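/- An $s$-term DNF formula over $n$ Boolean variables is a disjunction of (at most) $s$ conjunctions of literals. For a satisfiable $f:\{0,1\}^n\to\{0,1\}$ let $\mathcal U_{f^{-1}(1)}$ be the uniform distribution over its satisfying assignments. An $\varepsilon$-sampler for a distribution $D$ over $\{0,1\}^n$ is a Boolean circuit with $m$ input bits and $n$ output bits whose output, on uniformly random input bits, has a distribution $D'$ with total variation distance $d_{TV}(D',D)\le\varepsilon$. **Theorem.** There is a randomized algorithm (one algorithm for all parameters) with the following properties. For all $n$, $s$, all $\varepsilon,\delta>0$ and every satisfiable $f$ that has an $s$-term DNF formula over $n$ variables, given $n,s,\varepsilon,\delta$ (the last two rounded down to the form $1/k$ and $2^{-j}$, if they are smaller than $1$) and access to independent samples from $\mathcal U_{f^{-1}(1)}$, the algorithm outputs with probability at least $1-\delta$ an $\varepsilon$-sampler for $\mathcal U_{f^{-1}(1)}$. Its running time, which includes writing down the circuit and therefore bounds the size of the circuit and the number $m$ of its input bits, is $\mathrm{poly}\bigl(n^{\log_2(s/\varepsilon)},\log(1/\delta)\bigr)$ for every outcome of the samples and of the coin flips; here values of $n$ and $s/\varepsilon$ below $2$ are replaced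 by $2$, values of $\log_2(1/\delta)$ below $1$ are replaced by $1$, and the polynomial does not depend on $n,s,\varepsilon,\delta,f$. -/

import Mathlib

open MeasureTheory

namespace InvGen

/-! ## DNF formulas -/

/-- A literal over `n` Boolean variables: `(i, true)` is `xᵢ`, `(i, false)` is its negation. -/
abbrev Literal (n : ℕ) := Fin n × Bool

/-- A term: the conjunction of a list of literals (the empty one is the constant true). -/
abbrev Term (n : ℕ) := List (Literal n)

/-- A DNF formula: the disjunction of a list of terms (the empty one is the constant false). -/
abbrev DNF (n : ℕ) := List (Term n)

def Term.eval {n : ℕ} (T : Term n) (x : Fin n → Bool) : Bool :=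
  T.all fun l => x l.1 == l.2

def DNF.eval {n : ℕ} (φ : DNF n) (x : Fin n → Bool) : Bool :=
  φ.any fun T => Term.eval T x

/-- A family of concept classes, indexed by the number `n` of variables and a size parameter. -/
abbrev ConceptClass := (n : ℕ) → ℕ → Set ((Fin n → Bool) → Bool)

/-- The Boolean functions of `n` variables that have a DNF formula with (at most) `s` terms. -/
def DNFClass : ConceptClass := fun n s =>
  {f | ∃ φ : DNF n, φ.length ≤ s ∧ f = DNF.eval φ}

/-! ## Distributions -/

/-- The uniform distribution over the satisfying assignments of `f`. -/
noncomputable def unifSat {n : ℕ} (f : (Fin n → Bool) → Bool) (hf : ∃ x, f x = true) :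
    PMF (Fin n → Bool) :=
  PMF.uniformOfFinset (Finset.univ.filter fun x => f x = true)
    (by obtain ⟨x, hx⟩ := hf; exact ⟨x, by simp [hx]⟩)

/-- Total variation distance of two distributions over a finite set. -/
noncomputable def tvDist {α : Type*} [Fintype α] (D D' : PMF α) : ℝ :=
  (1 / 2) * ∑ x, |(D x).toReal - (D' x).toReal|

/-! ## Boolean circuits and samplers -/

/-- A gate of a Boolean circuit; its arguments are numbers of wires. -/
inductive Gate where
  | const (b : Bool)
  | not (a : ℕ)
  | and (a b : ℕ)
  | or (a b : ℕ)

/-- The value of a gate, given the values of the wires computed before it.  (A reference to a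
wire that does not exist yet reads as `false`.) -/
def Gate.eval (w : List Bool) : Gate → Bool
  | .const b => b
  | .not a => !(w.getD a false)
  | .and a b => w.getD a false && w.getD b false
  | .or a b => w.getD a false || w.getD b false

/-- A circuit with `numIn` input bits and `n` output bits.  Wires `0, …, numIn - 1` carry the
input, wire `numIn + i` carries the value of gate number `i`, and output bit `j` is read off
wire `outs j`. -/
structure Circuit (n : ℕ) where
  numIn : ℕ
  gates : List Gate
  outs : Fin n → ℕ

/-- The values of all wires on input `z`. -/
def Circuit.wires {n : ℕ} (C : Circuit n) (z : Fin C.numIn → Bool) : List Bool :=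
  C.gates.foldl (fun w g => w ++ [Gate.eval w g]) (List.ofFn z)

def Circuit.eval {n : ℕ} (C : Circuit n) (z : Fin C.numIn → Bool) : Fin n → Bool :=
  fun j => (C.wires z).getD (C.outs j) false

/-- `C` is a sampler for `D`: on uniformly random input bits its output has law `D`. -/
def Circuit.IsSampler {n : ℕ} (C : Circuit n) (D : PMF (Fin n → Bool)) : Prop :=
  (PMF.uniformOfFintype (Fin C.numIn → Bool)).map C.eval = D

/-- `C` is an `ε`-sampler for `D`: a sampler for some distribution within total variation
distance `ε` of `D`. -/
def Circuit.IsEpsSampler {n : ℕ} (ε : ℝ) (C : Circuit n) (D : PMF (Fin n → Bool)) : Prop :=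
  ∃ D' : PMF (Fin n → Bool), C.IsSampler D' ∧ tvDist D' D ≤ ε

def Gate.encode : Gate → List ℕ
  | .const b => [0, b.toNat, 0]
  | .not a => [1, a, 0]
  | .and a b => [2, a, b]
  | .or a b => [3, a, b]

/-- A circuit as a word on the output tape: the number of input bits in unary, a separator,
three numbers for each gate, and the numbers of the `n` output wires.  The word has
`numIn + 1 + 3 * (number of gates) + n` symbols, so the time to write it bounds the size of the
circuit, the number of its input bits included. -/
def Circuit.encode {n : ℕ} (C : Circuit n) : List ℕ :=
  List.replicate C.numIn 1 ++ [0] ++ C.gates.flatMap Gate.encode ++ List.ofFn C.outs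

/-! ## The machine model

A randomized random access machine with sample access to an unknown distribution over
`{0,1}ⁿ`, programmed in a structured language: natural number registers and arrays, addition and
truncated subtraction as the only arithmetic, tests for zero, coin flips, sample draws and an
output tape. One step per executed command or test; drawing a sample, that is `n` bits, takes
`n + 1` steps. As there is no multiplication, the numbers that arise within `t` steps have
`O(t)` more bits than the input numbers, so time is measured up to a polynomial as on a
Turing machine. -/

inductive Expr where
  | const (k : ℕ)
  | var (x : ℕ)
  | get (a : ℕ) (i : Expr)
  | add (e e' : Expr)
  | sub (e e' : Expr)

/-- Commands; `loop e p` repeats `p` as long as `e` is nonzero, `ite e p q` runs `p` if `e` is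
nonzero and `q` otherwise. -/
inductive Prog where
  | skip
  | assign (x : ℕ) (e : Expr)
  | store (a : ℕ) (i e : Expr)
  | flip (x : ℕ)
  | sample (a : ℕ)
  | emit (e : Expr)
  | seq (p q : Prog)
  | ite (e : Expr) (p q : Prog)
  | loop (e : Expr) (p : Prog)

/-- A memory state: registers, arrays, the output tape, and the numbers of samples and of coins
consumed so far. -/
structure State where
  var : ℕ → ℕ
  arr : ℕ → ℕ → ℕ
  out : List ℕ
  samples : ℕ
  coins : ℕ

def Expr.eval (st : State) : Expr → ℕ
  | .const k => k
  | .var x => st.var x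
  | .get a i => st.arr a (i.eval st)
  | .add e e' => e.eval st + e'.eval st
  | .sub e e' => e.eval st - e'.eval st

def State.setVar (st : State) (x v : ℕ) : State :=
  { st with var := Function.update st.var x v }

def State.setArr (st : State) (a i v : ℕ) : State :=
  { st with arr := Function.update st.arr a (Function.update (st.arr a) i v) }

/-- Consume a coin and write its value `b` into register `x`. -/
def State.flipCoin (st : State) (x : ℕ) (b : Bool) : State :=
  { st with
    var := Function.update st.var x b.toNat
    coins := st.coins + 1 }

/-- Consume a sample and write its `n` bits into cells `0, …, n - 1` of array `a`. -/
def State.loadSample {n : ℕ} (st : State) (a : ℕ) (x : Fin n → Bool) : State :=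
  { st with
    arr := Function.update st.arr a
      (fun i => if h : i < n then (x ⟨i, h⟩).toNat else st.arr a i)
    samples := st.samples + 1 }

/-- The randomness of a run: the sequence of samples (first component) and the sequence of coin
flips (second component) that the machine will see. -/
abbrev Tape (n : ℕ) := (ℕ → Fin n → Bool) × (ℕ → Bool)

/-- `Exec τ p st st' t`: program `p`, started in state `st` with randomness `τ`, halts in state
`st'` after `t` steps. -/
inductive Exec {n : ℕ} (τ : Tape n) : Prog → State → State → ℕ → Prop where
  | skip (st : State) : Exec τ .skip st st 1
  | assign (st : State) (x : ℕ) (e : Expr) :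
      Exec τ (.assign x e) st (st.setVar x (e.eval st)) 1
  | store (st : State) (a : ℕ) (i e : Expr) :
      Exec τ (.store a i e) st (st.setArr a (i.eval st) (e.eval st)) 1
  | flip (st : State) (x : ℕ) :
      Exec τ (.flip x) st (st.flipCoin x (τ.2 st.coins)) 1
  | sample (st : State) (a : ℕ) :
      Exec τ (.sample a) st (st.loadSample a (τ.1 st.samples)) (n + 1)
  | emit (st : State) (e : Expr) :
      Exec τ (.emit e) st { st with out := st.out ++ [e.eval st] } 1
  | seq {p q : Prog} {st st' st'' : State} {t t' : ℕ} :
      Exec τ p st st' t → Exec τ q st' st'' t' → Exec τ (.seq p q) st st'' (t + t')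
  | ite_true {e : Expr} {p q : Prog} {st st' : State} {t : ℕ} :
      e.eval st ≠ 0 → Exec τ p st st' t → Exec τ (.ite e p q) st st' (t + 1)
  | ite_false {e : Expr} {p q : Prog} {st st' : State} {t : ℕ} :
      e.eval st = 0 → Exec τ q st st' t → Exec τ (.ite e p q) st st' (t + 1)
  | loop_true {e : Expr} {p : Prog} {st st' st'' : State} {t t' : ℕ} :
      e.eval st ≠ 0 → Exec τ p st st' t → Exec τ (.loop e p) st' st'' t' →
      Exec τ (.loop e p) st st'' (t + t' + 1)
  | loop_false {e : Expr} {p : Prog} {st : State} :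
      e.eval st = 0 → Exec τ (.loop e p) st st 1

/-- The initial state on parameters `n`, `s`, `ε`, `δ`: the first four registers hold `n`, `s`,
`⌈1/ε⌉` and `⌈log₂ (1/δ)⌉` (so the machine sees the real parameters only after rounding them
down to the form `1/k` and `2⁻ʲ`); everything else is zero or empty. -/
noncomputable def initState (n s : ℕ) (ε δ : ℝ) : State where
  var := fun x =>
    if x = 0 then n else if x = 1 then s else if x = 2 then ⌈1 / ε⌉₊
    else if x = 3 then ⌈Real.logb 2 (1 / δ)⌉₊ else 0
  arr := fun _ _ => 0
  out := []
  samples := 0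
  coins := 0

/-- The law of the randomness with sample access to the uniform distribution over `f⁻¹(1)`:
independent samples and independent fair coins. -/
noncomputable def tapeLaw {n : ℕ} (f : (Fin n → Bool) → Bool) (hf : ∃ x, f x = true) :
    Measure (Tape n) :=
  (Measure.infinitePi fun _ : ℕ => (unifSat f hf).toMeasure).prod
    (Measure.infinitePi fun _ : ℕ => (PMF.uniformOfFintype Bool).toMeasure)

/-- `P` is an inverse approximate uniform generation algorithm for the class: for all
`ε, δ > 0` and every satisfiable `f` in the class, given sample access to the uniform
distribution over `f⁻¹(1)`, with probability at least `1 - δ` it halts with an `ε`-sampler for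
this distribution on its output tape. -/
def IsInverseGenerator (P : Prog) (𝒞 : ConceptClass) : Prop :=
  ∀ (n s : ℕ) (ε δ : ℝ), 0 < ε → 0 < δ →
    ∀ f ∈ 𝒞 n s, ∀ hf : ∃ x, f x = true,
      ENNReal.ofReal (1 - δ) ≤ tapeLaw f hf
        {τ | ∃ (st : State) (t : ℕ) (C : Circuit n),
          Exec τ P (initState n s ε δ) st t ∧ st.out = C.encode ∧
            C.IsEpsSampler ε (unifSat f hf)}

/-- `P` runs in time `T` on the class: whatever satisfying assignments of `f` it is given as
samples and whatever the coins are, it halts within `T n s ε δ` steps. -/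
def RunsInTime (P : Prog) (𝒞 : ConceptClass) (T : ℕ → ℕ → ℝ → ℝ → ℝ) : Prop :=
  ∀ (n s : ℕ) (ε δ : ℝ), 0 < ε → 0 < δ →
    ∀ f ∈ 𝒞 n s, ∀ τ : Tape n, (∀ i, f (τ.1 i) = true) →
      ∃ (st : State) (t : ℕ), Exec τ P (initState n s ε δ) st t ∧ (t : ℝ) ≤ T n s ε δ

/-- The quantity `n ^ log₂ (s/ε)`, with degenerate values of `n` and `s/ε` (below `2`)
replaced by `2`. -/
noncomputable def quasiPoly (n s : ℕ) (ε : ℝ) : ℝ :=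
  (max (n : ℝ) 2) ^ Real.logb 2 (max ((s : ℝ) / ε) 2)

/-- The quantity `log₂ (1/δ)`, with values below `1` replaced by `1`. -/
noncomputable def logInv (δ : ℝ) : ℝ :=
  max (Real.logb 2 (1 / δ)) 1

end InvGen

namespace InvGen

/-! ## Reasoning about programs -/

section Machine

/-! Write `S` for the satisfying set, `k = ⌈1/ε⌉` and `B` for the number of candidate terms. The
samples are used to find a set `H` close to `S` from both sides, given as a union of subcubes; the
circuit that is written then samples `H` almost uniformly.

Candidates. A term that covers a fraction `1/(4sk)` of `S` contains a whole block of `K = log n +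
O(1)` samples with probability at least `(4sk)^(-K)`. Given this, each free variable is constant on
the block with probability `2^(1-K)`, so with probability at least `1/2` the literals common to the
block are exactly those of the term (`card_goodBlocks`, `sampleLaw_no_goodBlock`). About `(4sk)^K`
blocks therefore reveal all heavy terms. This number is the only quasi-polynomial quantity; it has
the required form because `a ^ log b = b ^ log a` (`quasiPoly_eq`).

Selection. Let `p(C)` be the fraction of `S` that lies in `C`. Every subcube has `|S| p(C) ≤ |C|`,
with equality if and only if `C ⊆ S`. Hence subcubes inside `S` maximise `p(C)/|C|`, and this can be
tested by comparing candidates pairwise, with empirical frequencies and without knowing `|S|`. Some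
term has `p ≥ 1/s` and is among the candidates; comparison with it shows that a selected `C` has `|C
\ S| ≤ |S|/(4kB)` (`excess_le`, `GoodSamples.card_sdiff_le`). Only light terms can be missed. So `|H
\ S|` and `|S \ H|` are both at most `|S|/(4k)`.

Sampling. As in the Karp-Luby method, attempts run cyclically through the selected terms, and a
point drawn from a term is accepted only if no earlier selected term contains it. Larger subcubes
must be tried with larger probability. This is arranged by forcing only `ℓ` literals of each term,
the same `ℓ` for all, and leaving the others to chance, with `b` dummy coordinates that have to be
`1`. Every point of a term then arises from exactly `2^ℓ` of the `2^N` inputs, `N = n + b`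
(`card_attempt`). The last accepted point is the output. The number `b` makes the acceptance
probability of a whole cycle at most `1/(4k)`, so that the order inside a cycle hardly matters, but
at least `2^(-b)`, so that `4k * 2^b` cycles suffice (`cyclic_recursion_bound`,
`samplerCount_lower_bound`).

With `δ' = 1/(4k)`, both laws give each point of `S ∩ H` mass at least `(1-δ')^2 / ((1+δ')|S|)`, and
`|S ∩ H| ≥ (1-δ')|S|`, whence the distance is at most `4δ' = 1/k ≤ ε` (`tvDist_le_one_sub`,
`combine_bounds`).

The program is verified with a weakest-precondition calculus (`Wp`) that also bounds time: a fixed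
program whose loops make at most `X` passes takes time polynomial in `X`. `Wp.generatorP` says that
the emitted circuit computes `samplerBit`; what remains is counting and probability. -/

@[simp] theorem State.setVar_var (st : State) (x v y : ℕ) :
    (st.setVar x v).var y = if y = x then v else st.var y := by
  simp [State.setVar, Function.update_apply]

@[simp] theorem State.setVar_arr (st : State) (x v : ℕ) : (st.setVar x v).arr = st.arr := rfl
@[simp] theorem State.setVar_out (st : State) (x v : ℕ) : (st.setVar x v).out = st.out := rfl
@[simp] theorem State.setVar_samples (st : State) (x v : ℕ) :
    (st.setVar x v).samples = st.samples := rfl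

@[simp] theorem State.setArr_arr (st : State) (a i v c l : ℕ) :
    (st.setArr a i v).arr c l = if c = a ∧ l = i then v else st.arr c l := by
  by_cases hc : c = a
  · subst hc; simp [State.setArr, Function.update_apply]
  · simp [State.setArr, hc]

@[simp] theorem State.setArr_var (st : State) (a i v : ℕ) : (st.setArr a i v).var = st.var := rfl
@[simp] theorem State.setArr_out (st : State) (a i v : ℕ) : (st.setArr a i v).out = st.out := rfl
@[simp] theorem State.setArr_samples (st : State) (a i v : ℕ) :
    (st.setArr a i v).samples = st.samples := rfl

@[simp] theorem State.loadSample_arr {n : ℕ} (st : State) (a : ℕ) (x : Fin n → Bool) (c l : ℕ) :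
    (st.loadSample a x).arr c l =
      if c = a then (if h : l < n then (x ⟨l, h⟩).toNat else st.arr a l) else st.arr c l := by
  by_cases hc : c = a
  · subst hc; simp [State.loadSample]
  · simp [State.loadSample, hc]

@[simp] theorem State.loadSample_var {n : ℕ} (st : State) (a : ℕ) (x : Fin n → Bool) :
    (st.loadSample a x).var = st.var := rfl
@[simp] theorem State.loadSample_out {n : ℕ} (st : State) (a : ℕ) (x : Fin n → Bool) :
    (st.loadSample a x).out = st.out := rfl
@[simp] theorem State.loadSample_samples {n : ℕ} (st : State) (a : ℕ) (x : Fin n → Bool) :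
    (st.loadSample a x).samples = st.samples + 1 := rfl

/-- Does the program contain a command that writes register `y`? -/
def Prog.writesVar : Prog → ℕ → Bool
  | .assign x _, y => x == y
  | .flip x, y => x == y
  | .seq p q, y => p.writesVar y || q.writesVar y
  | .ite _ p q, y => p.writesVar y || q.writesVar y
  | .loop _ p, y => p.writesVar y
  | _, _ => false

/-- Does the program contain a command that writes array `c`? -/
def Prog.writesArr : Prog → ℕ → Bool
  | .store a _ _, c => a == c
  | .sample a, c => a == c
  | .seq p q, c => p.writesArr c || q.writesArr c
  | .ite _ p q, c => p.writesArr c || q.writesArr c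
  | .loop _ p, c => p.writesArr c
  | _, _ => false

/-- Does the program contain an output command? -/
def Prog.emits : Prog → Bool
  | .emit _ => true
  | .seq p q => p.emits || q.emits
  | .ite _ p q => p.emits || q.emits
  | .loop _ p => p.emits
  | _ => false

/-- Does the program contain a sampling command? -/
def Prog.draws : Prog → Bool
  | .sample _ => true
  | .seq p q => p.draws || q.draws
  | .ite _ p q => p.draws || q.draws
  | .loop _ p => p.draws
  | _ => false

/-- `st'` agrees with `st` on everything that `p` cannot change. -/
structure Frame (p : Prog) (st st' : State) : Prop where
  var : ∀ y, p.writesVar y = false → st'.var y = st.var y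
  arr : ∀ c, p.writesArr c = false → st'.arr c = st.arr c
  out : p.emits = false → st'.out = st.out
  samples : p.draws = false → st'.samples = st.samples

theorem Frame.refl (p : Prog) (st : State) : Frame p st st :=
  ⟨fun _ _ => rfl, fun _ _ => rfl, fun _ => rfl, fun _ => rfl⟩

theorem Frame.trans {p : Prog} {st st' st'' : State} (h : Frame p st st') (h' : Frame p st' st'') :
    Frame p st st'' :=
  ⟨fun y hy => (h'.var y hy).trans (h.var y hy), fun y hy => (h'.arr y hy).trans (h.arr y hy),
    fun hy => (h'.out hy).trans (h.out hy), fun hy => (h'.samples hy).trans (h.samples hy)⟩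

theorem Frame.of_sub {p q : Prog} {st st' : State} (h : Frame p st st')
    (hv : ∀ y, q.writesVar y = false → p.writesVar y = false)
    (ha : ∀ y, q.writesArr y = false → p.writesArr y = false)
    (ho : q.emits = false → p.emits = false) (hs : q.draws = false → p.draws = false) :
    Frame q st st' :=
  ⟨fun y hy => h.var y (hv y hy), fun y hy => h.arr y (ha y hy), fun hy => h.out (ho hy),
    fun hy => h.samples (hs hy)⟩

theorem Frame.seq_left {p q : Prog} {st st' : State} (h : Frame p st st') :
    Frame (.seq p q) st st' := by
  apply h.of_sub <;> simp +contextual [Prog.writesVar, Prog.writesArr, Prog.emits, Prog.draws]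

theorem Frame.seq_right {p q : Prog} {st st' : State} (h : Frame q st st') :
    Frame (.seq p q) st st' := by
  apply h.of_sub <;> simp +contextual [Prog.writesVar, Prog.writesArr, Prog.emits, Prog.draws]

theorem Frame.ite_left {e : Expr} {p q : Prog} {st st' : State} (h : Frame p st st') :
    Frame (.ite e p q) st st' := by
  apply h.of_sub <;> simp +contextual [Prog.writesVar, Prog.writesArr, Prog.emits, Prog.draws]

theorem Frame.ite_right {e : Expr} {p q : Prog} {st st' : State} (h : Frame q st st') :
    Frame (.ite e p q) st st' := by
  apply h.of_sub <;> simp +contextual [Prog.writesVar, Prog.writesArr, Prog.emits, Prog.draws]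

theorem Frame.loop {e : Expr} {p : Prog} {st st' : State} (h : Frame p st st') :
    Frame (.loop e p) st st' := by
  apply h.of_sub <;> simp +contextual [Prog.writesVar, Prog.writesArr, Prog.emits, Prog.draws]

/-- The frame conditions are syntactic, so for a concrete program they are settled by `rfl` or
`decide`. Loop invariants then need to mention only what the loop changes. -/
theorem Exec.frame {n : ℕ} {τ : Tape n} {p : Prog} {st st' : State} {t : ℕ}
    (h : Exec τ p st st' t) : Frame p st st' := by
  induction h with
  | skip st => exact Frame.refl _ _
  | assign st x e =>
    refine ⟨fun y hy => ?_, fun _ _ => rfl, fun _ => rfl, fun _ => rfl⟩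
    have : y ≠ x := by rintro rfl; simp [Prog.writesVar] at hy
    simp [this]
  | store st a i e =>
    refine ⟨fun _ _ => rfl, fun c hc => ?_, fun _ => rfl, fun _ => rfl⟩
    have : c ≠ a := by rintro rfl; simp [Prog.writesArr] at hc
    funext l; simp [this]
  | flip st x =>
    refine ⟨fun y hy => ?_, fun _ _ => rfl, fun _ => rfl, fun _ => rfl⟩
    have : y ≠ x := by rintro rfl; simp [Prog.writesVar] at hy
    simp [State.flipCoin, this]
  | sample st a =>
    refine ⟨fun _ _ => rfl, fun c hc => ?_, fun _ => rfl, fun h => by simp [Prog.draws] at h⟩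
    have : c ≠ a := by rintro rfl; simp [Prog.writesArr] at hc
    funext l; simp [this]
  | emit st e =>
    exact ⟨fun _ _ => rfl, fun _ _ => rfl, fun h => by simp [Prog.emits] at h, fun _ => rfl⟩
  | seq _ _ h1 h2 => exact h1.seq_left.trans h2.seq_right
  | ite_true _ _ h => exact h.ite_left
  | ite_false _ _ h => exact h.ite_right
  | loop_true _ _ _ h1 h2 => exact h1.loop.trans h2
  | loop_false _ => exact Frame.refl _ _

/-- A bound for the running time of a program all of whose loops make at most `X` passes. -/
def Prog.cost (X : ℕ) : Prog → ℕ
  | .seq p q => p.cost X + q.cost X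
  | .ite _ p q => p.cost X + q.cost X + 1
  | .loop _ p => X * (p.cost X + 1) + 1
  | .sample _ => X + 1
  | _ => 1

/-- For a fixed program the cost is a polynomial in `X`. Taking `X ≥ 2` lets additive constants and
sums be absorbed by raising the exponent. -/
theorem Prog.exists_cost_le_pow (p : Prog) : ∃ c, ∀ X, 2 ≤ X → p.cost X ≤ X ^ c := by
  have one : ∀ X : ℕ, 2 ≤ X → 1 ≤ X ^ 0 := by simp
  have add : ∀ {f g : ℕ → ℕ}, (∃ c, ∀ X, 2 ≤ X → f X ≤ X ^ c) → (∃ c, ∀ X, 2 ≤ X → g X ≤ X ^ c) →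
      ∃ c, ∀ X, 2 ≤ X → f X + g X ≤ X ^ c := by
    rintro f g ⟨c, hc⟩ ⟨d, hd⟩
    refine ⟨max c d + 1, fun X hX => ?_⟩
    have h1 : X ^ c ≤ X ^ max c d := Nat.pow_le_pow_right (by omega) (le_max_left _ _)
    have h2 : X ^ d ≤ X ^ max c d := Nat.pow_le_pow_right (by omega) (le_max_right _ _)
    have := hc X hX; have := hd X hX
    rw [pow_succ]
    nlinarith
  induction p with
  | seq p q hp hq => exact add hp hq
  | ite e p q hp hq => exact add (add hp hq) ⟨0, one⟩
  | loop e p hp =>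
    refine add ?_ ⟨0, one⟩
    obtain ⟨c, hc⟩ := add hp ⟨0, one⟩
    exact ⟨c + 1, fun X hX => by rw [pow_succ']; exact Nat.mul_le_mul_left _ (hc X hX)⟩
  | sample a => exact add ⟨1, by simp⟩ ⟨0, one⟩
  | _ => exact ⟨0, one⟩

/-- Started in `st`, program `p` halts within time `p.cost X`, in a state that satisfies `Q`. -/
def Wp {n : ℕ} (τ : Tape n) (X : ℕ) (p : Prog) (Q : State → Prop) (st : State) : Prop :=
  ∃ st' t, Exec τ p st st' t ∧ t ≤ p.cost X ∧ Q st'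

variable {n : ℕ} {τ : Tape n} {X : ℕ} {p q : Prog} {Q Q' : State → Prop} {st : State}

theorem Wp.mono (h : Wp τ X p Q st) (hQ : ∀ st', Frame p st st' → Q st' → Q' st') :
    Wp τ X p Q' st := by
  obtain ⟨st', t, hE, ht, hq⟩ := h
  exact ⟨st', t, hE, ht, hQ st' hE.frame hq⟩

theorem Wp.skip (h : Q st) : Wp τ X .skip Q st := ⟨_, _, .skip st, by simp [Prog.cost], h⟩

theorem Wp.assign {x : ℕ} {e : Expr} (h : Q (st.setVar x (e.eval st))) :
    Wp τ X (.assign x e) Q st := ⟨_, _, .assign st x e, by simp [Prog.cost], h⟩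

theorem Wp.store {a : ℕ} {i e : Expr} (h : Q (st.setArr a (i.eval st) (e.eval st))) :
    Wp τ X (.store a i e) Q st := ⟨_, _, .store st a i e, by simp [Prog.cost], h⟩

theorem Wp.sample {a : ℕ} (hn : n ≤ X) (h : Q (st.loadSample a (τ.1 st.samples))) :
    Wp τ X (.sample a) Q st := ⟨_, _, .sample st a, by simpa [Prog.cost] using hn, h⟩

theorem Wp.emit {e : Expr} (h : Q { st with out := st.out ++ [e.eval st] }) :
    Wp τ X (.emit e) Q st := ⟨_, _, .emit st e, by simp [Prog.cost], h⟩

theorem Wp.seq (h : Wp τ X p (Wp τ X q Q) st) : Wp τ X (.seq p q) Q st := by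
  obtain ⟨st', t, hE, ht, st'', t', hE', ht', hq⟩ := h
  exact ⟨st'', _, .seq hE hE', by simp only [Prog.cost]; omega, hq⟩

theorem Wp.ite {e : Expr} (h : e.eval st ≠ 0 → Wp τ X p Q st) (h' : e.eval st = 0 → Wp τ X q Q st) :
    Wp τ X (.ite e p q) Q st := by
  by_cases he : e.eval st = 0
  · obtain ⟨st', t, hE, ht, hq⟩ := h' he
    exact ⟨st', _, .ite_false he hE, by simp only [Prog.cost]; omega, hq⟩
  · obtain ⟨st', t, hE, ht, hq⟩ := h he
    exact ⟨st', _, .ite_true he hE, by simp only [Prog.cost]; omega, hq⟩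

/-- Run `p` for `x = 0, 1, …`, as long as `x` is less than register `y`. -/
def forUp (x y : ℕ) (p : Prog) : Prog :=
  .seq (.assign x (.const 0))
    (.loop (.sub (.var y) (.var x)) (.seq p (.assign x (.add (.var x) (.const 1)))))

/-- `I i` is the invariant before pass number `i`, with the counter already set to `i`. As the body
writes neither the counter nor the bound, the number of passes is the initial value of `y`. -/
theorem Wp.forUp {x y : ℕ} (I : ℕ → State → Prop) (hx : p.writesVar x = false)
    (hy : p.writesVar y = false) (hxy : x ≠ y) (hX : st.var y ≤ X) (h0 : I 0 (st.setVar x 0))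
    (hstep : ∀ i < st.var y, ∀ st1, Frame (forUp x y p) st st1 → st1.var x = i → I i st1 →
      Wp τ X p (fun st2 => I (i + 1) (st2.setVar x (i + 1))) st1)
    (hQ : ∀ st1, Frame (InvGen.forUp x y p) st st1 → I (st.var y) st1 → Q st1) :
    Wp τ X (InvGen.forUp x y p) Q st := by
  -- Induction on the number `d` of passes left; a pass costs the body, the increment and the loop
  -- test.
  have key : ∀ d i st1, i + d = st.var y → Frame (InvGen.forUp x y p) st st1 → st1.var x = i →
      I i st1 → ∃ st' t, Exec τ (.loop (.sub (.var y) (.var x))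
        (.seq p (.assign x (.add (.var x) (.const 1))))) st1 st' t ∧
        t ≤ d * (p.cost X + 2) + 1 ∧ Frame (InvGen.forUp x y p) st st' ∧ I (st.var y) st' := by
    have hyw : (InvGen.forUp x y p).writesVar y = false := by
      simp [InvGen.forUp, Prog.writesVar, hy, hxy]
    intro d
    induction d with
    | zero =>
      intro i st1 hi hf hxi hI
      refine ⟨st1, 1, .loop_false ?_, by simp, hf, by simpa [← hi] using hI⟩
      simp [Expr.eval, hxi, hf.var y hyw, ← hi]
    | succ d ih =>
      intro i st1 hi hf hxi hI
      obtain ⟨st2, t, hE, ht, hI2⟩ := hstep i (by omega) st1 hf hxi hI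
      have hf2 := hE.frame
      have hx2 : st2.var x = i := (hf2.var x hx).trans hxi
      have hE' : Exec τ (.seq p (.assign x (.add (.var x) (.const 1)))) st1
          (st2.setVar x (i + 1)) (t + 1) := by
        have := Exec.assign (τ := τ) st2 x (.add (.var x) (.const 1))
        simp only [Expr.eval, hx2] at this
        exact .seq hE this
      have hf3 : Frame (InvGen.forUp x y p) st (st2.setVar x (i + 1)) :=
        hf.trans (hE'.frame.loop.seq_right)
      obtain ⟨st', t', hE3, ht3, hf', hI'⟩ := ih (i + 1) _ (by omega) hf3 (by simp) hI2
      refine ⟨st', _, .loop_true ?_ hE' hE3, ?_, hf', hI'⟩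
      · simp only [Expr.eval, hxi, hf.var y hyw]; omega
      · rw [add_mul]; omega
  have hf0 : Frame (InvGen.forUp x y p) st (st.setVar x 0) :=
    (Exec.assign (τ := τ) st x (.const 0)).frame.seq_left
  obtain ⟨st', t, hE, ht, hf, hI⟩ := key (st.var y) 0 _ (by omega) hf0 (by simp) h0
  refine ⟨st', _, .seq (.assign st x (.const 0)) hE, ?_, hQ st' hf hI⟩
  have : st.var y * (p.cost X + 2) ≤ X * (p.cost X + 2) := Nat.mul_le_mul_right _ hX
  simp only [InvGen.forUp, Prog.cost]
  have e : X * (p.cost X + 1 + 1) = X * (p.cost X + 2) := rfl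
  omega

end Machine

/-! ## The program -/

infixr:60 " ;; " => Prog.seq

/-- `z := x * y`, by repeated addition. -/
def mulP (z x y : ℕ) : Prog :=
  .assign z (.const 0) ;; forUp 20 y (.assign z (.add (.var z) (.var x)))

/-- `c := ⌈log₂ y⌉` and `z := 2 ^ c`. -/
def clogP (c z y : ℕ) : Prog :=
  .assign z (.const 1) ;; .assign c (.const 0) ;;
  forUp 20 y (.ite (.sub (.var y) (.var z))
    (.assign z (.add (.var z) (.var z)) ;; .assign c (.add (.var c) (.const 1))) .skip)

/-- `z := x ^ y`. -/
def powP (z x y : ℕ) : Prog :=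
  .assign z (.const 1) ;;
  forUp 21 y (mulP 22 z x ;; .assign z (.var 22))

def dblP (z : ℕ) : Prog := .assign z (.add (.var z) (.var z))

/-! Registers `0, …, 3` hold the input; the parameters of the algorithm are kept in registers
`4, …, 15` and do not change after they have been computed. -/

notation "rn" => (0 : ℕ)
notation "rs" => (1 : ℕ)
notation "rk" => (2 : ℕ)
notation "rj" => (3 : ℕ)
notation "rB" => (4 : ℕ)
notation "rb" => (5 : ℕ)
notation "rN" => (6 : ℕ)
notation "re" => (7 : ℕ)
notation "rm" => (8 : ℕ)
notation "rL" => (9 : ℕ)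
notation "rZ" => (10 : ℕ)
notation "rK" => (11 : ℕ)

-- Scratch registers. `rT`, `rV`, `rJ`, `rI`, `rC` are loop counters and `rBase`, `rBase'` starts of
-- rows. While the circuit is written, `rG` is the number of the next wire, `rq` the first input bit
-- of the attempt, and `rOne`, `rt`, `rAny`, `rAcc`, `rRej` hold wires: constant true, test of a
-- term, some earlier term satisfied, accepted, rejected.
notation "rT" => (20 : ℕ)
notation "rV" => (21 : ℕ)
notation "rJ" => (22 : ℕ)
notation "rI" => (23 : ℕ)
notation "rC" => (24 : ℕ)
notation "rBase" => (25 : ℕ)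
notation "rBase'" => (26 : ℕ)
notation "rFlag" => (27 : ℕ)
notation "rx" => (28 : ℕ)
notation "ry" => (29 : ℕ)
notation "rf" => (30 : ℕ)
notation "rF" => (31 : ℕ)
notation "rEll" => (32 : ℕ)
notation "rG" => (33 : ℕ)
notation "rOne" => (34 : ℕ)
notation "rq" => (35 : ℕ)
notation "rAny" => (36 : ℕ)
notation "rt" => (37 : ℕ)
notation "rAcc" => (38 : ℕ)
notation "rRej" => (39 : ℕ)

-- The arrays: current sample, rows of the candidate terms (stored one after the other, each of
-- length `N`), counts, numbers of free variables, selection flags, wires of the point of the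
-- current attempt, wires of the current output.
notation "aX" => (0 : ℕ)
notation "aR" => (1 : ℕ)
notation "aC" => (2 : ℕ)
notation "aF" => (3 : ℕ)
notation "aK" => (4 : ℕ)
notation "aW" => (5 : ℕ)
notation "aO" => (6 : ℕ)

/-- The computation of the parameters. -/
def paramsP : Prog :=
  mulP 40 rs rk ;; .assign 41 (.add (.add (.var 40) (.var 40)) (.add (.var 40) (.var 40))) ;;
  clogP 42 43 rn ;; .assign rK (.add (.var 42) (.const 1)) ;;
  .assign 42 (.add (.var 42) (.const 2)) ;; powP 44 41 42 ;;
  .assign 45 (.add (.add (.var rj) (.var rs)) (.const 1)) ;; mulP rB 44 45 ;; dblP rB ;;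
  mulP 46 rk rB ;; dblP 46 ;; dblP 46 ;; clogP rb 47 46 ;;
  .assign rN (.add (.var rn) (.var rb)) ;;
  mulP 48 40 rB ;; dblP 48 ;; dblP 48 ;; dblP 48 ;; dblP 48 ;; dblP 48 ;;
  .assign 49 (.add (.add (.var rn) (.var rn)) (.add (.var rj) (.const 2))) ;;
  mulP re 48 49 ;; mulP rm 48 re ;;
  mulP rL rk 47 ;; dblP rL ;; dblP rL ;; mulP 50 rL rB ;; mulP rZ 50 rN

/-- Sampling of the candidate terms: term number `i` consists of the literals that are common to
all samples of the `i`-th block. -/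
def candP : Prog :=
  forUp rV rb (.store aX (.add (.var rn) (.var rV)) (.const 1)) ;;
  .assign rBase (.const 0) ;;
  forUp rJ rB
    (.sample aX ;;
     forUp rV rN (.store aR (.add (.var rBase) (.var rV)) (.get aX (.var rV))) ;;
     forUp rT rK
      (.sample aX ;;
       forUp rV rN
        (.ite (.add (.sub (.get aR (.add (.var rBase) (.var rV))) (.get aX (.var rV)))
                (.sub (.get aX (.var rV)) (.get aR (.add (.var rBase) (.var rV)))))
          (.store aR (.add (.var rBase) (.var rV)) (.const 2)) .skip)) ;;
     .assign rBase (.add (.var rBase) (.var rN)))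

/-- Counting the samples that satisfy each candidate term. -/
def countP : Prog :=
  forUp rT rm
    (.sample aX ;;
     .assign rBase (.const 0) ;;
     forUp rJ rB
      (.assign rFlag (.const 0) ;;
       forUp rV rN
        (.ite (.sub (.const 2) (.get aR (.add (.var rBase) (.var rV))))
          (.ite (.add (.sub (.get aR (.add (.var rBase) (.var rV))) (.get aX (.var rV)))
                  (.sub (.get aX (.var rV)) (.get aR (.add (.var rBase) (.var rV)))))
            (.assign rFlag (.const 1)) .skip) .skip) ;;
       .ite (.var rFlag) .skip (.store aC (.var rJ) (.add (.get aC (.var rJ)) (.const 1))) ;;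
       .assign rBase (.add (.var rBase) (.var rN))))

/-- Counting the free variables of each candidate term. -/
def freeP : Prog :=
  .assign rBase (.const 0) ;;
  forUp rJ rB
    (forUp rV rN
      (.ite (.sub (.get aR (.add (.var rBase) (.var rV))) (.const 1))
        (.store aF (.var rJ) (.add (.get aF (.var rJ)) (.const 1))) .skip) ;;
     .assign rBase (.add (.var rBase) (.var rN)))

/-- Selection of the candidate terms. -/
def keepP : Prog :=
  forUp rJ rB
    (.store aK (.var rJ) (.const 1) ;;
     forUp rI rB
      (.assign rx (.sub (.get aC (.var rI)) (.var re)) ;;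
       .assign rf (.get aF (.var rJ)) ;;
       forUp rT rf (dblP rx) ;;
       .assign ry (.add (.get aC (.var rJ)) (.var re)) ;;
       .assign rf (.get aF (.var rI)) ;;
       forUp rT rf (dblP ry) ;;
       .ite (.sub (.var rx) (.var ry)) (.store aK (.var rJ) (.const 0)) .skip))

/-- The least number of literals of a selected term. -/
def ellP : Prog :=
  .assign rF (.const 0) ;;
  forUp rJ rB
    (.ite (.get aK (.var rJ))
      (.ite (.sub (.get aF (.var rJ)) (.var rF)) (.assign rF (.get aF (.var rJ))) .skip) .skip) ;;
  .assign rEll (.sub (.var rn) (.var rF))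

/-- Output of a gate. -/
def gateP (o x y : Expr) : Prog :=
  .emit o ;; .emit x ;; .emit y ;; .assign rG (.add (.var rG) (.const 1))

/-- The part of the circuit that tests the term whose row starts at `rBase'` on the wires listed
in array `aW`. -/
def satP : Prog :=
  .assign rt (.var rOne) ;;
  forUp rV rN
    (.ite (.sub (.const 2) (.get aR (.add (.var rBase') (.var rV))))
      (.ite (.get aR (.add (.var rBase') (.var rV)))
        (gateP (.const 2) (.var rt) (.get aW (.var rV)) ;;
         .assign rt (.sub (.var rG) (.const 1)))
        (gateP (.const 1) (.get aW (.var rV)) (.const 0) ;;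
         gateP (.const 2) (.var rt) (.sub (.var rG) (.const 1)) ;;
         .assign rt (.sub (.var rG) (.const 1))))
      .skip)

/-- The choice of the wires for a random point of a subcube in which `rEll` of the literals of
the term number `rJ` are satisfied. -/
def pointP : Prog :=
  .assign rf (.var rEll) ;;
  forUp rV rN
    (.store aW (.var rV) (.add (.var rq) (.var rV)) ;;
     .ite (.sub (.const 2) (.get aR (.add (.var rBase) (.var rV))))
      (.ite (.var rf)
        (.store aW (.var rV) (.add (.var rZ) (.get aR (.add (.var rBase) (.var rV)))) ;;
         .assign rf (.sub (.var rf) (.const 1))) .skip) .skip)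

/-- The test of the selected terms before number `rJ`. -/
def earlierP : Prog :=
  .assign rAny (.var rZ) ;;
  .assign rBase' (.const 0) ;;
  forUp rI rJ
    (.ite (.get aK (.var rI))
      (satP ;; gateP (.const 3) (.var rAny) (.var rt) ;;
       .assign rAny (.sub (.var rG) (.const 1))) .skip ;;
     .assign rBase' (.add (.var rBase') (.var rN)))

/-- The selection between the new point and the old output. -/
def muxP : Prog :=
  forUp rV rn
    (gateP (.const 2) (.var rAcc) (.get aW (.var rV)) ;;
     gateP (.const 2) (.var rRej) (.get aO (.var rV)) ;;
     gateP (.const 3) (.sub (.var rG) (.const 2)) (.sub (.var rG) (.const 1)) ;;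
     .store aO (.var rV) (.sub (.var rG) (.const 1)))

/-- One attempt of the sampler, with term number `rJ`. -/
def attemptP : Prog :=
  pointP ;; earlierP ;; .assign rBase' (.var rBase) ;; satP ;;
  gateP (.const 1) (.var rAny) (.const 0) ;;
  gateP (.const 2) (.var rt) (.sub (.var rG) (.const 1)) ;;
  .assign rAcc (.sub (.var rG) (.const 1)) ;;
  gateP (.const 1) (.var rAcc) (.const 0) ;;
  .assign rRej (.sub (.var rG) (.const 1)) ;;
  muxP

/-- Output of the sampler. -/
def circuitP : Prog :=
  forUp rT rZ (.emit (.const 1)) ;; .emit (.const 0) ;;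
  .assign rG (.var rZ) ;;
  gateP (.const 0) (.const 0) (.const 0) ;; gateP (.const 0) (.const 1) (.const 0) ;;
  .assign rOne (.sub (.var rG) (.const 1)) ;;
  forUp rV rn (.store aO (.var rV) (.var rZ)) ;;
  .assign rq (.const 0) ;;
  forUp rC rL
    (.assign rBase (.const 0) ;;
     forUp rJ rB
      (.ite (.get aK (.var rJ)) attemptP .skip ;;
       .assign rq (.add (.var rq) (.var rN)) ;;
       .assign rBase (.add (.var rBase) (.var rN)))) ;;
  forUp rV rn (.emit (.get aO (.var rV)))

/-- Output of a circuit that always answers `(0, …, 0)`. -/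
def trivialP : Prog := .emit (.const 0) ;; forUp rV rn (.emit (.const 0))

/-- The inverse approximate uniform generation algorithm for DNF formulas. -/
def generatorP : Prog :=
  .ite (.sub (.var rk) (.const 1))
    (paramsP ;; candP ;; countP ;; freeP ;; keepP ;; ellP ;; circuitP) trivialP

/-! ## The parameters -/

section Params

/-- Chosen such that `4 * n ≤ 2 ^ blockLen n`, which makes a block inside a subcube reveal it with
probability at least `1/2`. -/
def blockLen (n : ℕ) : ℕ := Nat.clog 2 n + 2
-- The inverse of the guaranteed probability that a block lies in a term of density `1/(4sk)`.
def invHit (n s k : ℕ) : ℕ := (4 * (s * k)) ^ blockLen n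
-- The factor `2` pays for blocks that fix too many variables; `j + s + 1` is the exponent of the
-- failure probability for a single term, with room for a union bound over the terms.
def numCand (n s k j : ℕ) : ℕ := 2 * (invHit n s k * (j + s + 1))
-- The number `b` of dummy coordinates; `2 ^ b ≥ 4kB` brings the acceptance probability of a cycle
-- down to `1/(4k)`.
def coinLen (n s k j : ℕ) : ℕ := Nat.clog 2 (4 * (k * numCand n s k j))
-- The inverse of the tolerance `slack / numEst` for the empirical frequencies.
def invTol (n s k j : ℕ) : ℕ := 32 * (s * k * numCand n s k j)
-- With `u = 2n + j + 2` and `H = invTol` the tolerated deviation is `e = Hu` among `m = He`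
-- samples, so the exponent `2e²/m` of Hoeffding's inequality is `2u`; the summand `2n` pays for all
-- `3 ^ n` subcubes.
def slack (n s k j : ℕ) : ℕ := invTol n s k j * (2 * n + j + 2)
def numEst (n s k j : ℕ) : ℕ := invTol n s k j * slack n s k j
def numCycles (n s k j : ℕ) : ℕ := 4 * (k * 2 ^ coinLen n s k j)
def numInputs (n s k j : ℕ) : ℕ :=
  numCycles n s k j * numCand n s k j * (n + coinLen n s k j)

/-- The parameters of the algorithm. -/
structure Dims where
  n : ℕ
  B : ℕ
  b : ℕ
  e : ℕ
  m : ℕ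
  L : ℕ
  K : ℕ

def Dims.N (d : Dims) : ℕ := d.n + d.b

/-- The parameters stand in their registers. -/
structure Dims.Holds (d : Dims) (st : State) : Prop where
  n : st.var rn = d.n
  B : st.var rB = d.B
  b : st.var rb = d.b
  N : st.var rN = d.N
  e : st.var re = d.e
  m : st.var rm = d.m
  L : st.var rL = d.L
  Z : st.var rZ = d.L * d.B * d.N
  K : st.var rK = d.K

theorem Dims.Holds.of_eq {d : Dims} {st st' : State} (h : d.Holds st)
    (hv : ∀ y < 12, st'.var y = st.var y) : d.Holds st' := by
  constructor <;> rw [hv _ (by norm_num)]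
  exacts [h.n, h.B, h.b, h.N, h.e, h.m, h.L, h.Z, h.K]

theorem Dims.Holds.frame {d : Dims} {p : Prog} {st st' : State} (h : d.Holds st)
    (hf : Frame p st st') (hw : ∀ y < 12, p.writesVar y = false) : d.Holds st' :=
  h.of_eq fun y hy => hf.var y (hw y hy)

/-- A block consists of `K + 1 = blockLen n` samples: one that is copied and `K` that are compared
with it. -/
def dims (n s k j : ℕ) : Dims where
  n := n
  B := numCand n s k j
  b := coinLen n s k j
  e := slack n s k j
  m := numEst n s k j
  L := numCycles n s k j
  K := Nat.clog 2 n + 1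

variable {n : ℕ} {τ : Tape n} {X : ℕ} {Q : State → Prop} {st : State}

theorem State.ext' {st st' : State} (hv : ∀ y, st.var y = st'.var y) (ha : st.arr = st'.arr)
    (ho : st.out = st'.out) (hs : st.samples = st'.samples) (hc : st.coins = st'.coins) :
    st = st' := by
  cases st; cases st'
  simp only [State.mk.injEq] at *
  exact ⟨funext hv, ha, ho, hs, hc⟩

theorem Wp.mulP {z x y : ℕ} (hzx : z ≠ x) (hzy : z ≠ y) (hz : z ≠ 20) (hx : x ≠ 20) (hy : y ≠ 20)
    (hX : st.var y ≤ X)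
    (hQ : Q ((st.setVar z (st.var x * st.var y)).setVar 20 (st.var y))) :
    Wp τ X (InvGen.mulP z x y) Q st := by
  refine .seq (.assign (.forUp
    (fun i st1 => st1 = (st.setVar z (st.var x * i)).setVar 20 i) ?_ ?_ hy.symm ?_ ?_ ?_ ?_))
  · simp [Prog.writesVar, hz]
  · simp [Prog.writesVar, hzy]
  · simpa [hzy.symm] using hX
  · simp [Expr.eval]
  · rintro i hi st1 - - rfl
    refine .assign (State.ext' (fun w => ?_) rfl rfl rfl rfl)
    simp only [Expr.eval, State.setVar_var, hz, hzx.symm, hx, if_true, if_false]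
    split_ifs <;> simp [mul_add]
  · rintro st1 - rfl
    simpa [hzy.symm] using hQ

/-- The loop makes `y` passes, more than needed: doubling stops once the power reaches `y`, which
gives the minimum in the invariant, and `Nat.clog 2 y ≤ y` removes it at the end. -/
theorem Wp.clogP {c z y : ℕ} (hcz : c ≠ z) (hcy : c ≠ y) (hzy : z ≠ y) (hc : c ≠ 20) (hz : z ≠ 20)
    (hy : y ≠ 20) (hX : st.var y ≤ X)
    (hQ : Q (((st.setVar z (2 ^ Nat.clog 2 (st.var y))).setVar c (Nat.clog 2 (st.var y))).setVar 20
      (st.var y))) :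
    Wp τ X (InvGen.clogP c z y) Q st := by
  refine .seq (.assign (.seq (.assign (.forUp (fun i st1 => st1 =
    ((st.setVar z (2 ^ min i (Nat.clog 2 (st.var y)))).setVar c
      (min i (Nat.clog 2 (st.var y)))).setVar 20 i) ?_ ?_ hy.symm ?_ ?_ ?_ ?_))))
  · simp [Prog.writesVar, hc, hz]
  · simp [Prog.writesVar, hcy, hzy]
  · simpa [hcy.symm, hzy.symm] using hX
  · simp [Expr.eval]
  · rintro i hi st1 - - rfl
    have hlt : 2 ^ min i (Nat.clog 2 (st.var y)) < st.var y ↔ i < Nat.clog 2 (st.var y) := by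
      rw [← Nat.lt_clog_iff_pow_lt (by norm_num)]
      omega
    refine .ite (fun h => ?_) (fun h => ?_)
    · simp [Expr.eval, hcz.symm, hy, hzy.symm, hcy.symm, hz, Nat.sub_eq_zero_iff_le, hlt] at h
      refine .seq (.assign (.assign (State.ext' (fun w => ?_) rfl rfl rfl rfl)))
      have e1 : min i (Nat.clog 2 (st.var y)) = i := by omega
      have e2 : min (i + 1) (Nat.clog 2 (st.var y)) = i + 1 := by omega
      simp only [Expr.eval, State.setVar_var, hz, hcz, hcz.symm, hc, if_true, if_false, e1, e2]
      split_ifs <;> simp [pow_succ, mul_two]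
    · simp [Expr.eval, hcz.symm, hy, hzy.symm, hcy.symm, hz, Nat.sub_eq_zero_iff_le] at h
      have h' : ¬ i < Nat.clog 2 (st.var y) := by rw [← hlt]; omega
      refine .skip (State.ext' (fun w => ?_) rfl rfl rfl rfl)
      have e1 : min i (Nat.clog 2 (st.var y)) = Nat.clog 2 (st.var y) := by omega
      have e2 : min (i + 1) (Nat.clog 2 (st.var y)) = Nat.clog 2 (st.var y) := by omega
      simp only [State.setVar_var, e1, e2]
      split_ifs <;> rfl
  · rintro st1 - rfl
    have : Nat.clog 2 (st.var y) ≤ st.var y :=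
      (Nat.clog_le_of_le_pow (Nat.lt_two_pow_self).le)
    simpa [hzy.symm, hcy.symm, min_eq_right this] using hQ

theorem Wp.powP {z x y : ℕ} (hzx : z ≠ x) (hzy : z ≠ y) (hz : 22 < z) (hx : 22 < x) (hy : 22 < y)
    (hX : st.var y ≤ X) (hX' : st.var x ≤ X)
    (hQ : ∀ st', (∀ w, w ≠ z → w ≠ 20 → w ≠ 21 → w ≠ 22 → st'.var w = st.var w) →
      st'.var z = st.var x ^ st.var y → st'.arr = st.arr → st'.out = st.out →
      st'.samples = st.samples → Q st') :
    Wp τ X (InvGen.powP z x y) Q st := by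
  refine .seq (.assign (.forUp (fun i st1 => (∀ w, w ≠ z → w ≠ 20 → w ≠ 21 → w ≠ 22 →
      st1.var w = st.var w) ∧ st1.var z = st.var x ^ i) ?_ ?_ (by omega) ?_ ?_ ?_ ?_))
  · simp [Prog.writesVar, InvGen.mulP, InvGen.forUp]; omega
  · simp [Prog.writesVar, InvGen.mulP, InvGen.forUp]; omega
  · simpa [hzy.symm] using hX
  · refine ⟨fun w h1 h2 h3 h4 => by simp [h1, h3], ?_⟩
    have : z ≠ 21 := by omega
    simp [Expr.eval, this]
  · rintro i hi st1 - - ⟨h1, h2⟩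
    have hxv : st1.var x = st.var x := h1 x (by omega) (by omega) (by omega) (by omega)
    refine .seq (.mulP (by omega) (by omega) (by omega) (by omega) (by omega) (by rw [hxv]; exact hX')
      (.assign ⟨fun w h3 h4 h5 h6 => ?_, ?_⟩))
    · simpa [h3, h4, h5, h6] using h1 w h3 h4 h5 h6
    · have : z ≠ 21 := by omega
      simp [Expr.eval, this, h2, hxv, pow_succ]
  · rintro st1 hf ⟨h1, h2⟩
    refine hQ st1 h1 ?_ ?_ ?_ ?_
    · simpa [hzy.symm] using h2
    · funext c; exact hf.arr c rfl
    · exact hf.out rfl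
    · exact hf.samples rfl

theorem Wp.dblP {z : ℕ} (hQ : Q (st.setVar z (2 * st.var z))) : Wp τ X (InvGen.dblP z) Q st :=
  .assign (by simpa [Expr.eval, two_mul] using hQ)

/-- All loops of the program make at most `X` passes. -/
structure Fits (n s k j X : ℕ) : Prop where
  le_n : n ≤ X
  le_k : k ≤ X
  le_block : blockLen n ≤ X
  le_base : 4 * (s * k) ≤ X
  le_js : j + s + 1 ≤ X
  le_B : numCand n s k j ≤ X
  le_kB : 4 * (k * numCand n s k j) ≤ X
  le_u : 2 * n + j + 2 ≤ X
  le_e : slack n s k j ≤ X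
  le_m : numEst n s k j ≤ X
  le_L : numCycles n s k j ≤ X
  le_N : n + coinLen n s k j ≤ X
  le_Z : numInputs n s k j ≤ X
  le_pow : 2 ^ coinLen n s k j ≤ X

/-- Symbolic execution. Each `change` folds the value just computed into its named parameter, to
which the corresponding bound of `Fits` applies. -/
theorem Wp.paramsP {s k j : ℕ} (hX : Fits n s k j X) (h0 : st.var rn = n) (h1 : st.var rs = s)
    (h2 : st.var rk = k) (h3 : st.var rj = j)
    (hQ : ∀ st', Frame InvGen.paramsP st st' → (dims n s k j).Holds st' → Q st') :
    Wp τ X InvGen.paramsP Q st := by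
  suffices h : Wp τ X InvGen.paramsP (fun st' => (dims n s k j).Holds st') st from
    h.mono hQ
  refine .seq (.mulP (by decide) (by decide) (by decide) (by decide) (by decide)
    (by simpa [h2] using hX.le_k) (.seq (.assign ?_)))
  simp only [Expr.eval, State.setVar_var, Nat.reduceEqDiff, if_true, if_false, h1, h2]
  refine .seq (.clogP (by decide) (by decide) (by decide) (by decide) (by decide) (by decide)
    (by simpa [h0] using hX.le_n) ?_)
  simp [h0]
  refine .seq (.assign (.seq (.assign ?_)))
  simp [Expr.eval]
  refine .seq (.powP (by decide) (by decide) (by decide) (by decide) (by decide)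
    (by simpa [blockLen] using hX.le_block) ?_ ?_)
  · have := hX.le_base
    simp; omega
  rintro st1 hv1 hp - - -
  have g0 : st1.var rn = n := by rw [hv1] <;> simp [h0]
  have g1 : st1.var rs = s := by rw [hv1] <;> simp [h1]
  have g2 : st1.var rk = k := by rw [hv1] <;> simp [h2]
  have g3 : st1.var rj = j := by rw [hv1] <;> simp [h3]
  have g4 : st1.var 40 = s * k := by rw [hv1] <;> simp
  have g5 : st1.var rK = Nat.clog 2 n + 1 := by rw [hv1] <;> simp
  have g6 : st1.var 44 = invHit n s k := by
    rw [hp]; simp [invHit, blockLen]; ring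
  clear hv1 hp
  refine .seq (.assign ?_)
  simp [Expr.eval, g1, g3]
  refine .seq (.mulP (by decide) (by decide) (by decide) (by decide) (by decide)
    (by simpa using hX.le_js) ?_)
  simp [g6]
  refine .seq (.dblP ?_)
  simp only [State.setVar_var, Nat.reduceEqDiff, if_true, if_false]
  change Wp τ X _ _ (State.setVar _ rB (numCand n s k j))
  refine .seq (.mulP (by decide) (by decide) (by decide) (by decide) (by decide) ?_ ?_)
  · simpa using hX.le_B
  simp [g2]
  refine .seq (.dblP (.seq (.dblP ?_)))
  have e1 : 2 * (2 * (k * numCand n s k j)) = 4 * (k * numCand n s k j) := by ring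
  simp [e1]
  refine .seq (.clogP (by decide) (by decide) (by decide) (by decide) (by decide) (by decide)
    ?_ ?_)
  · simpa using hX.le_kB
  simp
  change Wp τ X _ _ (State.setVar (State.setVar (State.setVar _ 47 (2 ^ coinLen n s k j)) _
    (coinLen n s k j)) _ _)
  refine .seq (.assign ?_)
  simp [Expr.eval, g0]
  refine .seq (.mulP (by decide) (by decide) (by decide) (by decide) (by decide) ?_ ?_)
  · simpa using hX.le_B
  simp [g4]
  refine .seq (.dblP (.seq (.dblP (.seq (.dblP (.seq (.dblP (.seq (.dblP ?_)))))))))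
  have e2 : 2 * (2 * (2 * (2 * (2 * (s * k * numCand n s k j))))) = invTol n s k j := by
    unfold invTol; ring
  simp [e2]
  refine .seq (.assign ?_)
  have e3 : n + n + (j + 2) = 2 * n + j + 2 := by ring
  simp [Expr.eval, g0, g3, e3]
  refine .seq (.mulP (by decide) (by decide) (by decide) (by decide) (by decide) ?_ ?_)
  · simpa using hX.le_u
  simp
  change Wp τ X _ _ (State.setVar (State.setVar _ _ (slack n s k j)) _ _)
  refine .seq (.mulP (by decide) (by decide) (by decide) (by decide) (by decide) ?_ ?_)
  · simpa using hX.le_e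
  simp
  refine .seq (.mulP (by decide) (by decide) (by decide) (by decide) (by decide) ?_ ?_)
  · simpa using hX.le_pow
  simp [g2]
  refine .seq (.dblP (.seq (.dblP ?_)))
  have e4 : 2 * (2 * (k * 2 ^ coinLen n s k j)) = numCycles n s k j := by
    unfold numCycles; ring
  simp [e4]
  refine .seq (.mulP (by decide) (by decide) (by decide) (by decide) (by decide) ?_ ?_)
  · simpa using hX.le_B
  refine .mulP (by decide) (by decide) (by decide) (by decide) (by decide) ?_ ?_
  · simpa using hX.le_N
  constructor <;> simp [dims, Dims.N, numEst, g0, g5]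

end Params

/-! ## The phases of the program before the output -/

section Phases

variable {n : ℕ}

/-- Coordinate `v` of sample number `t`, where all coordinates from `n` on are `1`. -/
def extSample (τ : Tape n) (t v : ℕ) : ℕ := if h : v < n then (τ.1 t ⟨v, h⟩).toNat else 1

/-- The row of a candidate term after reading samples `t₀, …, t₀ + t`. -/
def commonRow (τ : Tape n) (t₀ t v : ℕ) : ℕ :=
  if ∀ t' ≤ t, extSample τ (t₀ + t') v = extSample τ t₀ v then extSample τ t₀ v else 2

/-- The row of candidate term number `i`: entry `v` is the required value of variable `v`, and
`2` if there is none. -/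
def candRow (d : Dims) (τ : Tape n) (i v : ℕ) : ℕ := commonRow τ (i * (d.K + 1)) d.K v

def rowSat (N : ℕ) (r x : ℕ → ℕ) : Prop := ∀ v < N, r v = 2 ∨ r v = x v

instance (N : ℕ) (r x : ℕ → ℕ) : Decidable (rowSat N r x) := by unfold rowSat; infer_instance

/-- The number of samples of the second phase that satisfy candidate term number `i`. -/
def candCount (d : Dims) (τ : Tape n) (i : ℕ) : ℕ :=
  Nat.count (fun t => rowSat d.N (candRow d τ i) (extSample τ (d.B * (d.K + 1) + t))) d.m

/-- The number of free variables of candidate term number `i`. -/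
def candFree (d : Dims) (τ : Tape n) (i : ℕ) : ℕ := Nat.count (fun v => candRow d τ i v = 2) d.N

/-- The test for the selection of candidate term number `i`. -/
def candKeep (d : Dims) (τ : Tape n) (i : ℕ) : Prop :=
  ∀ i' < d.B, 2 ^ candFree d τ i * (candCount d τ i' - d.e) ≤
    2 ^ candFree d τ i' * (candCount d τ i + d.e)

instance (d : Dims) (τ : Tape n) (i : ℕ) : Decidable (candKeep d τ i) := by
  unfold candKeep; infer_instance

/-- The largest number of free variables of a selected term. -/
def maxFree (d : Dims) (τ : Tape n) : ℕ :=
  ((Finset.range d.B).filter (candKeep d τ)).sup (candFree d τ)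

theorem extSample_le_one (τ : Tape n) (t v : ℕ) : extSample τ t v ≤ 1 := by
  unfold extSample; split_ifs
  · exact Bool.toNat_le _
  · exact le_rfl

theorem commonRow_zero (τ : Tape n) (t₀ v : ℕ) : commonRow τ t₀ 0 v = extSample τ t₀ v := by
  simp [commonRow]

/-- A row can be updated from the new sample alone: a mismatch turns the entry into `2`, and an
entry `2` stays `2` in both branches. -/
theorem commonRow_succ (τ : Tape n) (t₀ t v : ℕ) :
    commonRow τ t₀ (t + 1) v =
      if commonRow τ t₀ t v = extSample τ (t₀ + t + 1) v then commonRow τ t₀ t v else 2 := by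
  have h1 := extSample_le_one τ (t₀ + t + 1) v
  unfold commonRow
  by_cases h : ∀ t' ≤ t, extSample τ (t₀ + t') v = extSample τ t₀ v
  · rw [if_pos h]
    by_cases h' : extSample τ (t₀ + t + 1) v = extSample τ t₀ v
    · rw [if_pos h'.symm, if_pos]
      intro t' ht'
      rcases Nat.lt_or_ge t' (t + 1) with h2 | h2
      · exact h t' (by omega)
      · obtain rfl : t' = t + 1 := by omega
        exact h'
    · rw [if_neg (Ne.symm h'), if_neg]
      intro h2; exact h' (h2 (t + 1) le_rfl)
  · rw [if_neg h, ite_self, if_neg]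
    intro h2; exact h fun t' ht' => h2 t' (by omega)

theorem commonRow_le_two (τ : Tape n) (t₀ t v : ℕ) : commonRow τ t₀ t v ≤ 2 := by
  have := extSample_le_one τ t₀ v
  unfold commonRow; split_ifs <;> omega

/-- The rows of the first `i` candidate terms are stored. -/
def RowsHold (d : Dims) (τ : Tape n) (i : ℕ) (st : State) : Prop :=
  ∀ i' < i, ∀ v < d.N, st.arr aR (i' * d.N + v) = candRow d τ i' v

/-- The cells of the sample array behind the sample are set. -/
def PadHolds (d : Dims) (st : State) : Prop := ∀ l, d.n ≤ l → l < d.N → st.arr aX l = 1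

theorem idx_lt {i i' v N : ℕ} (hi : i' < i) (hv : v < N) : i' * N + v < i * N := by
  have : (i' + 1) * N ≤ i * N := Nat.mul_le_mul_right _ hi
  rw [add_mul] at this; omega

variable {τ : Tape n} {X : ℕ} {Q : State → Prop} {st : State} {d : Dims}

/-- Loading a sample overwrites only the first `n` cells, so the dummy coordinates have to be set to
`1` only once. -/
theorem loadSample_of_pad (hn : d.n = n) (h : PadHolds d st) (x : ℕ) (hx : st.samples = x) :
    PadHolds d (st.loadSample aX (τ.1 st.samples)) ∧
      ∀ l < d.N, (st.loadSample aX (τ.1 st.samples)).arr aX l = extSample τ x l := by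
  subst hx
  refine ⟨fun l h1 h2 => ?_, fun l h2 => ?_⟩
  · have : ¬ l < n := by omega
    simp [this, h l h1 h2]
  · by_cases h1 : l < n
    · simp [extSample, h1]
    · simp [extSample, h1, h l (by omega) h2]

theorem Wp.candP (hn : d.n = n) (hX : n ≤ X) (hB : d.B ≤ X) (hN : d.N ≤ X) (hK : d.K ≤ X)
    (hd : d.Holds st) (hs : st.samples = 0) :
    Wp τ X InvGen.candP (fun st' => RowsHold d τ d.B st' ∧ PadHolds d st' ∧
      st'.samples = d.B * (d.K + 1)) st := by
  refine .seq (.forUp (fun v st1 => ∀ v' < v, st1.arr aX (d.n + v') = 1) rfl rfl (by decide)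
    (by rw [hd.b]; unfold Dims.N at hN; omega) (by simp) ?_ ?_)
  · intro v hv st1 hf hv1 hI
    refine .store fun v' hv' => ?_
    simp only [Expr.eval, hv1, hf.var rn rfl, hd.n]
    rcases Nat.lt_or_ge v' v with h | h
    · simp [hI v' h]
    · obtain rfl : v' = v := by omega
      simp
  intro st1 hf1 hI1
  rw [hd.b] at hI1
  have hs1 : st1.samples = 0 := (hf1.samples rfl).trans hs
  have hd1 : d.Holds st1 := hd.frame hf1 (by decide)
  have hp1 : PadHolds d st1 := fun l h1 h2 => by
    have := hI1 (l - d.n) (by unfold Dims.N at h2; omega)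
    rwa [show d.n + (l - d.n) = l by omega] at this
  clear hI1 hf1 hs hd
  refine .seq (.assign (.forUp (fun i st2 => RowsHold d τ i st2 ∧ PadHolds d st2 ∧
    st2.samples = i * (d.K + 1) ∧ st2.var rBase = i * d.N) rfl rfl (by decide)
    (by simpa [hd1.B] using hB) ?_ ?_ ?_))
  · refine ⟨fun i' h => by omega, hp1, by simp [hs1], by simp [Expr.eval]⟩
  · rintro i - st2 hf2 hJ ⟨hR, hP, hS, hb⟩
    have hd2 : d.Holds st2 := (hd1.of_eq fun y hy => by
      have : y ≠ 25 := by omega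
      simp [this]).frame hf2 (by decide)
    clear hf2 hd1 hs1 hp1
    refine .seq (.sample hX ?_)
    obtain ⟨hP3, hX3⟩ := loadSample_of_pad (τ := τ) hn hP _ hS
    have hd3 : d.Holds (st2.loadSample aX (τ.1 st2.samples)) := hd2.of_eq fun _ _ => rfl
    have hR3 : RowsHold d τ i (st2.loadSample aX (τ.1 st2.samples)) := fun i' h v hv => by
      simpa using hR i' h v hv
    have hb3 : (st2.loadSample aX (τ.1 st2.samples)).var rBase = i * d.N := hb
    have hS3 : (st2.loadSample aX (τ.1 st2.samples)).samples = i * (d.K + 1) + 1 := by simp [hS]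
    generalize st2.loadSample aX (τ.1 st2.samples) = st3 at *
    clear hd2 hR hb hS hP
    refine .seq (.forUp (fun v st4 => RowsHold d τ i st4 ∧ ∀ v' < v, st4.arr aR (i * d.N + v') =
      extSample τ (i * (d.K + 1)) v') rfl rfl (by decide) (by simpa [hd3.N] using hN) ?_ ?_ ?_)
    · exact ⟨hR3, by simp⟩
    · rintro v hv st4 hf4 hV ⟨hR4, hI4⟩
      refine .store ⟨fun i' h v' hv' => ?_, fun v' hv' => ?_⟩
      · have := idx_lt h hv'
        simp only [Expr.eval, hf4.var rBase rfl, hb3, hV, State.setVar_arr, State.setArr_arr]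
        rw [if_neg (by omega), hR4 i' h v' hv']
      · simp only [Expr.eval, hf4.var rBase rfl, hb3, hV, State.setVar_arr, State.setArr_arr,
          hf4.arr aX rfl]
        rcases Nat.lt_or_ge v' v with h | h
        · rw [if_neg (by omega), hI4 v' h]
        · obtain rfl : v' = v := by omega
          simp [hX3 v' (by rw [← hd3.N]; exact hv)]
    rintro st4 hf4 ⟨hR4, hI4⟩
    have hd4 := hd3.frame hf4 (by decide)
    rw [hd3.N] at hI4
    have hS4 := (hf4.samples rfl).trans hS3
    have hb4 := (hf4.var rBase rfl).trans hb3
    have hP4 : PadHolds d st4 := fun l h1 h2 => by rw [hf4.arr aX rfl]; exact hP3 l h1 h2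
    clear hf4 hd3 hR3 hP3 hX3 hb3 hS3 st3 hJ
    -- The sample counter is ahead of `t` by one because the first sample of the block was read
    -- before this loop.
    refine .seq (.forUp (fun t st5 => RowsHold d τ i st5 ∧ PadHolds d st5 ∧
      st5.samples = i * (d.K + 1) + t + 1 ∧
      ∀ v < d.N, st5.arr aR (i * d.N + v) = commonRow τ (i * (d.K + 1)) t v) rfl rfl (by decide)
      (by simpa [hd4.K] using hK) ⟨hR4, hP4, by simp [hS4], ?_⟩ ?_ ?_)
    · intro v hv
      rw [commonRow_zero, State.setVar_arr, hI4 v hv]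
    · rintro t ht st5 hf5 hT ⟨hR5, hP5, hS5, hI5⟩
      refine .seq (.sample hX ?_)
      obtain ⟨hP6, hX6⟩ := loadSample_of_pad (τ := τ) hn hP5 _ hS5
      have hd6 : d.Holds (st5.loadSample aX (τ.1 st5.samples)) :=
        (hd4.frame hf5 (by decide)).of_eq fun _ _ => rfl
      have hR6 : RowsHold d τ i (st5.loadSample aX (τ.1 st5.samples)) := fun i' h v hv => by
        simpa using hR5 i' h v hv
      have hb6 : (st5.loadSample aX (τ.1 st5.samples)).var rBase = i * d.N :=
        (hf5.var rBase rfl).trans hb4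
      have hI6 : ∀ v < d.N, (st5.loadSample aX (τ.1 st5.samples)).arr aR (i * d.N + v) =
        commonRow τ (i * (d.K + 1)) t v := fun v hv => by simpa using hI5 v hv
      have hS6 : (st5.loadSample aX (τ.1 st5.samples)).samples = i * (d.K + 1) + t + 1 + 1 := by
        simp [hS5]
      generalize st5.loadSample aX (τ.1 st5.samples) = st6 at *
      clear hf5 hR5 hP5 hS5 hI5 hd4 hR4 hP4 hS4 hb4 hI4
      -- The row is updated in place: entries before `v` take the new sample into account, the
      -- others do not yet.
      refine .forUp (fun v st7 => RowsHold d τ i st7 ∧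
        (∀ v' < v, st7.arr aR (i * d.N + v') = commonRow τ (i * (d.K + 1)) (t + 1) v') ∧
        ∀ v' < d.N, v ≤ v' → st7.arr aR (i * d.N + v') = commonRow τ (i * (d.K + 1)) t v')
        rfl rfl (by decide) (by simpa [hd6.N] using hN)
        ⟨hR6, by simp, fun v hv _ => hI6 v hv⟩ ?_ ?_
      · rintro v hv st7 hf7 hV ⟨hR7, hI7, hI7'⟩
        rw [hd6.N] at hv
        have e1 : st7.arr aR (st7.var rBase + st7.var rV) = commonRow τ (i * (d.K + 1)) t v := by
          rw [hf7.var rBase rfl, hb6, hV, hI7' v hv le_rfl]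
        have e2 : st7.arr aX (st7.var rV) = extSample τ (i * (d.K + 1) + t + 1) v := by
          rw [hf7.arr aX rfl, hV, hX6 v hv]
        have hc := commonRow_succ τ (i * (d.K + 1)) t v
        refine .ite (fun h => .store ?_) (fun h => .skip ?_)
        · simp only [Expr.eval, e1, e2] at h
          rw [if_neg (by omega)] at hc
          refine ⟨fun i' h v' hv' => ?_, fun v' hv' => ?_, fun v' hv' h' => ?_⟩
          · have := idx_lt h hv'
            simp only [Expr.eval, hf7.var rBase rfl, hb6, hV, State.setVar_arr, State.setArr_arr]
            rw [if_neg (by omega), hR7 i' h v' hv']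
          · simp only [Expr.eval, hf7.var rBase rfl, hb6, hV, State.setVar_arr, State.setArr_arr]
            rcases Nat.lt_or_ge v' v with h | h
            · rw [if_neg (by omega), hI7 v' h]
            · obtain rfl : v' = v := by omega
              simp [hc]
          · simp only [Expr.eval, hf7.var rBase rfl, hb6, hV, State.setVar_arr, State.setArr_arr]
            rw [if_neg (by omega), hI7' v' hv' (by omega)]
        · simp only [Expr.eval, e1, e2] at h
          rw [if_pos (by omega)] at hc
          refine ⟨hR7, fun v' hv' => ?_, fun v' hv' h' => hI7' v' hv' (by omega)⟩
          rcases Nat.lt_or_ge v' v with h | h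
          · exact hI7 v' h
          · obtain rfl : v' = v := by omega
            rw [hc]; exact hI7' v' hv le_rfl
      · rintro st7 hf7 ⟨hR7, hI7, -⟩
        rw [hd6.N] at hI7
        refine ⟨hR7, fun l h1 h2 => ?_, ?_, hI7⟩
        · rw [State.setVar_arr, hf7.arr aX rfl]; exact hP6 l h1 h2
        · rw [State.setVar_samples, hf7.samples rfl, hS6]; ring
    rintro st5 hf5 ⟨hR5, hP5, hS5, hI5⟩
    rw [hd4.K] at hS5 hI5
    refine .assign ⟨fun i' h v hv => ?_, hP5, ?_, ?_⟩
    · rcases Nat.lt_or_ge i' i with h' | h'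
      · exact hR5 i' h' v hv
      · obtain rfl : i' = i := by omega
        exact hI5 v hv
    · simp only [State.setVar_samples, hS5]; ring
    · simp [Expr.eval, hf5.var rBase rfl, hb4, hf5.var rN rfl, hd4.N, add_mul]
  · rintro st2 hf2 ⟨hR, hP, hS, -⟩
    have e : ((st1.setVar rBase (Expr.eval st1 (.const 0))).var rB) = d.B := by simp [hd1.B]
    rw [e] at hR hS
    exact ⟨hR, hP, hS⟩

theorem RowsHold.of_arr {i : ℕ} {st' : State} (h : RowsHold d τ i st)
    (ha : st'.arr aR = st.arr aR) : RowsHold d τ i st' := fun i' hi v hv => by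
  rw [ha]; exact h i' hi v hv

theorem Wp.countP (hn : d.n = n) (hX : n ≤ X) (hB : d.B ≤ X) (hN : d.N ≤ X) (hm : d.m ≤ X)
    (hd : d.Holds st) (hR : RowsHold d τ d.B st) (hP : PadHolds d st)
    (hs : st.samples = d.B * (d.K + 1)) (hC : ∀ i, st.arr aC i = 0) :
    Wp τ X InvGen.countP (fun st' => ∀ i < d.B, st'.arr aC i = candCount d τ i) st := by
  refine .forUp (fun t st1 => PadHolds d st1 ∧ st1.samples = d.B * (d.K + 1) + t ∧
    ∀ i < d.B, st1.arr aC i = Nat.count (fun t => rowSat d.N (candRow d τ i)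
      (extSample τ (d.B * (d.K + 1) + t))) t) rfl rfl (by decide) (by simpa [hd.m] using hm)
    ⟨hP, by simp [hs], by simp [hC]⟩ ?_ ?_
  · rintro t - st1 hf1 hT ⟨hP1, hS1, hC1⟩
    refine .seq (.sample hX ?_)
    obtain ⟨hP2, hX2⟩ := loadSample_of_pad (τ := τ) hn hP1 _ hS1
    have hd2 : d.Holds (st1.loadSample aX (τ.1 st1.samples)) :=
      (hd.frame hf1 (by decide)).of_eq fun _ _ => rfl
    have hR2 : RowsHold d τ d.B (st1.loadSample aX (τ.1 st1.samples)) :=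
      hR.of_arr (by rw [← hf1.arr aR rfl]; funext l; simp)
    have hC2 : ∀ i < d.B, (st1.loadSample aX (τ.1 st1.samples)).arr aC i =
      Nat.count (fun t => rowSat d.N (candRow d τ i)
        (extSample τ (d.B * (d.K + 1) + t))) t := fun i hi => by simpa using hC1 i hi
    have hS2 : (st1.loadSample aX (τ.1 st1.samples)).samples = d.B * (d.K + 1) + t + 1 := by
      simp [hS1]
    generalize st1.loadSample aX (τ.1 st1.samples) = st2 at *
    clear hf1 hP1 hS1 hC1 hR hP hs hC
    -- Only the counters of the terms before number `i` include sample number `t`.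
    refine .seq (.assign (.forUp (fun i st3 => st3.var rBase = i * d.N ∧
      ∀ i' < d.B, st3.arr aC i' = Nat.count (fun t => rowSat d.N (candRow d τ i')
        (extSample τ (d.B * (d.K + 1) + t))) (if i' < i then t + 1 else t)) rfl rfl (by decide)
      (by simpa [hd2.B] using hB) ⟨by simp [Expr.eval], by simpa using hC2⟩ ?_ ?_))
    · rintro i hi st3 hf3 hJ3 ⟨hb3, hC3⟩
      have hd3 : d.Holds st3 := (hd2.of_eq fun y hy => by
        have : y ≠ 25 := by omega
        simp [this]).frame hf3 (by decide)
      replace hi : i < d.B := by simpa [hd2.B] using hi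
      have hR3 : RowsHold d τ d.B st3 := hR2.of_arr (by rw [hf3.arr aR rfl, State.setVar_arr])
      have hX3 : ∀ l < d.N, st3.arr aX l = extSample τ (d.B * (d.K + 1) + t) l := fun l hl => by
        rw [hf3.arr aX rfl, State.setVar_arr, hX2 l hl]
      -- The flag records that some literal among the entries before `v` is violated.
      refine .seq (.assign (.seq (.forUp (fun v st4 => st4.var rFlag =
        if (∀ v' < v, candRow d τ i v' = 2 ∨ candRow d τ i v' =
          extSample τ (d.B * (d.K + 1) + t) v') then 0 else 1) rfl rfl (by decide)
        (by simpa [hd3.N] using hN) (by simp [Expr.eval]) ?_ ?_)))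
      · rintro v hv st4 hf4 hV hI4
        replace hv : v < d.N := by simpa [hd3.N] using hv
        have e1 : st4.arr aR (st4.var rBase + st4.var rV) = candRow d τ i v := by
          rw [hV, hf4.arr aR rfl, hf4.var rBase rfl]
          simp [hb3, hR3 i hi v hv]
        have e2 : st4.arr aX (st4.var rV) = extSample τ (d.B * (d.K + 1) + t) v := by
          rw [hV, hf4.arr aX rfl]
          simp [hX3 v hv]
        have h2 : candRow d τ i v ≤ 2 := commonRow_le_two _ _ _ _
        have hsucc : (∀ v' < v + 1, candRow d τ i v' = 2 ∨ candRow d τ i v' =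
            extSample τ (d.B * (d.K + 1) + t) v') ↔ (∀ v' < v, candRow d τ i v' = 2 ∨
            candRow d τ i v' = extSample τ (d.B * (d.K + 1) + t) v') ∧ (candRow d τ i v = 2 ∨
            candRow d τ i v = extSample τ (d.B * (d.K + 1) + t) v) :=
          Nat.forall_lt_succ_right
        have hbad : ¬ (candRow d τ i v = 2 ∨
            candRow d τ i v = extSample τ (d.B * (d.K + 1) + t) v) →
          (1 : ℕ) = if (∀ v' < v + 1, candRow d τ i v' = 2 ∨ candRow d τ i v' =
            extSample τ (d.B * (d.K + 1) + t) v') then 0 else 1 := fun h => by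
          rw [if_neg fun h' => h (hsucc.1 h').2]
        have hgood : (candRow d τ i v = 2 ∨
            candRow d τ i v = extSample τ (d.B * (d.K + 1) + t) v) →
          st4.var rFlag = if (∀ v' < v + 1, candRow d τ i v' = 2 ∨ candRow d τ i v' =
            extSample τ (d.B * (d.K + 1) + t) v') then 0 else 1 := fun h => by
          rw [hI4]; congr 1; rw [hsucc]; simp [h]
        refine .ite (fun h => .ite (fun h' => .assign ?_) (fun h' => .skip ?_))
          (fun h => .skip ?_)
        · simp only [Expr.eval, e1, e2] at h h'
          simpa [Expr.eval] using hbad (by omega)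
        · simp only [Expr.eval, e1, e2] at h h'
          simpa using hgood (by omega)
        · simp only [Expr.eval, e1] at h
          simpa using hgood (by omega)
      rintro st4 hf4 hI4
      have hJ4 : st4.var rJ = i := by rw [hf4.var rJ rfl]; simp [hJ3]
      have hb4 : st4.var rBase = i * d.N := by rw [hf4.var rBase rfl]; simp [hb3]
      have hN4 : st4.var rN = d.N := by rw [hf4.var rN rfl]; simp [hd3.N]
      have hC4 : st4.arr aC = st3.arr aC := by rw [hf4.arr aC rfl]; rfl
      have e : (st3.setVar rFlag (Expr.eval st3 (.const 0))).var rN = d.N := by simp [hd3.N]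
      rw [e] at hI4
      change st4.var rFlag = if rowSat d.N (candRow d τ i)
        (extSample τ (d.B * (d.K + 1) + t)) then 0 else 1 at hI4
      refine .seq (.ite (fun h => .skip (.assign ⟨?_, fun i' hi' => ?_⟩))
        (fun h => .store (.assign ⟨?_, fun i' hi' => ?_⟩)))
      · simp [Expr.eval, hb4, hN4, add_mul]
      · rw [State.setVar_arr, State.setVar_arr, hC4, hC3 i' hi']
        rcases lt_trichotomy i' i with h' | rfl | h'
        · rw [if_pos h', if_pos (by omega)]
        · rw [if_neg (by omega), if_pos (by omega), Nat.count_succ, if_neg, add_zero]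
          intro h'; simp [Expr.eval, hI4, h'] at h
        · rw [if_neg (by omega), if_neg (by omega)]
      · simp [Expr.eval, hb4, hN4, add_mul]
      · simp only [Expr.eval, State.setVar_arr, State.setArr_arr, hJ4, hC4]
        rcases lt_trichotomy i' i with h' | rfl | h'
        · rw [if_neg (by omega), hC3 i' hi', if_pos h', if_pos (by omega)]
        · rw [if_pos (by simp), hC3 i' hi', if_neg (by omega), if_pos (by omega), Nat.count_succ,
            if_pos]
          by_contra h'; simp [Expr.eval, hI4, h'] at h
        · rw [if_neg (by omega), hC3 i' hi', if_neg (by omega), if_neg (by omega)]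
    · rintro st3 hf3 ⟨-, hC3⟩
      have e : (st2.setVar rBase (Expr.eval st2 (.const 0))).var rB = d.B := by simp [hd2.B]
      rw [e] at hC3
      refine ⟨fun l h1 h2 => ?_, ?_, fun i hi => ?_⟩
      · rw [State.setVar_arr, hf3.arr aX rfl]; exact hP2 l h1 h2
      · rw [State.setVar_samples, hf3.samples rfl, State.setVar_samples, hS2]; rfl
      · rw [State.setVar_arr, hC3 i hi, if_pos hi]
  · rintro st1 - ⟨-, -, hC1⟩
    rw [hd.m] at hC1
    exact hC1

theorem Wp.freeP (hB : d.B ≤ X) (hN : d.N ≤ X) (hd : d.Holds st) (hR : RowsHold d τ d.B st)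
    (hF : ∀ i, st.arr aF i = 0) :
    Wp τ X InvGen.freeP (fun st' => ∀ i < d.B, st'.arr aF i = candFree d τ i) st := by
  refine .seq (.assign (.forUp (fun i st1 => st1.var rBase = i * d.N ∧
    ∀ i', st1.arr aF i' = if i' < i then candFree d τ i' else 0) rfl rfl (by decide)
    (by simpa [hd.B] using hB) ⟨by simp [Expr.eval], by simp [hF]⟩ ?_ ?_))
  · rintro i hi st1 hf1 hJ ⟨hb1, hF1⟩
    have hd1 : d.Holds st1 := (hd.of_eq fun y hy => by
      have : y ≠ 25 := by omega
      simp [this]).frame hf1 (by decide)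
    replace hi : i < d.B := by simpa [hd.B] using hi
    have hR1 : RowsHold d τ d.B st1 := hR.of_arr (by rw [hf1.arr aR rfl, State.setVar_arr])
    refine .seq (.forUp (fun v st2 => ∀ i', st2.arr aF i' = if i' < i then candFree d τ i' else
      if i' = i then Nat.count (fun v => candRow d τ i v = 2) v else 0) rfl rfl (by decide)
      (by simpa [hd1.N] using hN) (fun i' => by simp [hF1 i']) ?_ ?_)
    · rintro v hv st2 hf2 hV hI2
      rw [hd1.N] at hv
      have e1 : st2.arr aR (st2.var rBase + st2.var rV) = candRow d τ i v := by
        rw [hV, hf2.arr aR rfl, hf2.var rBase rfl, hb1, hR1 i hi v hv]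
      have h2 : candRow d τ i v ≤ 2 := commonRow_le_two _ _ _ _
      have hJ2 : st2.var rJ = i := (hf2.var rJ rfl).trans hJ
      refine .ite (fun h => .store fun i' => ?_) (fun h => .skip fun i' => ?_)
      · simp only [Expr.eval, e1] at h
        simp only [Expr.eval, State.setVar_arr, State.setArr_arr, hJ2, hI2]
        rcases lt_trichotomy i' i with h' | rfl | h'
        · simp [h', h'.ne]
        · have : candRow d τ i' v = 2 := by omega
          simp [Nat.count_succ, this]
        · simp [h'.ne', h'.not_gt]
      · simp only [Expr.eval, e1] at h
        have : candRow d τ i v ≠ 2 := by omega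
        rw [State.setVar_arr, hI2, Nat.count_succ, if_neg this, add_zero]
    · rintro st2 hf2 hI2
      rw [hd1.N] at hI2
      refine .assign ⟨?_, fun i' => ?_⟩
      · simp [Expr.eval, hf2.var rBase rfl, hb1, hf2.var rN rfl, hd1.N, add_mul]
      · rw [State.setVar_arr, State.setVar_arr, hI2]
        rcases lt_trichotomy i' i with h' | rfl | h'
        · rw [if_pos h', if_pos (by omega)]
        · rw [if_neg (by omega), if_pos rfl, if_pos (by omega)]; rfl
        · rw [if_neg (by omega), if_neg (by omega), if_neg (by omega)]
  · rintro st1 - ⟨-, hF1⟩ i hi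
    have e : (st.setVar rBase (Expr.eval st (.const 0))).var rB = d.B := by simp [hd.B]
    rw [e] at hF1
    rw [hF1, if_pos hi]

/-- Multiplication by the size `2 ^ F` of a subcube is done by `F` doublings, which keeps the number
of passes at most `N` although the size is exponential. -/
theorem Wp.dblLoop {x y : ℕ} (hx : x ≠ rT) (hy : y ≠ rT) (hxy : x ≠ y) (hX : st.var y ≤ X)
    (hQ : Q ((st.setVar x (2 ^ st.var y * st.var x)).setVar rT (st.var y))) :
    Wp τ X (InvGen.forUp rT y (InvGen.dblP x)) Q st := by
  refine .forUp (fun i st1 => st1 = (st.setVar x (2 ^ i * st.var x)).setVar rT i) ?_ ?_ hy.symm hX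
    (State.ext' (fun w => ?_) rfl rfl rfl rfl) ?_ ?_
  · simp [InvGen.dblP, Prog.writesVar, hx]
  · simp [InvGen.dblP, Prog.writesVar, hxy]
  · by_cases hw : w = x <;> simp [hw]
  · rintro i - st1 - - rfl
    refine .dblP (State.ext' (fun w => ?_) rfl rfl rfl rfl)
    by_cases hw : w = x
    · subst hw; simp [hx, pow_succ]; ring
    · simp [hw, hx]; split_ifs <;> rfl
  · rintro st1 - rfl; exact hQ

theorem candFree_le (i : ℕ) : candFree d τ i ≤ d.N := Nat.count_le _

theorem Wp.keepP (hB : d.B ≤ X) (hN : d.N ≤ X) (hd : d.Holds st)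
    (hC : ∀ i < d.B, st.arr aC i = candCount d τ i)
    (hF : ∀ i < d.B, st.arr aF i = candFree d τ i) :
    Wp τ X InvGen.keepP (fun st' => ∀ i < d.B, st'.arr aK i = if candKeep d τ i then 1 else 0)
      st := by
  refine .forUp (fun i st1 => ∀ i' < i, st1.arr aK i' = if candKeep d τ i' then 1 else 0) rfl rfl
    (by decide) (by simpa [hd.B] using hB) (by simp) ?_ ?_
  · rintro i hi st1 hf1 hJ hI1
    rw [hd.B] at hi
    have hd1 := hd.frame hf1 (by decide)
    -- The flag of term `i` starts as `1` and is cleared by the first comparison that fails.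
    refine .seq (.store (.forUp (fun l st2 => (∀ i' < i, st2.arr aK i' =
        if candKeep d τ i' then 1 else 0) ∧ st2.arr aK i = if ∀ i' < l,
        2 ^ candFree d τ i * (candCount d τ i' - d.e) ≤
          2 ^ candFree d τ i' * (candCount d τ i + d.e) then 1 else 0) rfl rfl (by decide)
      (by simpa [hd1.B] using hB) ⟨fun i' h => ?_, ?_⟩ ?_ ?_))
    · simp [Expr.eval, hJ, h.ne, hI1 i' h]
    · simp [Expr.eval, hJ]
    · rintro l hl st2 hf2 hL ⟨hI2, hI2'⟩
      replace hl : l < d.B := by simpa [hd1.B] using hl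
      have hJ2 : st2.var rJ = i := by rw [hf2.var rJ rfl]; exact hJ
      have he2 : st2.var re = d.e := by rw [hf2.var re rfl]; exact hd1.e
      have hF2 : ∀ i < d.B, st2.arr aF i = candFree d τ i := fun i hi => by
        rw [hf2.arr aF rfl]; simp [hf1.arr aF rfl, hF i hi]
      have hC2 : ∀ i < d.B, st2.arr aC i = candCount d τ i := fun i hi => by
        rw [hf2.arr aC rfl]; simp [hf1.arr aC rfl, hC i hi]
      have hsucc : (∀ i' ≤ l, 2 ^ candFree d τ i * (candCount d τ i' - d.e) ≤
            2 ^ candFree d τ i' * (candCount d τ i + d.e)) ↔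
          (∀ i' < l, 2 ^ candFree d τ i * (candCount d τ i' - d.e) ≤
            2 ^ candFree d τ i' * (candCount d τ i + d.e)) ∧
          2 ^ candFree d τ i * (candCount d τ l - d.e) ≤
            2 ^ candFree d τ l * (candCount d τ i + d.e) := by
        simp only [← Nat.lt_succ_iff]
        exact Nat.forall_lt_succ_right
      refine .seq (.assign (.seq (.assign (.seq (.dblLoop (by decide) (by decide) (by decide)
        ?_ ?_)))))
      · simpa [Expr.eval, hJ2, hF2 i hi] using (candFree_le i).trans hN
      simp [Expr.eval, hJ2, hL, hF2 i hi, hC2 l hl, he2]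
      refine .seq (.assign (.seq (.assign (.seq (.dblLoop (by decide) (by decide) (by decide)
        ?_ ?_)))))
      · simpa [Expr.eval, hL, hF2 l hl] using (candFree_le l).trans hN
      simp [Expr.eval, hJ2, hL, hF2 l hl, hC2 i hi, he2]
      refine .ite (fun h => .store ⟨fun i' hi' => ?_, ?_⟩) (fun h => .skip ⟨fun i' hi' => ?_, ?_⟩)
      · simpa [Expr.eval, hJ2, hi'.ne] using hI2 i' hi'
      · simp [Expr.eval] at h
        rw [if_neg fun h' => by have := (hsucc.1 h').2; omega]
        simp [Expr.eval, hJ2]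
      · simpa using hI2 i' hi'
      · simp [Expr.eval] at h
        simp only [State.setVar_arr, hI2']
        congr 1
        rw [eq_iff_iff, hsucc]
        exact ⟨fun h' => ⟨h', by omega⟩, fun h' => h'.1⟩
    · rintro st2 hf2 ⟨hI2, hI2'⟩ i' hi'
      rw [State.setVar_arr]
      rcases Nat.lt_or_ge i' i with h' | h'
      · exact hI2 i' h'
      · obtain rfl : i' = i := by omega
        rw [hI2', State.setArr_var, hd1.B]; rfl
  · rintro st1 - hI1
    rwa [hd.B] at hI1

theorem Wp.ellP (hB : d.B ≤ X) (hd : d.Holds st)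
    (hF : ∀ i < d.B, st.arr aF i = candFree d τ i)
    (hK : ∀ i < d.B, st.arr aK i = if candKeep d τ i then 1 else 0) :
    Wp τ X InvGen.ellP (fun st' => st'.var rEll = d.n - maxFree d τ) st := by
  refine .seq (.assign (.seq (.forUp (fun i st1 => st1.var rF =
    ((Finset.range i).filter (candKeep d τ)).sup (candFree d τ)) rfl rfl (by decide)
    (by simpa [hd.B] using hB) (by simp [Expr.eval]) ?_ ?_)))
  · rintro i hi st1 hf1 hJ hI1
    replace hi : i < d.B := by simpa [hd.B] using hi
    have hF1 : st1.arr aF (st1.var rJ) = candFree d τ i := by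
      rw [hJ, hf1.arr aF rfl]; exact hF i hi
    have hK1 : st1.arr aK (st1.var rJ) = if candKeep d τ i then 1 else 0 := by
      rw [hJ, hf1.arr aK rfl]; exact hK i hi
    rw [Finset.range_add_one, Finset.filter_insert]
    refine .ite (fun h => .ite (fun h' => .assign ?_) (fun h' => .skip ?_)) (fun h => .skip ?_)
    · simp [Expr.eval, hK1] at h
      simp only [Expr.eval, hF1, hI1] at h'
      rw [if_pos h, Finset.sup_insert]
      simp only [State.setVar_var, Expr.eval, hF1]
      simp only [if_true, Nat.reduceEqDiff, if_false]
      exact (sup_eq_left.2 (by omega)).symm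
    · simp [Expr.eval, hK1] at h
      simp only [Expr.eval, hF1, hI1] at h'
      rw [if_pos h, Finset.sup_insert]
      simp only [State.setVar_var, hI1]
      simp only [Nat.reduceEqDiff, if_false]
      exact (sup_eq_right.2 (by omega)).symm
    · simp [Expr.eval, hK1] at h
      rw [if_neg h]
      simpa using hI1
  · rintro st1 hf1 hI1
    have e : (st.setVar rF (Expr.eval st (.const 0))).var rB = d.B := by simp [hd.B]
    rw [e] at hI1
    refine .assign ?_
    simp only [Expr.eval, State.setVar_var, hI1, if_true, hf1.var rn rfl]
    simp [hd.n, maxFree]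

end Phases

/-! ## The circuit -/

section Wires

/-- The values of all wires after the gates `G`, where the first `m` bits of `z` are the input. -/
def wires (m : ℕ) (G : List Gate) (z : ℕ → Bool) : List Bool :=
  G.foldl (fun w g => w ++ [Gate.eval w g]) (List.ofFn fun i : Fin m => z i)

/-- Wire `q` exists and carries the function `φ` of the input. -/
def Carries (m : ℕ) (G : List Gate) (q : ℕ) (φ : (ℕ → Bool) → Bool) : Prop :=
  q < m + G.length ∧ ∀ z, (wires m G z).getD q false = φ z

variable {m : ℕ} {G G' : List Gate} {q q' : ℕ} {φ φ' : (ℕ → Bool) → Bool}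

theorem wires_append (m : ℕ) (G : List Gate) (g : Gate) (z : ℕ → Bool) :
    wires m (G ++ [g]) z = wires m G z ++ [g.eval (wires m G z)] := by
  simp [wires]

theorem length_wires (m : ℕ) (G : List Gate) (z : ℕ → Bool) :
    (wires m G z).length = m + G.length := by
  induction G using List.reverseRecOn with
  | nil => simp [wires]
  | append_singleton G g ih => rw [wires_append]; simp [ih, add_assoc]

theorem Carries.congr (h : Carries m G q φ) (hφ : ∀ z, φ z = φ' z) : Carries m G q φ' :=
  ⟨h.1, fun z => (h.2 z).trans (hφ z)⟩

theorem Carries.append (h : Carries m G q φ) (g : Gate) : Carries m (G ++ [g]) q φ := by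
  refine ⟨by have := h.1; simp; omega, fun z => ?_⟩
  rw [wires_append, List.getD_append _ _ _ _ (by rw [length_wires]; exact h.1), h.2]

/-- Later gates never change the value of an existing wire, so facts about wires survive all further
output. -/
theorem Carries.mono (h : Carries m G q φ) (hG : G <+: G') : Carries m G' q φ := by
  obtain ⟨H, rfl⟩ := hG
  induction H using List.reverseRecOn with
  | nil => simpa using h
  | append_singleton H g ih => rw [← List.append_assoc]; exact ih.append g

theorem carries_gate (m : ℕ) (G : List Gate) (g : Gate) :
    Carries m (G ++ [g]) (m + G.length) fun z => g.eval (wires m G z) := by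
  refine ⟨by simp, fun z => ?_⟩
  rw [wires_append, List.getD_append_right _ _ _ _ (by rw [length_wires])]
  simp [length_wires]

theorem carries_input (G : List Gate) (hq : q < m) : Carries m G q fun z => z q := by
  refine Carries.mono (G := []) ⟨by simpa using hq, fun z => ?_⟩ (List.nil_prefix)
  simp [wires, List.getD_eq_getElem?_getD, hq]

theorem Carries.not (h : Carries m G q φ) :
    Carries m (G ++ [.not q]) (m + G.length) fun z => !φ z :=
  (carries_gate m G _).congr fun z => by simp only [Gate.eval, h.2]

theorem Carries.and (h : Carries m G q φ) (h' : Carries m G q' φ') :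
    Carries m (G ++ [.and q q']) (m + G.length) fun z => φ z && φ' z :=
  (carries_gate m G _).congr fun z => by simp only [Gate.eval, h.2, h'.2]

theorem Carries.or (h : Carries m G q φ) (h' : Carries m G q' φ') :
    Carries m (G ++ [.or q q']) (m + G.length) fun z => φ z || φ' z :=
  (carries_gate m G _).congr fun z => by simp only [Gate.eval, h.2, h'.2]

end Wires

/-! ### Program parts that write gates, and the functions carried by the new wires -/

section Emission

/-- The input part of the circuit and the gates `G` have been written to the output tape. -/
structure Emitted (m : ℕ) (G : List Gate) (st : State) : Prop where
  out : st.out = List.replicate m 1 ++ [0] ++ G.flatMap Gate.encode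
  next : st.var rG = m + G.length

variable {n : ℕ} {τ : Tape n} {X : ℕ} {Q : State → Prop} {st st' : State} {d : Dims}
variable {m : ℕ} {G G' : List Gate} {q q' : ℕ} {φ φ' : (ℕ → Bool) → Bool}

theorem Emitted.of_eq (h : Emitted m G st) (ho : st'.out = st.out)
    (hv : st'.var rG = st.var rG) : Emitted m G st' := ⟨ho.trans h.out, hv.trans h.next⟩

theorem Expr.eval_out (e : Expr) (o : List ℕ) :
    e.eval { st with out := o } = e.eval st := by
  induction e <;> simp_all [Expr.eval]

theorem Wp.gateP {o x y : Expr} (g : Gate) (hE : Emitted m G st)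
    (hg : [o.eval st, x.eval st, y.eval st] = g.encode)
    (hQ : ∀ st', Emitted m (G ++ [g]) st' → (∀ w, w ≠ rG → st'.var w = st.var w) →
      st'.arr = st.arr → Q st') :
    Wp τ X (InvGen.gateP o x y) Q st := by
  refine .seq (.emit (.seq (.emit (.seq (.emit (.assign (hQ _ ⟨?_, ?_⟩ ?_ ?_)))))))
  · simp [Expr.eval_out, hE.out, ← hg]
  · simp [Expr.eval, hE.next, add_assoc]
  · intro w hw; simp [hw]
  · rfl

/-- The wires listed in array `a` carry the functions `x v`, for `v < N`. -/
def Bus (m : ℕ) (G : List Gate) (N : ℕ) (w : ℕ → ℕ) (x : ℕ → (ℕ → Bool) → Bool) : Prop :=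
  ∀ v < N, Carries m G (w v) (x v)

theorem Bus.mono {N : ℕ} {w : ℕ → ℕ} {x : ℕ → (ℕ → Bool) → Bool} (h : Bus m G N w x)
    (hG : G <+: G') : Bus m G' N w x := fun v hv => (h v hv).mono hG

/-- Does the point on the bus `x` satisfy the first `N` entries of the row `r`? -/
def busSat (N : ℕ) (r : ℕ → ℕ) (x : ℕ → (ℕ → Bool) → Bool) (z : ℕ → Bool) : Prop :=
  rowSat N r fun v => (x v z).toNat

instance (N : ℕ) (r : ℕ → ℕ) (x : ℕ → (ℕ → Bool) → Bool) (z : ℕ → Bool) :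
    Decidable (busSat N r x z) := by unfold busSat; infer_instance

/-- Register `rt` follows a running conjunction that starts at the constant true: an entry `1` adds
the bit, an entry `0` its negation, an entry `2` nothing. -/
theorem Wp.satP {N : ℕ} {r : ℕ → ℕ} {x : ℕ → (ℕ → Bool) → Bool} (hN : N ≤ X)
    (hE : Emitted m G st) (hone : Carries m G (st.var rOne) fun _ => true)
    (hNr : st.var rN = N) (hr : ∀ v < N, st.arr aR (st.var rBase' + v) = r v)
    (hr2 : ∀ v, r v ≤ 2) (hx : Bus m G N (st.arr aW) x) :
    Wp τ X InvGen.satP (fun st' => ∃ G', G <+: G' ∧ Emitted m G' st' ∧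
      Carries m G' (st'.var rt) fun z => decide (busSat N r x z)) st := by
  refine .seq (.assign (.forUp (fun l st1 => ∃ G', G <+: G' ∧ Emitted m G' st1 ∧
    Carries m G' (st1.var rt) fun z => decide (busSat l r x z)) rfl rfl (by decide)
    (by simpa [hNr] using hN)
    ⟨G, List.prefix_rfl, hE.of_eq rfl rfl, hone.congr fun z => by simp [busSat, rowSat]⟩ ?_ ?_))
  · rintro l hl st1 hf1 hV ⟨G1, hG1, hE1, hC1⟩
    replace hl : l < N := by simpa [hNr] using hl
    have e1 : st1.arr aR (st1.var rBase' + st1.var rV) = r l := by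
      rw [hV, hf1.arr aR rfl, hf1.var rBase' rfl]
      simp [hr l hl]
    have hxl : Carries m G1 (st1.arr aW l) (x l) := by
      rw [hf1.arr aW rfl]; exact (hx l hl).mono hG1
    have h2 := hr2 l
    have hsucc : ∀ z, busSat (l + 1) r x z ↔ busSat l r x z ∧ (r l = 2 ∨ r l = (x l z).toNat) :=
      fun z => Nat.forall_lt_succ_right
    refine .ite (fun h => .ite (fun h' => ?_) (fun h' => ?_)) (fun h => .skip ?_)
    · simp only [Expr.eval, e1] at h h'
      have hr1 : r l = 1 := by omega
      refine .seq (.gateP (.and (st1.var rt) (st1.arr aW l)) hE1 (by simp [Expr.eval, Gate.encode, hV])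
        fun st2 hE2 hv2 ha2 => .assign ⟨_, hG1.trans (List.prefix_append _ _),
          hE2.of_eq rfl rfl, ?_⟩)
      have e2 : (st2.setVar rt (Expr.eval st2 (.sub (.var rG) (.const 1)))).var rt =
        m + G1.length := by simp [Expr.eval, hE2.next]
      simp only [State.setVar_var, Nat.reduceEqDiff, if_false] at e2 ⊢
      rw [e2]
      refine (hC1.and hxl).congr fun z => ?_
      rw [Bool.eq_iff_iff]
      cases hxz : x l z <;> simp [hsucc, hr1, hxz]
    · simp only [Expr.eval, e1] at h h'
      refine .seq (.gateP (.not (st1.arr aW l)) hE1 (by simp [Expr.eval, Gate.encode, hV])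
        fun st2 hE2 hv2 ha2 => .seq (.gateP (.and (st1.var rt) (m + G1.length)) hE2 ?_
          fun st3 hE3 hv3 ha3 => .assign ⟨_, (hG1.trans (List.prefix_append _ _)).trans
            (List.prefix_append _ _), hE3.of_eq rfl rfl, ?_⟩))
      · have := hE2.next
        simp [Expr.eval, Gate.encode, hv2 rt (by decide), this]
      have e2 : (st3.setVar rt (Expr.eval st3 (.sub (.var rG) (.const 1)))).var rt =
        m + (G1 ++ [Gate.not (st1.arr aW l)]).length := by simp [Expr.eval, hE3.next]
      simp only [State.setVar_var, Nat.reduceEqDiff, if_false] at e2 ⊢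
      rw [e2]
      refine ((hC1.append _).and hxl.not).congr fun z => ?_
      rw [Bool.eq_iff_iff]
      cases hxz : x l z <;> simp [hsucc, h', hxz]
    · simp only [Expr.eval, e1] at h
      have hr1 : r l = 2 := by omega
      exact ⟨G1, hG1, hE1.of_eq rfl rfl, hC1.congr fun z => by simp [hsucc, hr1]⟩
  · rintro st1 hf1 ⟨G1, hG1, hE1, hC1⟩
    have e : (st.setVar rt (Expr.eval st (.var rOne))).var rN = N := by simp [hNr]
    rw [e] at hC1
    exact ⟨G1, hG1, hE1, hC1⟩

/-- The number of literals among the first `v` entries of the row. -/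
def litCount (r : ℕ → ℕ) (v : ℕ) : ℕ := Nat.count (fun v => r v ≠ 2) v

theorem litCount_succ (r : ℕ → ℕ) (v : ℕ) :
    litCount r (v + 1) = litCount r v + if r v = 2 then 0 else 1 := by
  simp [litCount, Nat.count_succ]

/-- Is entry `v` of the row among its first `ℓ` literals? -/
def isForced (r : ℕ → ℕ) (ℓ v : ℕ) : Prop := r v ≠ 2 ∧ litCount r v < ℓ

instance (r : ℕ → ℕ) (ℓ v : ℕ) : Decidable (isForced r ℓ v) := by unfold isForced; infer_instance

/-- The point on the bus of an attempt: the first `ℓ` literals of the row are satisfied, the other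
coordinates are the input bits from number `q` on. -/
def attemptBit (r : ℕ → ℕ) (ℓ q v : ℕ) (z : ℕ → Bool) : Bool :=
  if isForced r ℓ v then decide (r v = 1) else z (q + v)

/-- No gates are needed here, only a choice of wires. Since wires `m` and `m + 1` carry the
constants false and true, wire `m + r v` carries the value that the literal requires. -/
theorem Wp.pointP {N ℓ : ℕ} {r : ℕ → ℕ} (hN : N ≤ X) (hNr : st.var rN = N)
    (hl : st.var rEll = ℓ) (hr : ∀ v < N, st.arr aR (st.var rBase + v) = r v)
    (hr2 : ∀ v, r v ≤ 2) (hZ : st.var rZ = m) (hf : Carries m G m fun _ => false)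
    (ht : Carries m G (m + 1) fun _ => true) (hq : st.var rq + N ≤ m) :
    Wp τ X InvGen.pointP (fun st' => Bus m G N (st'.arr aW) (attemptBit r ℓ (st.var rq))) st := by
  -- `rf` counts the literals still to be forced; the truncated subtraction keeps it at `0` once all
  -- `ℓ` have been used.
  refine .seq (.assign (.forUp (fun l st1 => st1.var rf = ℓ - litCount r l ∧
    Bus m G l (st1.arr aW) (attemptBit r ℓ (st.var rq))) rfl rfl (by decide)
    (by simpa [hNr] using hN) ⟨by simp [Expr.eval, hl, litCount], fun v hv => by omega⟩ ?_ ?_))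
  · rintro l hlN st1 hf1 hV ⟨hc, hb⟩
    replace hlN : l < N := by simpa [hNr] using hlN
    have hq1 : st1.var rq = st.var rq := hf1.var rq rfl
    have hZ1 : st1.var rZ = m := (hf1.var rZ rfl).trans hZ
    have e1 : st1.arr aR (st1.var rBase + st1.var rV) = r l := by
      rw [hV, hf1.arr aR rfl, hf1.var rBase rfl]
      simp [hr l hlN]
    have h2 := hr2 l
    have hfree : ¬ isForced r ℓ l → Bus m G (l + 1)
        (fun v => if v = l then st.var rq + l else st1.arr aW v)
        (attemptBit r ℓ (st.var rq)) := fun h v hv => by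
      rcases Nat.lt_or_ge v l with h' | h'
      · simpa [h'.ne] using hb v h'
      · obtain rfl : v = l := by omega
        simp only [if_true]
        exact (carries_input G (by omega)).congr fun z => by simp [attemptBit, h]
    have hforced : isForced r ℓ l → Bus m G (l + 1)
        (fun v => if v = l then m + r l else st1.arr aW v)
        (attemptBit r ℓ (st.var rq)) := fun h v hv => by
      rcases Nat.lt_or_ge v l with h' | h'
      · simpa [h'.ne] using hb v h'
      · obtain rfl : v = l := by omega
        simp only [if_true]
        have := h.1
        rcases (by omega : r v = 0 ∨ r v = 1) with h0 | h0
        · rw [h0]; exact hf.congr fun z => by simp [attemptBit, h, h0]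
        · rw [h0]; exact ht.congr fun z => by simp [attemptBit, h, h0]
    refine .seq (.store ?_)
    have e1' : (st1.setArr aW (st1.var rV) (st1.var rq + st1.var rV)).arr aR (st1.var rBase + st1.var rV) = r l := by
      simp [e1]
    refine .ite (fun h => .ite (fun h' => .seq (.store (.assign ⟨?_, ?_⟩)))
      (fun h' => .skip ⟨?_, ?_⟩)) (fun h => .skip ⟨?_, ?_⟩)
    all_goals simp only [Expr.eval, State.setArr_var, e1'] at h
    · have hne : r l ≠ 2 := by omega
      simp [Expr.eval, hc, litCount_succ, hne]; omega
    · have hne : r l ≠ 2 := by omega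
      simp only [Expr.eval, State.setArr_var, hc] at h'
      convert hforced ⟨hne, by omega⟩ using 1
      funext v
      simp only [Expr.eval, State.setVar_arr, State.setArr_arr, State.setArr_var, hV, hZ1]
      have e3 := e1
      rw [hV] at e3
      simp [e3]
      split_ifs <;> rfl
    · have hne : r l ≠ 2 := by omega
      simp only [Expr.eval, State.setArr_var, hc] at h'
      simp [Expr.eval, hc, litCount_succ, hne]; omega
    · simp only [Expr.eval, State.setArr_var, hc] at h'
      convert hfree (fun hh => by have := hh.2; omega) using 1
      funext v
      simp [Expr.eval, hV, hq1]
    · have hne : r l = 2 := by omega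
      simp [Expr.eval, hc, litCount_succ, hne]
    · convert hfree (fun hh => by have := hh.1; omega) using 1
      funext v
      simp [Expr.eval, hV, hq1]
  · rintro st1 hf1 ⟨-, hb⟩
    have e : (st.setVar rf (Expr.eval st (.var rEll))).var rN = N := by simp [hNr]
    rw [e] at hb
    exact hb

/-- A running disjunction over the selected terms before number `i`, starting at wire `m`, the
constant false. -/
theorem Wp.earlierP {N B i : ℕ} {r : ℕ → ℕ → ℕ} {keep : ℕ → Prop} [DecidablePred keep]
    {x : ℕ → (ℕ → Bool) → Bool} (hN : N ≤ X) (hB : B ≤ X) (hi : i < B) (hE : Emitted m G st)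
    (hone : Carries m G (st.var rOne) fun _ => true) (hZ : st.var rZ = m)
    (hf : Carries m G m fun _ => false) (hNr : st.var rN = N) (hJ : st.var rJ = i)
    (hr : ∀ i < B, ∀ v < N, st.arr aR (i * N + v) = r i v) (hr2 : ∀ i v, r i v ≤ 2)
    (hK : ∀ i < B, st.arr aK i = if keep i then 1 else 0) (hx : Bus m G N (st.arr aW) x) :
    Wp τ X InvGen.earlierP (fun st' => ∃ G', G <+: G' ∧ Emitted m G' st' ∧
      Carries m G' (st'.var rAny) fun z =>
        decide (∃ i' < i, keep i' ∧ busSat N (r i') x z)) st := by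
  refine .seq (.assign (.seq (.assign (.forUp (fun l st1 => st1.var rBase' = l * N ∧
    ∃ G', G <+: G' ∧ Emitted m G' st1 ∧ Carries m G' (st1.var rAny) fun z =>
        decide (∃ i' < l, keep i' ∧ busSat N (r i') x z)) rfl rfl (by decide)
    (by simp [hJ]; omega) ⟨by simp [Expr.eval], G, List.prefix_rfl, hE.of_eq rfl rfl, ?_⟩ ?_ ?_))))
  · simpa [Expr.eval, hZ] using hf
  · rintro l hl st1 hf1 hI ⟨hb1, G1, hG1, hE1, hC1⟩
    replace hl : l < i := by simpa [hJ] using hl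
    have e1 : st1.arr aK (st1.var rI) = if keep l then 1 else 0 := by
      rw [hI, hf1.arr aK rfl]; simp [hK l (hl.trans hi)]
    have hN1 : st1.var rN = N := (hf1.var rN rfl).trans hNr
    have hsucc : ∀ z, (∃ i' < l + 1, keep i' ∧ busSat N (r i') x z) ↔
        (∃ i' < l, keep i' ∧ busSat N (r i') x z) ∨ (keep l ∧ busSat N (r l) x z) := fun z => by
      constructor
      · rintro ⟨i', h1, h2⟩
        rcases Nat.lt_or_ge i' l with h' | h'
        · exact .inl ⟨i', h', h2⟩
        · obtain rfl : i' = l := by omega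
          exact .inr h2
      · rintro (⟨i', h1, h2⟩ | h)
        exacts [⟨i', by omega, h2⟩, ⟨l, by omega, h⟩]
    refine .seq (.ite (fun h => ?_) (fun h => .skip (.assign ⟨?_, G1, hG1, hE1.of_eq rfl rfl, ?_⟩)))
    · simp [Expr.eval, e1] at h
      refine .seq ((Wp.satP (r := r l) (x := x) hN hE1 ?_ hN1 ?_ (hr2 l) ?_).mono ?_)
      · rw [hf1.var rOne rfl]; exact hone.mono hG1
      · intro v hv
        rw [hf1.arr aR rfl, hb1]
        simpa using hr l (hl.trans hi) v hv
      · rw [hf1.arr aW rfl]; exact hx.mono hG1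
      rintro st2 hf2 ⟨G2, hG2, hE2, hC2⟩
      have hany : st2.var rAny = st1.var rAny := hf2.var rAny rfl
      refine .seq (.gateP (.or (st1.var rAny) (st2.var rt)) hE2
        (by simp [Expr.eval, Gate.encode, hany])
        fun st3 hE3 hv3 ha3 => .assign (.assign ⟨?_, _, (hG1.trans hG2).trans
          (List.prefix_append _ _), hE3.of_eq rfl rfl, ?_⟩))
      · simp [Expr.eval, hv3 rBase' (by decide), hf2.var rBase' rfl, hb1, hv3 rN (by decide),
          hf2.var rN rfl, hN1, add_mul]
      · have e2 : st3.var rG - 1 = m + G2.length := by simp [hE3.next]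
        simp [Expr.eval, e2]
        refine ((hC1.mono hG2).or hC2).congr fun z => ?_
        rw [Bool.eq_iff_iff]
        simpa [h] using (hsucc z).symm
    · simp [Expr.eval, hb1, hN1, add_mul]
    · simp [Expr.eval, e1] at h
      simp only [State.setVar_var, Nat.reduceEqDiff, if_false]
      exact hC1.congr fun z => by
        rw [Bool.eq_iff_iff]
        simpa [h] using (hsucc z).symm
  · rintro st1 hf1 ⟨-, G1, hG1, hE1, hC1⟩
    have e : ((st.setVar rAny (Expr.eval st (.var rZ))).setVar rBase' (Expr.eval (st.setVar rAny
      (Expr.eval st (.var rZ))) (.const 0))).var rJ = i := by simp [hJ]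
    rw [e] at hC1
    exact ⟨G1, hG1, hE1, hC1⟩

theorem Wp.muxP {α : (ℕ → Bool) → Bool} {x o : ℕ → (ℕ → Bool) → Bool} (hX : n ≤ X)
    (hE : Emitted m G st) (hn : st.var rn = n) (hA : Carries m G (st.var rAcc) α)
    (hR : Carries m G (st.var rRej) fun z => !α z) (hx : Bus m G n (st.arr aW) x)
    (ho : Bus m G n (st.arr aO) o) :
    Wp τ X InvGen.muxP (fun st' => ∃ G', G <+: G' ∧ Emitted m G' st' ∧
      Bus m G' n (st'.arr aO) fun v z => if α z then x v z else o v z) st := by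
  -- The output wires are replaced one at a time: those from `l` on still carry the old output.
  refine .forUp (fun l st1 => ∃ G', G <+: G' ∧ Emitted m G' st1 ∧
      (∀ v < n, l ≤ v → Carries m G' (st1.arr aO v) (o v)) ∧
      Bus m G' l (st1.arr aO) fun v z => if α z then x v z else o v z) rfl rfl (by decide)
      (by simpa [hn] using hX) ⟨G, List.prefix_rfl, hE.of_eq rfl rfl, fun v hv _ => ho v hv,
        fun v hv => by omega⟩ ?_ ?_
  · rintro l hl st1 hf1 hV ⟨G1, hG1, hE1, hI1, hI1'⟩
    rw [hn] at hl
    have hA1 : Carries m G1 (st1.var rAcc) α := by rw [hf1.var rAcc rfl]; exact hA.mono hG1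
    have hR1 : Carries m G1 (st1.var rRej) fun z => !α z := by
      rw [hf1.var rRej rfl]; exact hR.mono hG1
    have hx1 : Carries m G1 (st1.arr aW l) (x l) := by
      rw [hf1.arr aW rfl]; exact (hx l hl).mono hG1
    refine .seq (.gateP (.and (st1.var rAcc) (st1.arr aW l)) hE1
      (by simp [Expr.eval, Gate.encode, hV]) fun st2 hE2 hv2 ha2 => ?_)
    refine .seq (.gateP (.and (st1.var rRej) (st1.arr aO l)) hE2
      (by simp [Expr.eval, Gate.encode, ha2, hv2 rRej (by decide), hv2 rV (by decide), hV])
      fun st3 hE3 hv3 ha3 => ?_)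
    refine .seq (.gateP (.or (m + G1.length) (m + (G1 ++
      [Gate.and (st1.var rAcc) (st1.arr aW l)]).length)) hE3 ?_ fun st4 hE4 hv4 ha4 => ?_)
    · have := hE3.next
      simp [Expr.eval, Gate.encode, this]; omega
    have hG4 := ((List.prefix_append G1 [Gate.and (st1.var rAcc) (st1.arr aW l)]).trans
      (List.prefix_append _ [Gate.and (st1.var rRej) (st1.arr aO l)])).trans
      (List.prefix_append _ [Gate.or (m + G1.length) (m + (G1 ++
      [Gate.and (st1.var rAcc) (st1.arr aW l)]).length)])
    have hnew := ((hA1.and hx1).append (.and (st1.var rRej) (st1.arr aO l))).or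
      ((hR1.append (.and (st1.var rAcc) (st1.arr aW l))).and
        ((hI1 l hl le_rfl).append (.and (st1.var rAcc) (st1.arr aW l))))
    have e4 : st4.var rG - 1 = m + (G1 ++ [Gate.and (st1.var rAcc) (st1.arr aW l)] ++
      [Gate.and (st1.var rRej) (st1.arr aO l)]).length := by simp [hE4.next]
    have eV : st4.var rV = l := by
      rw [hv4 _ (by decide), hv3 _ (by decide), hv2 _ (by decide), hV]
    have ea : st4.arr = st1.arr := by rw [ha4, ha3, ha2]
    refine .store ⟨_, hG1.trans hG4, hE4.of_eq rfl rfl, fun v hv hlv => ?_, fun v hv => ?_⟩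
    · simp only [Expr.eval, State.setVar_arr, State.setArr_arr, eV, ea]
      rw [if_neg (by omega)]
      exact (hI1 v hv (by omega)).mono hG4
    · simp only [Expr.eval, State.setVar_arr, State.setArr_arr, eV, ea, e4]
      rcases Nat.lt_or_ge v l with h' | h'
      · rw [if_neg (by omega)]
        exact (hI1' v h').mono hG4
      · obtain rfl : v = l := by omega
        rw [if_pos (by simp)]
        exact hnew.congr fun z => by cases α z <;> simp
  · rintro st1 hf1 ⟨G1, hG1, hE1, -, hI1⟩
    rw [hn] at hI1
    exact ⟨G1, hG1, hE1, hI1⟩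

end Emission

/-! ### The complete sampling circuit -/

section Sampler

/-- Is the point of the attempt with term number `i` accepted, that is, is this term the first
selected one that it satisfies? -/
def attemptAccepts (r : ℕ → ℕ → ℕ) (keep : ℕ → Prop) (N ℓ i q : ℕ) (z : ℕ → Bool) : Prop :=
  busSat N (r i) (attemptBit (r i) ℓ q) z ∧
    ¬ ∃ i' < i, keep i' ∧ busSat N (r i') (attemptBit (r i) ℓ q) z

instance (r : ℕ → ℕ → ℕ) (keep : ℕ → Prop) [DecidablePred keep] (N ℓ i q : ℕ) (z : ℕ → Bool) :
    Decidable (attemptAccepts r keep N ℓ i q z) := by unfold attemptAccepts; infer_instance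

/-- The output of the sampler after a number of attempts: the last accepted point. -/
def samplerBit (r : ℕ → ℕ → ℕ) (keep : ℕ → Prop) [DecidablePred keep] (B N ℓ : ℕ) :
    ℕ → ℕ → (ℕ → Bool) → Bool
  | 0, _, _ => false
  | a + 1, v, z =>
    if keep (a % B) ∧ attemptAccepts r keep N ℓ (a % B) (a * N) z then
      attemptBit (r (a % B)) ℓ (a * N) v z
    else samplerBit r keep B N ℓ a v z

variable {n : ℕ} {τ : Tape n} {X : ℕ} {Q : State → Prop} {st st' : State} {d : Dims}
variable {m : ℕ} {G G' : List Gate} {q q' : ℕ} {φ φ' : (ℕ → Bool) → Bool}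
variable {r : ℕ → ℕ → ℕ} {keep : ℕ → Prop} [DecidablePred keep]

/-- The point is tested against its own term as well, since only `ℓ` of its literals are forced and
the others hold only by chance. -/
theorem Wp.attemptP {N B i ℓ : ℕ} {o : ℕ → (ℕ → Bool) → Bool} (hN : N ≤ X) (hB : B ≤ X)
    (hnX : n ≤ X) (hnN : n ≤ N) (hi : i < B) (hE : Emitted m G st)
    (hone : st.var rOne = m + 1) (ht : Carries m G (m + 1) fun _ => true)
    (hf : Carries m G m fun _ => false) (hZ : st.var rZ = m) (hNr : st.var rN = N)
    (hn : st.var rn = n) (hJ : st.var rJ = i) (hb : st.var rBase = i * N) (hl : st.var rEll = ℓ)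
    (hq : st.var rq + N ≤ m)
    (hr : ∀ i < B, ∀ v < N, st.arr aR (i * N + v) = r i v) (hr2 : ∀ i v, r i v ≤ 2)
    (hK : ∀ i < B, st.arr aK i = if keep i then 1 else 0) (ho : Bus m G n (st.arr aO) o) :
    Wp τ X InvGen.attemptP (fun st' => ∃ G', G <+: G' ∧ Emitted m G' st' ∧
      Bus m G' n (st'.arr aO) fun v z => if attemptAccepts r keep N ℓ i (st.var rq) z then
        attemptBit (r i) ℓ (st.var rq) v z else o v z) st := by
  refine .seq ((Wp.pointP (r := r i) hN hNr hl (by rw [hb]; exact hr i hi) (hr2 i) hZ hf ht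
    hq).mono fun st1 hf1 hx1 => ?_)
  have hE1 : Emitted m G st1 := hE.of_eq (hf1.out rfl) (hf1.var rG rfl)
  refine .seq ((Wp.earlierP (r := r) (keep := keep) hN hB hi hE1
    (by rw [hf1.var rOne rfl, hone]; exact ht) (by rw [hf1.var rZ rfl, hZ]) hf
    (by rw [hf1.var rN rfl, hNr]) (by rw [hf1.var rJ rfl, hJ]) (by rw [hf1.arr aR rfl]; exact hr)
    hr2 (by rw [hf1.arr aK rfl]; exact hK) hx1).mono ?_)
  rintro st2 hf2 ⟨G2, hG2, hE2, hA2⟩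
  have hb2 : st2.var rBase = i * N := by rw [hf2.var rBase rfl, hf1.var rBase rfl, hb]
  have hE2' : Emitted m G2 (st2.setVar rBase' (Expr.eval st2 (.var rBase))) := hE2.of_eq rfl rfl
  refine .seq (.assign (.seq ((Wp.satP (r := r i) hN hE2' ?_ ?_ ?_ (hr2 i)
    (x := attemptBit (r i) ℓ (st.var rq)) ?_).mono ?_)))
  · have : (st2.setVar rBase' (Expr.eval st2 (.var rBase))).var rOne = m + 1 := by
      simp [hf2.var rOne rfl, hf1.var rOne rfl, hone]
    rw [this]; exact ht.mono hG2
  · simp [hf2.var rN rfl, hf1.var rN rfl, hNr]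
  · intro v hv
    simp [Expr.eval, hb2, hf2.arr aR rfl, hf1.arr aR rfl, hr i hi v hv]
  · simpa [hf2.arr aW rfl] using hx1.mono hG2
  rintro st3 hf3 ⟨G3, hG3, hE3, hC3⟩
  have hany : st3.var rAny = st2.var rAny := by rw [hf3.var rAny rfl]; simp
  refine .seq (.gateP (.not (st2.var rAny)) hE3 (by simp [Expr.eval, Gate.encode, hany])
    fun st4 hE4 hv4 ha4 => ?_)
  have h4 : st4.var rt = st3.var rt := hv4 _ (by decide)
  refine .seq (.gateP (.and (st3.var rt) (m + G3.length)) hE4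
    (by simp [Expr.eval, Gate.encode, h4, hE4.next]) fun st5 hE5 hv5 ha5 => ?_)
  have hacc := (hC3.append (.not (st2.var rAny))).and (hA2.mono hG3).not
  set G5 := G3 ++ [.not (st2.var rAny)] ++ [Gate.and (st3.var rt) (m + G3.length)] with hG5
  have e5 : st5.var rG - 1 = m + (G3 ++ [Gate.not (st2.var rAny)]).length := by
    simp [hE5.next, hG5]
  have hg5 : G2 <+: G5 := (hG3.trans (List.prefix_append _ _)).trans (List.prefix_append _ _)
  refine .seq (.assign (.seq (.gateP (.not (m + (G3 ++ [Gate.not (st2.var rAny)]).length))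
    (hE5.of_eq rfl rfl) ?_ fun st6 hE6 hv6 ha6 => ?_)))
  · simp [Expr.eval, Gate.encode]; simpa using e5
  have hrej := hacc.not
  have e6 : st6.var rG - 1 = m + G5.length := by simp [hE6.next]
  have hg6 := hg5.trans (List.prefix_append G5 [.not (m + (G3 ++ [Gate.not (st2.var rAny)]).length)])
  have hacc6 : st6.var rAcc = m + (G3 ++ [Gate.not (st2.var rAny)]).length := by
    rw [hv6 _ (by decide)]; simpa [Expr.eval] using e5
  have ha : ∀ c, c ≠ aW → c ≠ aO → st6.arr c = st.arr c := fun c h1 h2 => by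
    have hw : (5 == c) = false := by simpa using Ne.symm h1
    rw [ha6, State.setVar_arr, ha5, ha4, hf3.arr c rfl, State.setVar_arr, hf2.arr c rfl,
      hf1.arr c (by simp [InvGen.pointP, InvGen.forUp, Prog.writesArr, hw])]
  have haO : st6.arr aO = st.arr aO := by
    rw [ha6, State.setVar_arr, ha5, ha4, hf3.arr aO rfl, State.setVar_arr, hf2.arr aO rfl,
      hf1.arr aO rfl]
  have haW : st6.arr aW = st1.arr aW := by
    rw [ha6, State.setVar_arr, ha5, ha4, hf3.arr aW rfl, State.setVar_arr, hf2.arr aW rfl]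
  have hn6 : st6.var rn = n := by
    rw [hv6 _ (by decide), State.setVar_var, if_neg (by decide), hv5 _ (by decide),
      hv4 _ (by decide), hf3.var rn rfl, State.setVar_var, if_neg (by decide), hf2.var rn rfl,
      hf1.var rn rfl, hn]
  have hE6' : Emitted m _ (st6.setVar rRej (Expr.eval st6 (.sub (.var rG) (.const 1)))) :=
    hE6.of_eq rfl rfl
  refine .seq (.assign ((Wp.muxP (x := attemptBit (r i) ℓ (st.var rq)) (o := o) hnX hE6'
    (by simpa using hn6) (by simpa [hacc6] using hacc.append _) ?_ ?_ ?_).mono ?_))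
  · simpa [Expr.eval, e6] using hrej
  · rw [State.setVar_arr, haW]
    exact fun v hv => (hx1.mono (hG2.trans hg6)) v (by omega)
  · rw [State.setVar_arr, haO]
    exact ho.mono (hG2.trans hg6)
  · rintro st7 hf7 ⟨G7, hG7, hE7, hB7⟩
    refine ⟨G7, (hG2.trans hg6).trans hG7, hE7, fun v hv => (hB7 v hv).congr fun z => ?_⟩
    simp [attemptAccepts]

/-- The input bits of a circuit, as a sequence. -/
def padInput {m : ℕ} (z : Fin m → Bool) (q : ℕ) : Bool := if h : q < m then z ⟨q, h⟩ else false

theorem Wp.circuitP (hn : d.n = n) (hX : n ≤ X) (hB : d.B ≤ X) (hN : d.N ≤ X) (hL : d.L ≤ X)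
    (hZ : d.L * d.B * d.N ≤ X) (hd : d.Holds st) (hout : st.out = []) {ℓ : ℕ}
    (hl : st.var rEll = ℓ)
    (hr : ∀ i < d.B, ∀ v < d.N, st.arr aR (i * d.N + v) = r i v) (hr2 : ∀ i v, r i v ≤ 2)
    (hK : ∀ i < d.B, st.arr aK i = if keep i then 1 else 0) :
    Wp τ X InvGen.circuitP (fun st' => ∃ (G : List Gate) (outs : Fin n → ℕ),
      st'.out = (Circuit.mk (d.L * d.B * d.N) G outs).encode ∧
      ∀ z : Fin (d.L * d.B * d.N) → Bool, ∀ v, Circuit.eval (.mk (d.L * d.B * d.N) G outs) z v =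
        samplerBit r keep d.B d.N ℓ (d.L * d.B) v (padInput z)) st := by
  set m := d.L * d.B * d.N with hm
  refine .seq (.forUp (fun t st1 => st1.out = List.replicate t 1) rfl rfl (by decide)
    (by rw [hd.Z]; exact hZ) (by simpa using hout) ?_ ?_)
  · rintro t - st1 - - hI
    refine .emit ?_
    simp [Expr.eval, hI, List.replicate_succ']
  rintro st1 hf1 hI1
  rw [hd.Z] at hI1
  have hd1 := hd.frame hf1 (by decide)
  refine .seq (.emit (.seq (.assign ?_)))
  have hE2 : Emitted m [] (State.setVar { st1 with out := st1.out ++ [Expr.eval st1 (.const 0)] } rG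
      (Expr.eval { st1 with out := st1.out ++ [Expr.eval st1 (.const 0)] } (.var rZ))) :=
    ⟨by simp [hI1, Expr.eval, hm], by simp [Expr.eval, hd1.Z, hm]⟩
  refine .seq (.gateP (.const false) hE2 rfl fun st2 hE3 hv3 ha3 =>
    .seq (.gateP (.const true) hE3 rfl fun st3 hE4 hv4 ha4 => ?_))
  -- The first two gates are the constants; their wires directly follow the `m` input bits.
  have hf : Carries m ([] ++ [Gate.const false] ++ [Gate.const true]) m fun _ => false :=
    ((carries_gate m [] (.const false)).append _).congr fun _ => rfl
  have ht : Carries m ([] ++ [Gate.const false] ++ [Gate.const true]) (m + 1) fun _ => true :=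
    (carries_gate m ([] ++ [.const false]) (.const true)).congr fun _ => rfl
  have hone : st3.var rG - 1 = m + 1 := by simp [hE4.next]
  have hva : ∀ w, w ≠ rG → st3.var w = st1.var w := fun w hw => by
    rw [hv4 w hw, hv3 w hw]; simp [hw]
  have haa : st3.arr = st.arr := by
    rw [ha4, ha3]; funext c; exact hf1.arr c rfl
  have hd3 : d.Holds st3 := hd1.of_eq fun y hy => hva y (by omega)
  have hl3 : st3.var rEll = ℓ := by rw [hva _ (by decide), hf1.var rEll rfl, hl]
  generalize [] ++ [Gate.const false] ++ [Gate.const true] = G0 at *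
  clear hva ha4 hv4 hE3 ha3 hv3 hE2 hI1 hf1 hd1
  refine .seq (.assign (.seq (.forUp (fun l st4 => ∀ v < l, st4.arr aO v = m) rfl rfl (by decide)
    (by simpa [hd3.n, hn] using hX) (by simp) ?_ ?_)))
  · rintro l hl st4 hf4 hV hI
    refine .store fun v hv => ?_
    simp only [Expr.eval, State.setVar_arr, State.setArr_arr, hV, hf4.var rZ rfl]
    rcases Nat.lt_or_ge v l with h | h
    · simp [h.ne, hI v h]
    · obtain rfl : v = l := by omega
      simp [hd3.Z, hm]
  rintro st4 hf4 hO4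
  have e : (st3.setVar rOne (Expr.eval st3 (.sub (.var rG) (.const 1)))).var rn = n := by
    simp [hd3.n, hn]
  rw [e] at hO4
  have hd4 : d.Holds st4 := (hd3.of_eq fun y hy => by
    have : y ≠ 34 := by omega
    simp [this]).frame hf4 (by decide)
  have hE5 : Emitted m G0 st4 := hE4.of_eq (by rw [hf4.out rfl]; rfl) (by rw [hf4.var rG rfl]; simp)
  have hone4 : st4.var rOne = m + 1 := by rw [hf4.var rOne rfl]; simpa [Expr.eval] using hone
  have hl4 : st4.var rEll = ℓ := by rw [hf4.var rEll rfl]; simpa using hl3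
  have hr4 : st4.arr aR = st.arr aR := by rw [hf4.arr aR rfl, State.setVar_arr, haa]
  have hK4 : st4.arr aK = st.arr aK := by rw [hf4.arr aK rfl, State.setVar_arr, haa]
  have hO : Bus m G0 n (st4.arr aO) (samplerBit r keep d.B d.N ℓ 0) := fun v hv => by
    rw [hO4 v hv]; exact hf
  clear hf4 hd3 hO4 hl3 haa hone hE4
  refine .seq (.assign (.seq (.forUp (fun c st5 => st5.var rq = c * d.B * d.N ∧
    ∃ G, G0 <+: G ∧ Emitted m G st5 ∧ Bus m G n (st5.arr aO)
      (samplerBit r keep d.B d.N ℓ (c * d.B))) rfl rfl (by decide) (by simpa [hd4.L] using hL)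
      ⟨by simp [Expr.eval], G0, List.prefix_rfl, hE5.of_eq rfl rfl, by simpa using hO⟩ ?_ ?_)))
  · rintro c hc st5 hf5 hC ⟨hq5, G5, hG5, hE5, hO5⟩
    replace hc : c < d.L := by simpa [hd4.L] using hc
    have hd5 : d.Holds st5 := (hd4.of_eq fun y hy => by
      have : y ≠ 35 := by omega
      simp [this]).frame hf5 (by decide)
    refine .seq (.assign (.forUp (fun i st6 => st6.var rq = (c * d.B + i) * d.N ∧
      st6.var rBase = i * d.N ∧ ∃ G, G0 <+: G ∧ Emitted m G st6 ∧ Bus m G n (st6.arr aO)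
      (samplerBit r keep d.B d.N ℓ (c * d.B + i))) rfl rfl (by decide)
      (by simpa [hd5.B] using hB)
      ⟨by simp [hq5], by simp [Expr.eval], G5, hG5, hE5.of_eq rfl rfl, hO5⟩ ?_ ?_))
    · rintro i hi st6 hf6 hJ ⟨hq6, hb6, G6, hG6, hE6, hO6⟩
      replace hi : i < d.B := by simpa [hd5.B] using hi
      have hmod : (c * d.B + i) % d.B = i := by
        rw [mul_comm, Nat.mul_add_mod, Nat.mod_eq_of_lt hi]
      have hlt : c * d.B + i + 1 ≤ d.L * d.B := by
        have := idx_lt hc hi; omega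
      -- Attempt number `c * B + i` owns a window of `N` input bits. Windows of unselected terms are
      -- skipped, not reused, so positions depend only on the number of the attempt.
      have hqm : (c * d.B + i) * d.N + d.N ≤ m := by
        have := Nat.mul_le_mul_right d.N hlt
        rw [add_mul, one_mul] at this; exact this
      have hd6 : d.Holds st6 := (hd5.of_eq fun y hy => by
        have : y ≠ 25 := by omega
        simp [this]).frame hf6 (by decide)
      have hK6 : st6.arr aK = st.arr aK := by
        rw [hf6.arr aK rfl, State.setVar_arr, hf5.arr aK rfl, State.setVar_arr, hK4]
      have hR6 : st6.arr aR = st.arr aR := by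
        rw [hf6.arr aR rfl, State.setVar_arr, hf5.arr aR rfl, State.setVar_arr, hr4]
      refine .seq (.ite (fun h => ?_) (fun h => .skip ?_))
      · simp [Expr.eval, hK6, hJ, hK i hi] at h
        refine (Wp.attemptP (r := r) (keep := keep) hN hB hX (by unfold Dims.N; omega) hi hE6
          ?_ (ht.mono hG6) (hf.mono hG6) hd6.Z hd6.N (hd6.n.trans hn) hJ hb6 (ℓ := ℓ) ?_
          (by rw [hq6]; exact hqm) (by rw [hR6]; exact hr) hr2 (by rw [hK6]; exact hK) hO6).mono ?_
        · rw [hf6.var rOne rfl]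
          simp [hf5.var rOne rfl, hone4]
        · rw [hf6.var rEll rfl]
          simp [hf5.var rEll rfl, hl4]
        · rintro st7 hf7 ⟨G7, hG7, hE7, hO7⟩
          refine .seq (.assign (.assign ⟨?_, ?_, G7, hG6.trans hG7, hE7.of_eq rfl rfl, ?_⟩))
          · simp [Expr.eval, hf7.var rq rfl, hf7.var rN rfl, hq6, hd6.N]; ring
          · simp [Expr.eval, hf7.var rBase rfl, hf7.var rN rfl, hb6, hd6.N]; ring
          · refine fun v hv => (hO7 v hv).congr fun z => ?_
            rw [← add_assoc, samplerBit, hmod, hq6]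
            simp [h]
      · simp [Expr.eval, hK6, hJ, hK i hi] at h
        refine .seq (.assign (.assign ⟨?_, ?_, G6, hG6, hE6.of_eq rfl rfl, ?_⟩))
        · simp [Expr.eval, hq6, hd6.N]; ring
        · simp [Expr.eval, hb6, hd6.N]; ring
        · refine fun v hv => (hO6 v hv).congr fun z => ?_
          rw [← add_assoc, samplerBit, hmod]
          simp [h]
    · rintro st6 hf6 ⟨hq6, -, G6, hG6, hE6, hO6⟩
      have e : (st5.setVar rBase (Expr.eval st5 (.const 0))).var rB = d.B := by simp [hd5.B]
      rw [e] at hq6 hO6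
      have e2 : c * d.B + d.B = (c + 1) * d.B := by ring
      rw [e2] at hq6 hO6
      exact ⟨by simpa using hq6, G6, hG6, hE6.of_eq rfl rfl, hO6⟩
  · rintro st5 hf5 ⟨-, G5, hG5, hE5, hO5⟩
    have e : (st4.setVar rq (Expr.eval st4 (.const 0))).var rL = d.L := by simp [hd4.L]
    rw [e] at hO5
    have hn5 : st5.var rn = n := by rw [hf5.var rn rfl]; simp [hd4.n, hn]
    refine .forUp (fun l st6 => st6.out = List.replicate m 1 ++ [0] ++ G5.flatMap Gate.encode ++
      (List.range l).map (st5.arr aO)) rfl rfl (by decide) (by rw [hn5]; exact hX)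
      (by simp [hE5.out]) ?_ ?_
    · rintro l - st6 hf6 hV hI
      refine .emit ?_
      simp [Expr.eval, hI, hV, List.range_succ, hf6.arr aO rfl]
    · rintro st6 - hI
      rw [hn5] at hI
      refine ⟨G5, fun v => st5.arr aO v, ?_, fun z v => ?_⟩
      · simp only [hI, Circuit.encode, List.ofFn_eq_map]
        rw [← List.map_coe_finRange_eq_range, List.map_map]; rfl
      · rw [← (hO5 v v.2).2]
        unfold Circuit.eval Circuit.wires wires
        congr 3
        funext i
        simp [padInput]

end Sampler

/-! ### The whole program -/

section Generator

variable {n : ℕ} {τ : Tape n} {X : ℕ} {Q : State → Prop} {st st' : State}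

/-- The program flips no coins: the function computed by its output depends on the samples only, so
correctness becomes a statement about the samples alone. -/
theorem Wp.generatorP {s k j : ℕ} (hX : Fits n s k j X) (hk : 2 ≤ k)
    (h0 : st.var rn = n) (h1 : st.var rs = s) (h2 : st.var rk = k) (h3 : st.var rj = j)
    (harr : ∀ c i, st.arr c i = 0) (hout : st.out = []) (hs : st.samples = 0) :
    Wp τ X InvGen.generatorP (fun st' => ∃ (G : List Gate) (outs : Fin n → ℕ),
      st'.out = (Circuit.mk (numInputs n s k j) G outs).encode ∧
      ∀ z : Fin (numInputs n s k j) → Bool, ∀ v,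
        Circuit.eval (.mk (numInputs n s k j) G outs) z v =
        samplerBit (candRow (dims n s k j) τ) (candKeep (dims n s k j) τ) (dims n s k j).B
          (dims n s k j).N (n - maxFree (dims n s k j) τ)
          ((dims n s k j).L * (dims n s k j).B) v (padInput z)) st := by
  refine .ite (fun _ => ?_) (fun h => by simp [Expr.eval, h2] at h; omega)
  refine .seq (.paramsP hX h0 h1 h2 h3 fun st1 hf1 hd1 => ?_)
  have hB : (dims n s k j).B ≤ X := hX.le_B
  have hN : (dims n s k j).N ≤ X := hX.le_N
  have hK : (dims n s k j).K ≤ X := by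
    have := hX.le_block; unfold blockLen at this; simp only [dims]; omega
  have hm : (dims n s k j).m ≤ X := hX.le_m
  have hL : (dims n s k j).L ≤ X := hX.le_L
  have hZ : (dims n s k j).L * (dims n s k j).B * (dims n s k j).N ≤ X := hX.le_Z
  have hn : (dims n s k j).n = n := rfl
  have ha1 : st1.arr = st.arr := funext fun c => hf1.arr c rfl
  change Wp τ X _ (fun st' => ∃ (G : List Gate) (outs : Fin n → ℕ), st'.out = (Circuit.mk
    ((dims n s k j).L * (dims n s k j).B * (dims n s k j).N) G outs).encode ∧
      ∀ z : Fin ((dims n s k j).L * (dims n s k j).B * (dims n s k j).N) → Bool, ∀ v,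
        Circuit.eval (.mk ((dims n s k j).L * (dims n s k j).B * (dims n s k j).N) G outs) z v =
        samplerBit (candRow (dims n s k j) τ) (candKeep (dims n s k j) τ) (dims n s k j).B
          (dims n s k j).N (n - maxFree (dims n s k j) τ)
          ((dims n s k j).L * (dims n s k j).B) v (padInput z)) _
  generalize dims n s k j = d at *
  refine .seq ((Wp.candP hn hX.le_n hB hN hK hd1 ((hf1.samples rfl).trans hs)).mono ?_)
  rintro st2 hf2 ⟨hR2, hP2, hS2⟩
  have hd2 := hd1.frame hf2 (by decide)
  refine .seq ((Wp.countP hn hX.le_n hB hN hm hd2 hR2 hP2 hS2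
    (fun i => by rw [hf2.arr aC rfl, ha1, harr])).mono fun st3 hf3 hC3 => ?_)
  have hd3 := hd2.frame hf3 (by decide)
  have hR3 := hR2.of_arr (hf3.arr aR rfl)
  refine .seq ((Wp.freeP hB hN hd3 hR3
    (fun i => by rw [hf3.arr aF rfl, hf2.arr aF rfl, ha1, harr])).mono fun st4 hf4 hF4 => ?_)
  have hd4 := hd3.frame hf4 (by decide)
  have hR4 := hR3.of_arr (hf4.arr aR rfl)
  refine .seq ((Wp.keepP (τ := τ) hB hN hd4 (by rw [hf4.arr aC rfl]; exact hC3) hF4).mono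
    fun st5 hf5 hK5 => ?_)
  have hd5 := hd4.frame hf5 (by decide)
  have hR5 := hR4.of_arr (hf5.arr aR rfl)
  refine .seq ((Wp.ellP (τ := τ) hB hd5 (by rw [hf5.arr aF rfl]; exact hF4) hK5).mono
    fun st6 hf6 hl6 => ?_)
  have hd6 := hd5.frame hf6 (by decide)
  have hR6 := hR5.of_arr (hf6.arr aR rfl)
  rw [hn] at hl6
  have ho : st6.out = [] := by
    rw [hf6.out rfl, hf5.out rfl, hf4.out rfl, hf3.out rfl, hf2.out rfl, hf1.out rfl, hout]
  exact Wp.circuitP hn hX.le_n hB hN hL hZ hd6 ho hl6 hR6 (fun _ _ => commonRow_le_two _ _ _ _)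
    (by rw [hf6.arr aK rfl]; exact hK5)

theorem Wp.generatorP_trivial {k : ℕ} (hX : n ≤ X) (hk : k ≤ 1) (h0 : st.var rn = n)
    (h2 : st.var rk = k) (hout : st.out = []) :
    Wp τ X InvGen.generatorP (fun st' => ∃ C : Circuit n, st'.out = C.encode) st := by
  refine .ite (fun h => by simp [Expr.eval, h2] at h; omega) (fun _ => ?_)
  refine .seq (.emit (.forUp (fun l st1 => st1.out = [0] ++ List.replicate l 0) rfl rfl (by decide)
    (by simpa [h0] using hX) (by simp [hout, Expr.eval]) ?_ ?_))
  · rintro l - st1 - - hI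
    refine .emit ?_
    simp [Expr.eval, hI, List.replicate_succ']
  · rintro st1 - hI
    refine ⟨⟨0, [], fun _ => 0⟩, ?_⟩
    simp [hI, Circuit.encode, h0]

end Generator

/-! ## The distribution of the sampler -/

section SamplerLaw

theorem padInput_append_left {m N : ℕ} (z : Fin m → Bool) (w : Fin N → Bool) {q : ℕ} (hq : q < m) :
    padInput (Fin.append z w) q = padInput z q := by
  have : (⟨q, by omega⟩ : Fin (m + N)) = Fin.castAdd N ⟨q, hq⟩ := rfl
  simp only [padInput, hq, show q < m + N by omega, dif_pos, this, Fin.append_left]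

theorem padInput_append_right {m N : ℕ} (z : Fin m → Bool) (w : Fin N → Bool) (q : ℕ) :
    padInput (Fin.append z w) (m + q) = padInput w q := by
  by_cases hq : q < N
  · have : (⟨m + q, by omega⟩ : Fin (m + N)) = Fin.natAdd m ⟨q, hq⟩ := rfl
    simp only [padInput, hq, show m + q < m + N by omega, dif_pos, this, Fin.append_right]
  · simp [padInput, hq]

variable {r : ℕ → ℕ → ℕ} {keep : ℕ → Prop} [DecidablePred keep] {B N ℓ n : ℕ}

theorem attemptBit_shift (r : ℕ → ℕ) (ℓ q v : ℕ) (z : ℕ → Bool) :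
    attemptBit r ℓ q v z = attemptBit r ℓ 0 v fun v => z (q + v) := by
  simp [attemptBit]

theorem attemptAccepts_shift {keep : ℕ → Prop} (i q : ℕ) (z : ℕ → Bool) :
    attemptAccepts r keep N ℓ i q z ↔ attemptAccepts r keep N ℓ i 0 fun v => z (q + v) := by
  simp only [attemptAccepts, busSat, ← attemptBit_shift]

theorem attemptAccepts_congr {keep : ℕ → Prop} {i : ℕ} {z z' : ℕ → Bool} (h : ∀ v < N, z v = z' v) :
    attemptAccepts r keep N ℓ i 0 z ↔ attemptAccepts r keep N ℓ i 0 z' := by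
  have e : ∀ v < N, attemptBit (r i) ℓ 0 v z = attemptBit (r i) ℓ 0 v z' := fun v hv => by
    simp [attemptBit, h v hv]
  have e2 : ∀ i', busSat N (r i') (attemptBit (r i) ℓ 0) z ↔
      busSat N (r i') (attemptBit (r i) ℓ 0) z' := fun i' => by
    unfold busSat rowSat
    exact forall₂_congr fun v hv => by simp only [e v hv]
  simp only [attemptAccepts, e2]

/-- The first `a` attempts read only the first `a * N` input bits, which makes the next attempt
independent of them. -/
theorem samplerBit_congr {a v : ℕ} {z z' : ℕ → Bool} (hv : v < N)
    (h : ∀ q < a * N, z q = z' q) :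
    samplerBit r keep B N ℓ a v z = samplerBit r keep B N ℓ a v z' := by
  induction a with
  | zero => rfl
  | succ a ih =>
    have hq : ∀ v < N, z (a * N + v) = z' (a * N + v) := fun v hv =>
      h _ (idx_lt (Nat.lt_succ_self a) hv)
    have e1 := attemptAccepts_shift (r := r) (keep := keep) (N := N) (ℓ := ℓ) (a % B) (a * N) z
    have e2 := attemptAccepts_shift (r := r) (keep := keep) (N := N) (ℓ := ℓ) (a % B) (a * N) z'
    have e3 := attemptAccepts_congr (r := r) (keep := keep) (ℓ := ℓ) (i := a % B) hq
    have e4 : attemptBit (r (a % B)) ℓ (a * N) v z = attemptBit (r (a % B)) ℓ (a * N) v z' := by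
      simp [attemptBit, hq v hv]
    simp only [samplerBit, e1, e2, e3, e4]
    rw [ih fun q hq => h q (by rw [add_mul]; omega)]

/-- The point of an attempt with term number `i` on `N` fresh input bits. -/
def attemptPoint (n : ℕ) (r : ℕ → ℕ) (ℓ : ℕ) (w : Fin N → Bool) : Fin n → Bool :=
  fun v => attemptBit r ℓ 0 v (padInput w)

/-- The output of the sampler after `a` attempts. -/
def samplerPoint (n : ℕ) (r : ℕ → ℕ → ℕ) (keep : ℕ → Prop) [DecidablePred keep] (B N ℓ a : ℕ)
    {m : ℕ} (z : Fin m → Bool) : Fin n → Bool :=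
  fun v => samplerBit r keep B N ℓ a v (padInput z)

theorem samplerPoint_append (hn : n ≤ N) (a : ℕ) (z : Fin (a * N) → Bool) (w : Fin N → Bool) :
    samplerPoint n r keep B N ℓ (a + 1) (Fin.append z w) =
      if keep (a % B) ∧ attemptAccepts r keep N ℓ (a % B) 0 (padInput w) then
        attemptPoint n (r (a % B)) ℓ w else samplerPoint n r keep B N ℓ a z := by
  have e0 : (fun v => padInput (Fin.append z w) (a * N + v)) = padInput w :=
    funext fun v => padInput_append_right z w v
  funext v
  have hv : (v : ℕ) < N := by omega
  simp only [samplerPoint, samplerBit, attemptAccepts_shift _ (a * N), e0]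
  rw [attemptBit_shift, e0]
  split_ifs
  · rfl
  · exact samplerBit_congr hv fun q hq => padInput_append_left z w hq

open Classical in
/-- The number of inputs on which `a` attempts of the sampler end with output `y`. -/
noncomputable def samplerCount (r : ℕ → ℕ → ℕ) (keep : ℕ → Prop) [DecidablePred keep] (B N ℓ a : ℕ)
    (m : ℕ) (y : Fin n → Bool) : ℕ :=
  (Finset.univ.filter fun z : Fin m → Bool => samplerPoint n r keep B N ℓ a z = y).card

open Classical in
/-- The inputs of an attempt with term number `i` on which the attempt is accepted. -/
noncomputable def acceptSet (r : ℕ → ℕ → ℕ) (keep : ℕ → Prop) [DecidablePred keep] (N ℓ i : ℕ) :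
    Finset (Fin N → Bool) :=
  Finset.univ.filter fun w => keep i ∧ attemptAccepts r keep N ℓ i 0 (padInput w)

/-- The last accepted point is the output, so the recursion runs over the final attempt: if it
accepts, the earlier bits are irrelevant; if not, its own bits are. -/
theorem samplerCount_succ (hn : n ≤ N) (a : ℕ) (y : Fin n → Bool) :
    samplerCount r keep B N ℓ (a + 1) (a * N + N) y =
      2 ^ (a * N) * ((acceptSet r keep N ℓ (a % B)).filter
        fun w => attemptPoint n (r (a % B)) ℓ w = y).card +
      (2 ^ N - (acceptSet r keep N ℓ (a % B)).card) * samplerCount r keep B N ℓ a (a * N) y := by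
  classical
  have e1 : samplerCount r keep B N ℓ (a + 1) (a * N + N) y =
      (Finset.univ.filter fun p : (Fin (a * N) → Bool) × (Fin N → Bool) =>
        samplerPoint n r keep B N ℓ (a + 1) (Fin.append p.1 p.2) = y).card := by
    unfold samplerCount
    refine (Finset.card_bij (fun p _ => Fin.append p.1 p.2) ?_ ?_ ?_).symm
    · intro p hp; simpa using hp
    · rintro ⟨p1, p2⟩ - ⟨p1', p2'⟩ - h
      exact (Fin.appendEquiv (a * N) N).injective h
    · intro z hz
      obtain ⟨p, rfl⟩ := (Fin.appendEquiv (a * N) N).surjective z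
      exact ⟨p, by simpa [Fin.appendEquiv] using hz, rfl⟩
  have e2 : (Finset.univ.filter fun p : (Fin (a * N) → Bool) × (Fin N → Bool) =>
        samplerPoint n r keep B N ℓ (a + 1) (Fin.append p.1 p.2) = y) =
      (Finset.univ ×ˢ ((acceptSet r keep N ℓ (a % B)).filter
        fun w => attemptPoint n (r (a % B)) ℓ w = y)) ∪
      ((Finset.univ.filter fun z => samplerPoint n r keep B N ℓ a z = y) ×ˢ
        (acceptSet r keep N ℓ (a % B))ᶜ) := by
    ext ⟨z, w⟩
    simp only [Finset.mem_filter, Finset.mem_univ, true_and, Finset.mem_union, Finset.mem_product,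
      Finset.mem_compl, acceptSet, samplerPoint_append hn]
    split_ifs with h <;> simp [h]
  rw [e1, e2, Finset.card_union_of_disjoint, Finset.card_product, Finset.card_product,
    Finset.card_compl]
  · simp [samplerCount, mul_comm]
  · rw [Finset.disjoint_left]
    rintro ⟨z, w⟩ h1 h2
    simp only [Finset.mem_product, Finset.mem_filter, Finset.mem_compl] at h1 h2
    exact h2.2 h1.2.1

/-- The points that satisfy the row. -/
def rowSet (n : ℕ) (r : ℕ → ℕ) : Finset (Fin n → Bool) :=
  Finset.univ.filter fun y => ∀ v : Fin n, r v = 2 ∨ r v = (y v).toNat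

theorem mem_rowSet {r : ℕ → ℕ} {y : Fin n → Bool} :
    y ∈ rowSet n r ↔ ∀ v : Fin n, r v = 2 ∨ r v = (y v).toNat := by simp [rowSet]

/-- The points for which term number `i` is the first selected one that they satisfy. -/
def firstSet (n : ℕ) (r : ℕ → ℕ → ℕ) (keep : ℕ → Prop) [DecidablePred keep] (i : ℕ) :
    Finset (Fin n → Bool) :=
  (rowSet n (r i)).filter fun y => keep i ∧ ∀ i' < i, keep i' → y ∉ rowSet n (r i')

theorem card_forced (r : ℕ → ℕ) (ℓ N : ℕ) :
    Nat.count (isForced r ℓ) N = min ℓ (litCount r N) := by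
  induction N with
  | zero => simp [litCount]
  | succ N ih =>
    rw [Nat.count_succ, ih, litCount_succ]
    unfold isForced
    by_cases h : r N = 2
    · simp [h]
    · simp only [h, ne_eq, not_false_eq_true, true_and, if_false]
      split_ifs <;> omega

/-- Bits at forced coordinates are not read and all other bits are determined by `y`. As there are
exactly `ℓ` forced coordinates, the count does not depend on the size of the subcube; this is what
makes the attempts with different terms comparable. -/
theorem card_attempt {r : ℕ → ℕ} (hr : ∀ v, n ≤ v → v < N → r v = 1)
    (hn : n ≤ N) (hl : ℓ ≤ litCount r N) {y : Fin n → Bool} (hy : y ∈ rowSet n r) :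
    (Finset.univ.filter fun w : Fin N → Bool => busSat N r (attemptBit r ℓ 0) (padInput w) ∧
      attemptPoint n r ℓ w = y).card = 2 ^ ℓ := by
  classical
  rw [mem_rowSet] at hy
  -- The dummy coordinates of an accepted point must all be `1`.
  let y' : Fin N → Bool := fun v => if h : (v : ℕ) < n then y ⟨v, h⟩ else true
  have hy' : ∀ v : Fin N, r v = 2 ∨ r v = (y' v).toNat := fun v => by
    by_cases h : (v : ℕ) < n
    · simpa [y', h] using hy ⟨v, h⟩
    · right; simp [y', h, hr v (by omega) v.2]
  have key : (Finset.univ.filter fun w : Fin N → Bool =>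
      busSat N r (attemptBit r ℓ 0) (padInput w) ∧ attemptPoint n r ℓ w = y) =
      Fintype.piFinset fun v : Fin N => if isForced r ℓ v then Finset.univ else {y' v} := by
    ext w
    have hbit : ∀ v : Fin N, attemptBit r ℓ 0 v (padInput w) =
        if isForced r ℓ v then y' v else w v := fun v => by
      unfold attemptBit
      split_ifs with h
      · have h1 := h.1
        rcases hy' v with h2 | h2
        · exact absurd h2 h1
        · rw [h2]; cases y' v <;> simp
      · simp [padInput]
    have h1 : (busSat N r (attemptBit r ℓ 0) (padInput w) ∧ attemptPoint n r ℓ w = y) ↔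
        ∀ v : Fin N, attemptBit r ℓ 0 v (padInput w) = y' v := by
      constructor
      · rintro ⟨h1, rfl⟩ v
        by_cases h : (v : ℕ) < n
        · simp [y', h, attemptPoint]
        · have h2 := h1 v v.2
          rw [hr v (by omega) v.2] at h2
          simp only [y', h, dif_neg, not_false_eq_true]
          cases h3 : attemptBit r ℓ 0 v (padInput w) <;> simp [h3] at h2 ⊢
      · intro h
        refine ⟨fun v hv => ?_, funext fun v => ?_⟩
        · have := h ⟨v, hv⟩
          simp only at this
          simp only [this]
          exact hy' ⟨v, hv⟩
        · have := h ⟨v, by omega⟩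
          simpa [attemptPoint, y'] using this
    simp only [Finset.mem_filter, Finset.mem_univ, true_and, h1, Fintype.mem_piFinset]
    refine forall_congr' fun v => ?_
    rw [hbit]
    split_ifs <;> simp
  rw [key, Fintype.card_piFinset]
  have e : ∀ v : Fin N, (if isForced r ℓ v then (Finset.univ : Finset Bool) else {y' v}).card =
      if isForced r ℓ v then 2 else 1 := fun v => by split_ifs <;> simp
  simp only [e]
  rw [Fin.prod_univ_eq_prod_range (fun v => if isForced r ℓ v then 2 else 1) N,
    Finset.prod_ite, Finset.prod_const, Finset.prod_const, one_pow, mul_one,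
    ← Nat.count_eq_card_filter_range, card_forced, min_eq_left hl]

/-- All rows agree on the dummy coordinates, so once the point satisfies its own row, tests of other
rows concern only the first `n` coordinates. -/
theorem busSat_iff_mem {r r' : ℕ → ℕ} (hr' : ∀ v, n ≤ v → v < N → r' v = 1)
    (hr : ∀ v, n ≤ v → v < N → r v = 1) (hn : n ≤ N) {w : Fin N → Bool}
    (h : busSat N r (attemptBit r ℓ 0) (padInput w)) :
    busSat N r' (attemptBit r ℓ 0) (padInput w) ↔ attemptPoint n r ℓ w ∈ rowSet n r' := by
  rw [mem_rowSet]
  constructor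
  · exact fun h' v => h' v (by omega)
  · intro h' v hv
    rcases Nat.lt_or_ge v n with h1 | h1
    · exact h' ⟨v, h1⟩
    · have := h v hv
      rw [hr v h1 hv] at this
      rw [hr' v h1 hv]
      exact this

/-- Every point of the union is produced by exactly one term, the first selected one containing it,
and always by the same number of inputs. -/
theorem card_acceptSet_filter (hr : ∀ i, ∀ v, n ≤ v → v < N → r i v = 1)
    (hn : n ≤ N) {i : ℕ} (hl : keep i → ℓ ≤ litCount (r i) N)
    (y : Fin n → Bool) :
    ((acceptSet r keep N ℓ i).filter fun w => attemptPoint n (r i) ℓ w = y).card =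
      if y ∈ firstSet n r keep i then 2 ^ ℓ else 0 := by
  classical
  have hmem : ∀ w, w ∈ acceptSet r keep N ℓ i ↔
      busSat N (r i) (attemptBit (r i) ℓ 0) (padInput w) ∧
        attemptPoint n (r i) ℓ w ∈ firstSet n r keep i := fun w => by
    simp only [acceptSet, firstSet, Finset.mem_filter, Finset.mem_univ, true_and]
    unfold attemptAccepts
    constructor
    · rintro ⟨h1, h2, h3⟩
      refine ⟨h2, (busSat_iff_mem (hr i) (hr i) hn h2).1 h2, h1, fun i' hi' hk hm => h3 ⟨i', hi', hk, ?_⟩⟩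
      exact (busSat_iff_mem (hr i') (hr i) hn h2).2 hm
    · rintro ⟨h1, h2, h3, h4⟩
      refine ⟨h3, h1, ?_⟩
      rintro ⟨i', hi', hk, hm⟩
      exact h4 i' hi' hk ((busSat_iff_mem (hr i') (hr i) hn h1).1 hm)
  split_ifs with hy
  · rw [← card_attempt (hr i) hn (hl (Finset.mem_filter.1 hy).2.1) (Finset.mem_filter.1 hy).1]
    congr 1
    ext w
    simp only [Finset.mem_filter, hmem, Finset.mem_univ, true_and]
    constructor
    · rintro ⟨⟨h1, -⟩, h2⟩; exact ⟨h1, h2⟩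
    · rintro ⟨h1, rfl⟩; exact ⟨⟨h1, hy⟩, rfl⟩
  · rw [Finset.card_eq_zero, Finset.filter_eq_empty_iff]
    rintro w hw rfl
    exact hy ((hmem w).1 hw).2

theorem card_acceptSet (hr : ∀ i, ∀ v, n ≤ v → v < N → r i v = 1)
    (hn : n ≤ N) {i : ℕ} (hl : keep i → ℓ ≤ litCount (r i) N) :
    (acceptSet r keep N ℓ i).card = 2 ^ ℓ * (firstSet n r keep i).card := by
  classical
  rw [Finset.card_eq_sum_card_fiberwise (f := attemptPoint n (r i) ℓ) (t := Finset.univ)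
    (fun _ _ => Finset.mem_coe.2 (Finset.mem_univ _))]
  simp only [card_acceptSet_filter hr hn hl]
  rw [Finset.sum_ite_mem, Finset.univ_inter, Finset.sum_const, smul_eq_mul, mul_comm]

/-- The points that satisfy a selected term. -/
def keptSet (n : ℕ) (r : ℕ → ℕ → ℕ) (keep : ℕ → Prop) [DecidablePred keep] (B : ℕ) :
    Finset (Fin n → Bool) :=
  ((Finset.range B).filter keep).biUnion fun i => rowSet n (r i)

theorem exists_mem_firstSet {y : Fin n → Bool} (hy : y ∈ keptSet n r keep B) :
    ∃ i < B, y ∈ firstSet n r keep i := by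
  simp only [keptSet, Finset.mem_biUnion, Finset.mem_filter, Finset.mem_range] at hy
  have h : ∃ i, i < B ∧ keep i ∧ y ∈ rowSet n (r i) := by
    obtain ⟨i, ⟨h1, h2⟩, h3⟩ := hy; exact ⟨i, h1, h2, h3⟩
  classical
  obtain ⟨h1, h2, h3⟩ := Nat.find_spec h
  refine ⟨_, h1, Finset.mem_filter.2 ⟨h3, h2, fun i' hi' hk hm => ?_⟩⟩
  exact Nat.find_min h hi' ⟨hi'.trans h1, hk, hm⟩

theorem sum_card_firstSet (n : ℕ) (r : ℕ → ℕ → ℕ) (keep : ℕ → Prop) [DecidablePred keep] (B : ℕ) :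
    ∑ i ∈ Finset.range B, (firstSet n r keep i).card ≤ (keptSet n r keep B).card := by
  rw [← Finset.card_biUnion]
  · refine Finset.card_le_card fun y hy => ?_
    simp only [Finset.mem_biUnion, Finset.mem_range] at hy
    obtain ⟨i, hi, hy⟩ := hy
    obtain ⟨h1, h2, -⟩ := Finset.mem_filter.1 hy
    exact Finset.mem_biUnion.2 ⟨i, Finset.mem_filter.2 ⟨Finset.mem_range.2 hi, h2⟩, h1⟩
  · have : ∀ i i', i < i' → Disjoint (firstSet n r keep i) (firstSet n r keep i') := by
      intro i i' h
      rw [Finset.disjoint_left]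
      intro y h1 h2
      obtain ⟨h3, h4, -⟩ := Finset.mem_filter.1 h1
      exact (Finset.mem_filter.1 h2).2.2 i h h4 h3
    intro i _ i' _ h
    rcases lt_or_gt_of_ne h with h | h
    · exact this i i' h
    · exact (this i' i h).symm

/-- Here `p a` stands for the probability of a fixed point after `a` attempts. The point gains `α`
once per cycle, at position `i₀`, and attempt `i` overwrites it with probability at most `σ i`. One
cycle thus takes `p` to at least `(1 - S) * (p + α)`; iterating this from `p ≥ 0` gives a geometric
sum. -/
theorem cyclic_recursion_bound {p σ : ℕ → ℝ} {α S : ℝ} {B i₀ : ℕ} (hp : 0 ≤ p 0) (hα : 0 ≤ α)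
    (hσ : ∀ i, 0 ≤ σ i) (hS : ∑ i ∈ Finset.range B, σ i ≤ S) (hS1 : S ≤ 1) (hi₀ : i₀ < B)
    (hrec : ∀ a, p (a + 1) = (if a % B = i₀ then α else 0) + (1 - σ (a % B)) * p a) (c : ℕ) :
    α * (1 - S) * (1 - (1 - S) ^ c) ≤ S * p (c * B) := by
  have hS0 : 0 ≤ S := (Finset.sum_nonneg fun i _ => hσ i).trans hS
  have hpart : ∀ i ≤ B, ∑ i ∈ Finset.range i, σ i ≤ S := fun i hi =>
    (Finset.sum_le_sum_of_subset_of_nonneg (Finset.range_mono hi) fun _ _ _ => hσ _).trans hS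
  -- Inside a cycle the product of the factors `1 - σ i` is bounded below by one minus the sum.
  -- After position `i₀` the gain `α` is treated as if it had been present from the start, which
  -- only lowers the bound.
  have hcyc : ∀ c, 0 ≤ p (c * B) → ∀ i ≤ B,
      (1 - ∑ i ∈ Finset.range i, σ i) * (p (c * B) + if i₀ < i then α else 0) ≤ p (c * B + i) := by
    intro c hc i
    induction i with
    | zero => simp
    | succ i ih =>
      intro hi
      have hmod : (c * B + i) % B = i := by
        rw [mul_comm, Nat.mul_add_mod, Nat.mod_eq_of_lt (by omega)]
      have h1 := ih (by omega)
      have h2 := hpart (i + 1) hi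
      rw [← add_assoc, hrec, hmod]
      rw [Finset.sum_range_succ] at h2 ⊢
      have h3 := hσ i
      have h5 : 0 ≤ ∑ i ∈ Finset.range i, σ i := Finset.sum_nonneg fun i _ => hσ i
      set T := ∑ i ∈ Finset.range i, σ i
      have h4 : (1 - σ i) * ((1 - T) * (p (c * B) + if i₀ < i then α else 0)) ≤
        (1 - σ i) * p (c * B + i) := mul_le_mul_of_nonneg_left h1 (by linarith)
      rcases lt_trichotomy i i₀ with h | h | h
      · rw [if_neg (by omega)] at h4 ⊢
        rw [if_neg h.ne]
        have : 0 ≤ σ i * T * p (c * B) := by positivity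
        nlinarith
      · rw [if_neg (by omega)] at h4
        rw [if_pos (by omega), if_pos h]
        have : 0 ≤ σ i * T * p (c * B) := by positivity
        have : 0 ≤ (T + σ i) * α := by positivity
        nlinarith
      · rw [if_pos h] at h4
        rw [if_pos (by omega), if_neg h.ne']
        have : 0 ≤ σ i * T * (p (c * B) + α) := by positivity
        nlinarith
  have hstep : ∀ c, 0 ≤ p (c * B) → (1 - S) * (p (c * B) + α) ≤ p ((c + 1) * B) := by
    intro c hc
    have h := hcyc c hc B le_rfl
    rw [if_pos hi₀] at h
    have e : (c + 1) * B = c * B + B := by ring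
    rw [e]
    refine le_trans (mul_le_mul_of_nonneg_right ?_ (by positivity)) h
    linarith
  have hpos : ∀ c, 0 ≤ p (c * B) := fun c => by
    induction c with
    | zero => simpa using hp
    | succ c ih =>
      refine le_trans ?_ (hstep c ih)
      exact mul_nonneg (by linarith) (by positivity)
  induction c with
  | zero => simpa using mul_nonneg hS0 hp
  | succ c ih =>
    have h := mul_le_mul_of_nonneg_left (hstep c (hpos c)) hS0
    have h2 := mul_le_mul_of_nonneg_left ih (by linarith : 0 ≤ 1 - S)
    rw [pow_succ]
    nlinarith

/-- Every point that satisfies a selected term is output with nearly the right probability. -/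
theorem samplerCount_lower_bound (hr : ∀ i, ∀ v, n ≤ v → v < N → r i v = 1)
    (hn : n ≤ N)
    (hl : ∀ i < B, keep i → ℓ ≤ litCount (r i) N) {α S : ℝ} (hα : α = 2 ^ ℓ / 2 ^ N)
    (hS : S = α * (keptSet n r keep B).card) (hS1 : S ≤ 1) {y : Fin n → Bool}
    (hy : y ∈ keptSet n r keep B) (c : ℕ) :
    (1 - S) * (1 - (1 - S) ^ c) / (keptSet n r keep B).card ≤
      samplerCount r keep B N ℓ (c * B) (c * B * N) y / 2 ^ (c * B * N) := by
  classical
  obtain ⟨i₀, hi₀, hy₀⟩ := exists_mem_firstSet hy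
  have hα0 : 0 < α := by rw [hα]; positivity
  have hcard : (0 : ℝ) < (keptSet n r keep B).card := by
    exact_mod_cast Finset.card_pos.2 ⟨y, hy⟩
  have hB : 0 < B := by omega
  -- Exactly one attempt per cycle can produce `y`.
  have huniq : ∀ i < B, y ∈ firstSet n r keep i ↔ i = i₀ := by
    intro i hi
    constructor
    · intro h
      obtain ⟨h1, h2, h3⟩ := Finset.mem_filter.1 h
      obtain ⟨h4, h5, h6⟩ := Finset.mem_filter.1 hy₀
      rcases lt_trichotomy i i₀ with h' | h' | h'
      · exact absurd h1 (h6 i h' h2)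
      · exact h'
      · exact absurd h4 (h3 i₀ h' h5)
    · rintro rfl; exact hy₀
  have hb := cyclic_recursion_bound
    (p := fun a => (samplerCount r keep B N ℓ a (a * N) y : ℝ) / 2 ^ (a * N))
    (σ := fun i => α * (firstSet n r keep i).card) (α := α) (S := S) (B := B) (i₀ := i₀)
    (by positivity) hα0.le (fun i => by positivity) ?_ hS1 hi₀ ?_ c
  · rw [div_le_iff₀ hcard]
    have e : α * (1 - S) * (1 - (1 - S) ^ c) = α * ((1 - S) * (1 - (1 - S) ^ c)) := by ring
    rw [e] at hb
    -- Since `S = α * |H|`, the factor `α` cancels and only the size of the union remains.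
    conv_rhs at hb => rw [hS, mul_assoc]
    rw [mul_comm (_ / _)]
    exact le_of_mul_le_mul_left hb hα0
  · rw [← Finset.mul_sum, hS]
    refine mul_le_mul_of_nonneg_left ?_ hα0.le
    exact_mod_cast sum_card_firstSet n r keep B
  · intro a
    have hlt : a % B < B := Nat.mod_lt _ hB
    have h := samplerCount_succ (r := r) (keep := keep) (B := B) (ℓ := ℓ) hn a y
    have hle : (acceptSet r keep N ℓ (a % B)).card ≤ 2 ^ N := by
      refine (Finset.card_le_univ _).trans ?_
      simp
    have hacc := card_acceptSet (n := n) hr hn (hl (a % B) hlt)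
    rw [card_acceptSet_filter hr hn (hl (a % B) hlt)] at h
    have h' : (samplerCount r keep B N ℓ (a + 1) (a * N + N) y : ℝ) =
        2 ^ (a * N) * (if a % B = i₀ then 2 ^ ℓ else 0) +
        (2 ^ N - 2 ^ ℓ * (firstSet n r keep (a % B)).card) *
          samplerCount r keep B N ℓ a (a * N) y := by
      rw [h, hacc] 
      rw [hacc] at hle
      simp only [huniq _ hlt]
      push_cast [Nat.cast_sub hle]
      rfl
    have e : (a + 1) * N = a * N + N := by ring
    rw [e, h', hα, pow_add]
    split_ifs
    · field_simp
    · field_simp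
      ring

end SamplerLaw

/-! ## The samples -/

section Samples

variable {n : ℕ}

/-- The law of one sample. -/
noncomputable def pointLaw (S : Finset (Fin n → Bool)) (hS : S.Nonempty) :
    Measure (Fin n → Bool) := (PMF.uniformOfFinset S hS).toMeasure

instance (S : Finset (Fin n → Bool)) (hS : S.Nonempty) : IsProbabilityMeasure (pointLaw S hS) := by
  unfold pointLaw; infer_instance

/-- The law of the sequence of samples. -/
noncomputable def sampleLaw (S : Finset (Fin n → Bool)) (hS : S.Nonempty) :
    Measure (ℕ → Fin n → Bool) := Measure.infinitePi fun _ => pointLaw S hS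

instance (S : Finset (Fin n → Bool)) (hS : S.Nonempty) : IsProbabilityMeasure (sampleLaw S hS) := by
  unfold sampleLaw; infer_instance

/-- The fraction of the points of `S` that lie in `T`. -/
noncomputable def density (S T : Finset (Fin n → Bool)) : ℝ := ((S ∩ T).card : ℝ) / S.card

variable {S : Finset (Fin n → Bool)} (hS : S.Nonempty)

theorem pointLaw_real (T : Finset (Fin n → Bool)) : (pointLaw S hS).real T = density S T := by
  rw [measureReal_def, pointLaw, PMF.toMeasure_uniformOfFinset_apply _ _ (MeasurableSet.of_discrete)]
  simp only [density, ENNReal.toReal_div, ENNReal.toReal_natCast, Finset.mem_coe]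
  congr 3

theorem pointLaw_singleton {x : Fin n → Bool} (hx : x ∈ S) :
    (pointLaw S hS).real {x} = 1 / S.card := by
  have := pointLaw_real hS {x}
  rw [Finset.coe_singleton] at this
  rw [this, density, Finset.inter_singleton_of_mem hx]
  simp

open ProbabilityTheory in
-- Hoeffding's inequality: a variable with values in `[0, 1]` is sub-Gaussian with parameter `1/4`.
-- The offset `o` selects the samples of the second phase.
theorem sampleLaw_sum_ge (g : (Fin n → Bool) → ℝ) (hg : ∀ x, g x ∈ Set.Icc (0 : ℝ) 1) (o m : ℕ)
    {e : ℝ} (he : 0 ≤ e) :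
    (sampleLaw S hS).real {ω | e ≤ ∑ t ∈ Finset.range m, (g (ω (o + t)) - ∫ x, g x ∂pointLaw S hS)}
      ≤ Real.exp (-2 * e ^ 2 / m) := by
  have hgm : Measurable g := measurable_of_countable g
  have hmp : ∀ t, MeasurePreserving (fun ω : ℕ → Fin n → Bool => ω (o + t)) (sampleLaw S hS)
      (pointLaw S hS) := fun t => measurePreserving_eval_infinitePi _ _
  have hind : iIndepFun (fun t ω => g (ω (o + t)) - ∫ x, g x ∂pointLaw S hS) (sampleLaw S hS) := by
    have h := iIndepFun_infinitePi (P := fun _ : ℕ => pointLaw S hS)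
      (X := fun _ x => g x - ∫ x, g x ∂pointLaw S hS) (fun _ => hgm.sub_const _)
    exact h.precomp (g := fun t => o + t) (add_right_injective o)
  have hsub : ∀ t < m, HasSubgaussianMGF
      (fun ω : ℕ → Fin n → Bool => g (ω (o + t)) - ∫ x, g x ∂pointLaw S hS)
      ((‖(1 : ℝ) - 0‖₊ / 2) ^ 2) (sampleLaw S hS) := fun t _ => by
    have hi : ∫ ω, g (ω (o + t)) ∂sampleLaw S hS = ∫ x, g x ∂pointLaw S hS := by
      rw [← (hmp t).map_eq, integral_map (hmp t).measurable.aemeasurable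
        hgm.aestronglyMeasurable]
    rw [← hi]
    exact hasSubgaussianMGF_of_mem_Icc (hgm.comp (hmp t).measurable).aemeasurable
      (ae_of_all _ fun ω => hg _)
  refine (HasSubgaussianMGF.measure_sum_range_ge_le_of_iIndepFun hind hsub he).trans_eq ?_
  congr 1
  -- For `m = 0` both exponents are `0` by the convention for division by zero.
  rcases eq_or_ne (m : ℝ) 0 with h | h
  · simp [h]
  · simp
    field_simp

/-- The number of samples with numbers `o, …, o + m - 1` that lie in `T`. -/
def hits (T : Finset (Fin n → Bool)) (ω : ℕ → Fin n → Bool) (o m : ℕ) : ℕ :=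
  Nat.count (fun t => ω (o + t) ∈ T) m

theorem hits_eq_sum (T : Finset (Fin n → Bool)) (ω : ℕ → Fin n → Bool) (o m : ℕ) :
    (hits T ω o m : ℝ) = ∑ t ∈ Finset.range m, if ω (o + t) ∈ T then (1 : ℝ) else 0 := by
  rw [hits, Nat.count_eq_card_filter_range, Finset.sum_boole]

theorem integral_indicator_pointLaw (T : Finset (Fin n → Bool)) :
    ∫ x, (if x ∈ T then (1 : ℝ) else 0) ∂pointLaw S hS = density S T := by
  rw [← pointLaw_real hS T, ← integral_indicator_one (MeasurableSet.of_discrete)]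
  congr 1
  funext x
  simp [Set.indicator_apply]

/-- The two tails come from the indicator of `T` and from its complement. -/
theorem sampleLaw_deviation (T : Finset (Fin n → Bool)) (o m : ℕ) {e : ℝ} (he : 0 ≤ e) :
    (sampleLaw S hS).real {ω | ¬ |(hits T ω o m : ℝ) - m * density S T| ≤ e} ≤
      2 * Real.exp (-2 * e ^ 2 / m) := by
  have h1 := sampleLaw_sum_ge hS (fun x => if x ∈ T then (1 : ℝ) else 0)
    (fun x => by split_ifs <;> simp) o m he
  have h2 := sampleLaw_sum_ge hS (fun x => 1 - if x ∈ T then (1 : ℝ) else 0)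
    (fun x => by split_ifs <;> simp) o m he
  have hint : Integrable (fun x => if x ∈ T then (1 : ℝ) else 0) (pointLaw S hS) :=
    Integrable.of_finite
  rw [integral_sub (integrable_const _) hint] at h2
  rw [integral_indicator_pointLaw] at h1 h2
  simp only [Finset.sum_sub_distrib, ← hits_eq_sum, Finset.sum_const, Finset.card_range,
    nsmul_eq_mul, integral_const, probReal_univ, smul_eq_mul, mul_one] at h1 h2
  refine (measureReal_mono (s₂ := {ω | e ≤ (hits T ω o m : ℝ) - m * density S T} ∪
    {ω | e ≤ (m : ℝ) - hits T ω o m - (m - m * density S T)}) fun ω hω => ?_).trans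
    ((measureReal_union_le _ _).trans (by linarith))
  simp only [Set.mem_ofPred_eq, not_le, Set.mem_union] at hω ⊢
  rcases lt_abs.1 hω with h | h
  · left; linarith
  · right; linarith

/-- The points of the block of samples that starts at `o`. -/
def block (K : ℕ) (ω : ℕ → Fin n → Bool) (o : ℕ) : Fin K → Fin n → Bool := fun t => ω (o + t)

/-- Consecutive blocks read disjoint sets of samples. Restricting the product measure to these and
currying the indices shows that the blocks are independent. -/
theorem sampleLaw_blocks (K B : ℕ) (A : Set (Fin K → Fin n → Bool)) :
    (sampleLaw S hS).real {ω | ∀ i < B, block K ω (i * K) ∉ A} =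
      (1 - (Measure.infinitePi fun _ : Fin K => pointLaw S hS).real A) ^ B := by
  let f : Fin B × Fin K → ℕ := fun p => p.1 * K + p.2
  have hf : Function.Injective f := by
    rintro ⟨i, t⟩ ⟨i', t'⟩ h
    simp only [f] at h
    rcases lt_trichotomy (i : ℕ) i' with h' | h' | h'
    · have := idx_lt h' t.2; omega
    · rw [h'] at h
      exact Prod.ext (Fin.ext h') (Fin.ext (by simpa using h))
    · have := idx_lt h' t'.2; omega
  have h1 := Measure.map_infinitePi_infinitePi_of_inj (P := fun _ : ℕ => pointLaw S hS) hf
  have h2 := Measure.infinitePi_map_curry (fun (_ : Fin B) (_ : Fin K) => pointLaw S hS)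
  rw [← h1, Measure.map_map (MeasurableEquiv.measurable _) (by fun_prop)] at h2
  have h3 : {ω : ℕ → Fin n → Bool | ∀ i < B, block K ω (i * K) ∉ A} =
      (⇑(MeasurableEquiv.curry (Fin B) (Fin K) (Fin n → Bool)) ∘ fun ω p => ω (f p)) ⁻¹'
        ((Finset.univ : Finset (Fin B)) : Set (Fin B)).pi fun _ => Aᶜ := by
    ext ω
    simp only [Set.mem_ofPred_eq, Set.mem_preimage, Set.mem_pi, Finset.coe_univ, Set.mem_univ,
      forall_true_left, Set.mem_compl_iff]
    exact ⟨fun h i => h i i.2, fun h i hi => h ⟨i, hi⟩⟩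
  rw [measureReal_def, sampleLaw, h3, ← Measure.map_apply (by fun_prop)
    (MeasurableSet.pi (Finset.countable_toSet _) fun _ _ => MeasurableSet.of_discrete), h2,
    Measure.infinitePi_pi _ (fun _ _ => MeasurableSet.of_discrete), Finset.prod_const,
    Finset.card_univ, Fintype.card_fin, ENNReal.toReal_pow, ← measureReal_def,
    probReal_compl_eq_one_sub MeasurableSet.of_discrete]

theorem infinitePi_pointLaw_real {K : ℕ} {A : Finset (Fin K → Fin n → Bool)}
    (hA : ∀ x ∈ A, ∀ t, x t ∈ S) :
    (Measure.infinitePi fun _ : Fin K => pointLaw S hS).real A = A.card / (S.card : ℝ) ^ K := by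
  rw [← sum_measureReal_singleton, Finset.sum_congr rfl (g := fun _ => (1 / (S.card : ℝ)) ^ K)]
  · simp [div_eq_mul_inv]
  · intro x hx
    rw [measureReal_def, Measure.infinitePi_singleton_of_fintype, ENNReal.toReal_prod]
    have : ∀ t ∈ Finset.univ, ((pointLaw S hS) {x t}).toReal = 1 / S.card := fun t _ =>
      pointLaw_singleton hS (hA x hx t)
    rw [Finset.prod_congr rfl this]
    simp

end Samples

/-! ### Blocks of samples that determine a subcube -/

section Blocks

variable {n : ℕ}

/-- The blocks of points of the subcube given by the row `r` on which no further variable is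
constant. -/
def goodBlocks (K : ℕ) (r : ℕ → ℕ) : Finset (Fin K → Fin n → Bool) :=
  (Fintype.piFinset fun _ => rowSet n r).filter
    fun x => ∀ v : Fin n, r v = 2 → ∃ t t', x t v ≠ x t' v

/-- Flipping a free coordinate exchanges the two halves of the subcube. -/
theorem card_rowSet_half {r : ℕ → ℕ} {v : Fin n} (hv : r v = 2) (b : Bool) :
    2 * ((rowSet n r).filter fun y => y v = b).card = (rowSet n r).card := by
  have h1 : ((rowSet n r).filter fun y => y v = b).card =
      ((rowSet n r).filter fun y => ¬ y v = b).card := by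
    have hflip : ∀ y ∈ rowSet n r, ∀ c, Function.update y v c ∈ rowSet n r := fun y hy c => by
      rw [mem_rowSet] at hy ⊢
      intro w
      rcases eq_or_ne w v with rfl | h
      · exact .inl hv
      · rw [Function.update_of_ne h]; exact hy w
    refine Finset.card_bij' (fun y _ => Function.update y v !b) (fun y _ => Function.update y v b)
      ?_ ?_ ?_ ?_
    · intro y hy
      rw [Finset.mem_filter] at hy ⊢
      exact ⟨hflip y hy.1 _, by simp⟩
    · intro y hy
      rw [Finset.mem_filter] at hy ⊢
      exact ⟨hflip y hy.1 _, by simp⟩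
    · intro y hy
      rw [Finset.mem_filter] at hy
      rw [Function.update_idem, ← hy.2, Function.update_eq_self]
    · intro y hy
      rw [Finset.mem_filter] at hy
      have : y v = !b := by cases h : y v <;> cases b <;> simp_all
      simp only [Function.update_idem]
      rw [← this, Function.update_eq_self]
  have h2 := Finset.card_filter_add_card_filter_not (s := rowSet n r) fun y => y v = b
  omega

/-- Union bound over the free variables and the two constant values: the bad fraction is at most `2n
/ 2 ^ K ≤ 1/2`. -/
theorem card_goodBlocks {K : ℕ} (hK : 4 * n ≤ 2 ^ K) (r : ℕ → ℕ) :
    ((rowSet n r).card : ℝ) ^ K / 2 ≤ (goodBlocks (n := n) K r).card := by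
  classical
  let bad : Finset (Fin K → Fin n → Bool) :=
    (Finset.univ.filter fun v : Fin n => r v = 2).biUnion fun v =>
      Finset.univ.biUnion fun b : Bool =>
        Fintype.piFinset fun _ => (rowSet n r).filter fun y => y v = b
  have hcover : (Fintype.piFinset fun _ : Fin K => rowSet n r) ⊆ goodBlocks K r ∪ bad := by
    intro x hx
    by_cases h : x ∈ goodBlocks K r
    · exact Finset.mem_union_left _ h
    refine Finset.mem_union_right _ ?_
    simp only [goodBlocks, Finset.mem_filter, hx, true_and, not_forall, not_exists, not_not] at h
    obtain ⟨v, hv, h⟩ := h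
    rw [Fintype.mem_piFinset] at hx
    simp only [bad, Finset.mem_biUnion, Finset.mem_filter, Finset.mem_univ, true_and,
      Fintype.mem_piFinset]
    rcases Nat.eq_zero_or_pos K with hK0 | hK0
    · subst hK0; exact ⟨v, hv, true, fun t => t.elim0⟩
    · exact ⟨v, hv, x ⟨0, hK0⟩ v, fun t => ⟨hx t, h t _⟩⟩
  have hbad : (bad.card : ℝ) ≤ n * (2 * (((rowSet n r).card : ℝ) / 2) ^ K) := by
    have h1 : bad.card ≤ ∑ v ∈ Finset.univ.filter fun v : Fin n => r v = 2, ∑ b : Bool,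
        ((rowSet n r).filter fun y => y v = b).card ^ K := by
      refine Finset.card_biUnion_le.trans (Finset.sum_le_sum fun v _ =>
        Finset.card_biUnion_le.trans (Finset.sum_le_sum fun b _ => ?_))
      simp
    have h2 : ∀ v ∈ Finset.univ.filter fun v : Fin n => r v = 2, ∀ b : Bool,
        (((rowSet n r).filter fun y => y v = b).card : ℝ) = ((rowSet n r).card : ℝ) / 2 := by
      intro v hv b
      rw [← card_rowSet_half (Finset.mem_filter.1 hv).2 b]
      push_cast; ring
    calc (bad.card : ℝ) ≤ ∑ v ∈ Finset.univ.filter fun v : Fin n => r v = 2, ∑ b : Bool,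
        (((rowSet n r).filter fun y => y v = b).card : ℝ) ^ K := by exact_mod_cast h1
      _ = ∑ v ∈ Finset.univ.filter fun v : Fin n => r v = 2,
          2 * (((rowSet n r).card : ℝ) / 2) ^ K := by
        refine Finset.sum_congr rfl fun v hv => ?_
        simp only [h2 v hv, Finset.sum_const, Finset.card_univ, Fintype.card_bool, nsmul_eq_mul]
        norm_num
      _ ≤ _ := by
        rw [Finset.sum_const, nsmul_eq_mul]
        refine mul_le_mul_of_nonneg_right ?_ (by positivity)
        have := Finset.card_filter_le (Finset.univ : Finset (Fin n)) fun v : Fin n => r v = 2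
        simp only [Finset.card_univ, Fintype.card_fin] at this
        exact_mod_cast this
  have h3 : ((rowSet n r).card : ℝ) ^ K ≤ (goodBlocks (n := n) K r).card + bad.card := by
    have := (Finset.card_le_card hcover).trans (Finset.card_union_le _ _)
    simp only [Fintype.card_piFinset, Finset.prod_const, Finset.card_univ, Fintype.card_fin] at this
    exact_mod_cast this
  have h4 : (n : ℝ) * (2 * (((rowSet n r).card : ℝ) / 2) ^ K) ≤ ((rowSet n r).card : ℝ) ^ K / 2 := by
    have hK' : (4 * n : ℝ) ≤ 2 ^ K := by exact_mod_cast hK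
    rw [div_pow, ← mul_assoc, mul_div_assoc', div_le_iff₀ (by positivity)]
    have : 0 ≤ ((rowSet n r).card : ℝ) ^ K := by positivity
    nlinarith
  linarith

/-- A block is good with probability `g ≥ θ ^ K / 2`, and `(1 - g) ^ B ≤ exp (-gB)`, where `gB ≥ u`
by the choice of `B`. -/
theorem sampleLaw_no_goodBlock {S : Finset (Fin n → Bool)} (hS : S.Nonempty) {K : ℕ}
    (hK : 4 * n ≤ 2 ^ K) (B : ℕ) {r : ℕ → ℕ} (hr : rowSet n r ⊆ S) {W : ℕ} {θ : ℝ} (hθ : 0 ≤ θ)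
    (hd : θ ≤ density S (rowSet n r)) (hW : 1 ≤ θ ^ K * W) {u : ℕ} (hB : B = 2 * (W * u)) :
    (sampleLaw S hS).real {ω | ∀ i < B, block K ω (i * K) ∉
      ((goodBlocks K r : Finset (Fin K → Fin n → Bool)) : Set _)} ≤ Real.exp (-u) := by
  have hgood : ∀ x ∈ goodBlocks (n := n) K r, ∀ t, x t ∈ S := fun x hx t =>
    hr (Fintype.mem_piFinset.1 (Finset.mem_filter.1 hx).1 t)
  rw [sampleLaw_blocks, infinitePi_pointLaw_real hS hgood]
  have hScard : (0 : ℝ) < S.card := by exact_mod_cast Finset.card_pos.2 hS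
  have h1 : θ ^ K / 2 ≤ ((goodBlocks (n := n) K r).card : ℝ) / (S.card : ℝ) ^ K := by
    have h2 := card_goodBlocks hK r
    rw [density, Finset.inter_eq_right.2 hr] at hd
    have h3 : θ ^ K ≤ ((rowSet n r).card : ℝ) ^ K / (S.card : ℝ) ^ K := by
      rw [← div_pow]; exact pow_le_pow_left₀ hθ hd K
    rw [le_div_iff₀ (by positivity)] at h3 ⊢
    linarith
  have h0 : ((goodBlocks (n := n) K r).card : ℝ) / (S.card : ℝ) ^ K ≤ 1 := by
    rw [← infinitePi_pointLaw_real hS hgood]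
    exact measureReal_le_one
  set g := ((goodBlocks (n := n) K r).card : ℝ) / (S.card : ℝ) ^ K
  have hWpos : (0 : ℝ) ≤ W := by positivity
  calc (1 - g) ^ B ≤ (Real.exp (-g)) ^ B :=
        pow_le_pow_left₀ (by linarith) (by have := Real.add_one_le_exp (-g); linarith) B
    _ = Real.exp (-(B * g)) := by rw [← Real.exp_nat_mul]; ring_nf
    _ ≤ Real.exp (-u) := by
      apply Real.exp_le_exp.2
      rw [hB]; push_cast
      have hu : (0 : ℝ) ≤ u := by positivity
      have h5 : 1 ≤ 2 * W * g := by nlinarith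
      nlinarith

end Blocks

/-! ## Good samples -/

section Good

variable {n : ℕ}

/-- The row of a term. -/
def termRow (T : Term n) (v : ℕ) : ℕ :=
  if h : v < n then
    if ((⟨v, h⟩ : Fin n), true) ∈ T then 1 else if ((⟨v, h⟩ : Fin n), false) ∈ T then 0 else 2
  else 1

/-- The satisfying assignments of a term. -/
def termSet (T : Term n) : Finset (Fin n → Bool) := Finset.univ.filter fun x => T.eval x = true

theorem mem_termSet {T : Term n} {x : Fin n → Bool} :
    x ∈ termSet T ↔ ∀ v b, (v, b) ∈ T → x v = b := by
  simp [termSet, Term.eval]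

/-- Satisfiability is needed: for a contradictory pair of literals the row records only the positive
one. -/
theorem rowSet_termRow {T : Term n} (h : (termSet T).Nonempty) :
    rowSet n (termRow T) = termSet T := by
  obtain ⟨y, hy⟩ := h
  rw [mem_termSet] at hy
  ext x
  rw [mem_rowSet, mem_termSet]
  have e : ∀ v : Fin n, termRow T v =
      if (v, true) ∈ T then 1 else if (v, false) ∈ T then 0 else 2 := fun v => by simp [termRow]
  simp only [e]
  constructor
  · intro h v b hb
    have h1 := h v
    cases b
    · have : (v, true) ∉ T := fun h' => by simpa [hy v _ hb] using hy v _ h'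
      rw [if_neg this, if_pos hb] at h1
      cases hx : x v <;> simp [hx] at h1 ⊢
    · rw [if_pos hb] at h1
      cases hx : x v <;> simp [hx] at h1 ⊢
  · intro h v
    split_ifs with h1 h2
    · simp [h v _ h1]
    · simp [h v _ h2]
    · simp

/-- The row with the given first entries. -/
def rowOf (c : Fin n → Fin 3) (v : ℕ) : ℕ := if h : v < n then c ⟨v, h⟩ else 1

theorem rowSet_congr {r r' : ℕ → ℕ} (h : ∀ v < n, r v = r' v) : rowSet n r = rowSet n r' := by
  ext x
  simp only [mem_rowSet]
  exact forall_congr' fun v => by rw [h v v.2]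

/-- There are only `3 ^ n` subcubes, indexed by a finite type over which a union bound is possible.
-/
theorem exists_rowOf {r : ℕ → ℕ} (hr : ∀ v, r v ≤ 2) :
    ∃ c : Fin n → Fin 3, rowSet n r = rowSet n (rowOf c) :=
  ⟨fun v => ⟨r v, by have := hr v; omega⟩, rowSet_congr fun v hv => by simp [rowOf, hv]⟩

/-- The samples yield every heavy term of the formula as a candidate, and the frequency of every
subcube among the samples of the second phase is close to its probability. -/
structure GoodSamples (S : Finset (Fin n → Bool)) (φ : DNF n) (s k j : ℕ)
    (ω : ℕ → Fin n → Bool) : Prop where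
  heavy : ∀ T ∈ φ, 1 / (4 * (s * k) : ℝ) ≤ density S (termSet T) → ∃ i < numCand n s k j,
    block (blockLen n) ω (i * blockLen n) ∈ goodBlocks (blockLen n) (termRow T)
  freq : ∀ c : Fin n → Fin 3,
    |(hits (rowSet n (rowOf c)) ω (numCand n s k j * blockLen n) (numEst n s k j) : ℝ) -
      numEst n s k j * density S (rowSet n (rowOf c))| ≤ slack n s k j

theorem four_mul_le_pow_blockLen (n : ℕ) : 4 * n ≤ 2 ^ blockLen n := by
  have := Nat.le_pow_clog (b := 2) (by norm_num) n
  rw [blockLen, pow_add]; omega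

theorem numCand_pos {s k j : ℕ} (hs : 0 < s) (hk : 0 < k) : 0 < numCand n s k j := by
  unfold numCand invHit; positivity

theorem invTol_pos {s k j : ℕ} (hs : 0 < s) (hk : 0 < k) : 0 < invTol n s k j := by
  have := numCand_pos (n := n) (j := j) hs hk
  unfold invTol; positivity

theorem exp_neg_le_two_pow (u : ℕ) : Real.exp (-u) ≤ (1 / 2) ^ u := by
  have h : Real.exp (-1) ≤ 1 / 2 := by
    rw [Real.exp_neg, one_div]
    apply inv_anti₀ (by norm_num)
    have := Real.add_one_le_exp (1 : ℝ)
    linarith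
  calc Real.exp (-u) = Real.exp (-1) ^ u := by rw [← Real.exp_nat_mul]; ring_nf
    _ ≤ _ := pow_le_pow_left₀ (Real.exp_nonneg _) h u

/-- Missing a heavy term and a wrong frequency each get probability `2 ^ (-(j + 1))`. Frequencies
are controlled for all subcubes at once, so no conditioning on the candidates, which are themselves
random, is needed. -/
theorem sampleLaw_not_good {S : Finset (Fin n → Bool)} (hS : S.Nonempty) {φ : DNF n}
    (hφ : S = Finset.univ.filter fun x => φ.eval x = true) {s k : ℕ} (hs : φ.length ≤ s)
    (hk : 0 < k) (j : ℕ) :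
    (sampleLaw S hS).real {ω | ¬ GoodSamples S φ s k j ω} ≤ (1 / 2) ^ j := by
  classical
  have hterm : ∀ T ∈ φ, termSet T ⊆ S := fun T hT x hx => by
    rw [hφ, Finset.mem_filter]
    exact ⟨Finset.mem_univ _, List.any_eq_true.2 ⟨T, hT, (Finset.mem_filter.1 hx).2⟩⟩
  have hs0 : 0 < s := by
    obtain ⟨x, hx⟩ := hS
    rw [hφ, Finset.mem_filter] at hx
    obtain ⟨T, hT, -⟩ := List.any_eq_true.1 hx.2
    exact (List.length_pos_of_mem hT).trans_le hs
  have hsk : (0 : ℝ) < 4 * (s * k) := by positivity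
  set miss : Term n → Set (ℕ → Fin n → Bool) := fun T =>
    {ω | 1 / (4 * (s * k) : ℝ) ≤ density S (termSet T) ∧ ∀ i < numCand n s k j,
    block (blockLen n) ω (i * blockLen n) ∉
      ((goodBlocks (blockLen n) (termRow T) : Finset (Fin (blockLen n) → Fin n → Bool)) : Set _)}
  set dev : (Fin n → Fin 3) → Set (ℕ → Fin n → Bool) := fun c => {ω |
    ¬ |(hits (rowSet n (rowOf c)) ω (numCand n s k j * blockLen n) (numEst n s k j) : ℝ) -
      numEst n s k j * density S (rowSet n (rowOf c))| ≤ slack n s k j}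
  have hsub : {ω | ¬ GoodSamples S φ s k j ω} ⊆ (⋃ T ∈ φ.toFinset, miss T) ∪
      ⋃ c ∈ (Finset.univ : Finset (Fin n → Fin 3)), dev c := by
    intro ω hω
    by_contra h
    simp only [Set.mem_union, Set.mem_iUnion, not_or, not_exists, List.mem_toFinset] at h
    refine hω ⟨fun T hT hd => ?_, fun c => ?_⟩
    · by_contra h'
      push Not at h'
      exact h.1 T hT ⟨hd, h'⟩
    · by_contra h'
      exact h.2 c (Finset.mem_univ _) h'
  have hmiss : ∀ T ∈ φ.toFinset, (sampleLaw S hS).real (miss T) ≤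
      Real.exp (-((j + s + 1 : ℕ) : ℝ)) := by
    intro T hT
    rw [List.mem_toFinset] at hT
    -- For a light term nothing is required, so its event is empty.
    by_cases hd : 1 / (4 * (s * k) : ℝ) ≤ density S (termSet T)
    · have hne : (termSet T).Nonempty := by
        rw [Finset.nonempty_iff_ne_empty]
        intro h
        rw [h, density, Finset.inter_empty, Finset.card_empty, Nat.cast_zero, zero_div] at hd
        exact absurd hd (not_le.2 (by positivity))
      refine (measureReal_mono ?_).trans (sampleLaw_no_goodBlock hS (K := blockLen n)
        (four_mul_le_pow_blockLen n) (numCand n s k j) (r := termRow T) (W := invHit n s k)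
        (θ := 1 / (4 * (s * k) : ℝ)) ?_ (by positivity) ?_ ?_ rfl)
      · exact fun ω hω => hω.2
      · rw [rowSet_termRow hne]; exact hterm T hT
      · rw [rowSet_termRow hne]; exact hd
      · rw [invHit]; push_cast
        rw [← mul_pow, one_div_mul_cancel hsk.ne', one_pow]
    · have : miss T = ∅ := Set.eq_empty_of_forall_notMem fun ω hω => hd hω.1
      rw [this, measureReal_empty]; positivity
  have hdev : ∀ c ∈ (Finset.univ : Finset (Fin n → Fin 3)), (sampleLaw S hS).real (dev c) ≤
      2 * (1 / 2) ^ (2 * (2 * n + j + 2)) := by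
    intro c _
    refine (sampleLaw_deviation hS _ _ _ (by positivity)).trans ?_
    have hH : (0 : ℝ) < invTol n s k j := by exact_mod_cast invTol_pos hs0 hk
    have e : -2 * (slack n s k j : ℝ) ^ 2 / numEst n s k j =
        -((2 * (2 * n + j + 2) : ℕ) : ℝ) := by
      have hu : (0 : ℝ) < 2 * n + j + 2 := by positivity
      rw [numEst, slack]; push_cast; field_simp
    rw [e]
    exact mul_le_mul_of_nonneg_left (exp_neg_le_two_pow _) (by norm_num)
  have h1 : (sampleLaw S hS).real (⋃ T ∈ φ.toFinset, miss T) ≤ (1 / 2) ^ (j + 1) := by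
    refine (measureReal_biUnion_finset_le _ _).trans ((Finset.sum_le_sum hmiss).trans ?_)
    rw [Finset.sum_const, nsmul_eq_mul]
    -- The crude bound `s ≤ 2 ^ s` turns the union bound into the summand `s` of the exponent.
    have hcard : (φ.toFinset.card : ℝ) ≤ 2 ^ s := by
      exact_mod_cast ((List.toFinset_card_le φ).trans hs).trans (Nat.lt_two_pow_self).le
    calc (φ.toFinset.card : ℝ) * Real.exp (-((j + s + 1 : ℕ) : ℝ)) ≤
        2 ^ s * (1 / 2) ^ (j + s + 1) :=
          mul_le_mul hcard (exp_neg_le_two_pow _) (Real.exp_nonneg _) (by positivity)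
      _ = (2 * (1 / 2)) ^ s * (1 / 2) ^ (j + 1) := by rw [mul_pow]; ring
      _ = _ := by norm_num
  have h2 : (sampleLaw S hS).real (⋃ c ∈ (Finset.univ : Finset (Fin n → Fin 3)), dev c) ≤
      (1 / 2) ^ (j + 1) := by
    refine (measureReal_biUnion_finset_le _ _).trans ((Finset.sum_le_sum hdev).trans ?_)
    rw [Finset.sum_const, nsmul_eq_mul, Finset.card_univ, Fintype.card_fun, Fintype.card_fin,
      Fintype.card_fin]
    have h3 : ((3 ^ n : ℕ) : ℝ) ≤ 4 ^ n := by
      exact_mod_cast Nat.pow_le_pow_left (by norm_num) n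
    have h4 : ((1 : ℝ) / 2) ^ (2 * (2 * n + j + 2)) ≤ (1 / 2) ^ (2 * n + (j + 2)) :=
      pow_le_pow_of_le_one (by norm_num) (by norm_num) (by omega)
    calc ((3 ^ n : ℕ) : ℝ) * (2 * (1 / 2) ^ (2 * (2 * n + j + 2))) ≤
        4 ^ n * (2 * (1 / 2) ^ (2 * n + (j + 2))) := by gcongr
      _ = (4 * (1 / 2) ^ 2) ^ n * (1 / 2) ^ (j + 1) := by
        rw [mul_pow, ← pow_mul, pow_add]; ring
      _ = _ := by norm_num
  refine (measureReal_mono hsub).trans ((measureReal_union_le _ _).trans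
    ((add_le_add h1 h2).trans_eq ?_))
  rw [pow_succ]; ring

end Good

/-! ## The selected terms for good samples -/

section Selected

variable {n s k j : ℕ} {τ : Tape n}

theorem candRow_le_two (d : Dims) (τ : Tape n) (i v : ℕ) : candRow d τ i v ≤ 2 :=
  commonRow_le_two _ _ _ _

theorem candRow_of_le (d : Dims) (τ : Tape n) (i : ℕ) {v : ℕ} (hv : n ≤ v) :
    candRow d τ i v = 1 := by
  have : ∀ t, extSample τ t v = 1 := fun t => by simp [extSample, hv.not_gt]
  simp [candRow, commonRow, this]

/-- On a good block the literals of the term are constant because all samples satisfy it, and every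
other variable takes both values. -/
theorem candRow_eq_termRow {T : Term n} {i : ℕ}
    (h : block (blockLen n) τ.1 (i * blockLen n) ∈ goodBlocks (blockLen n) (termRow T)) {v : ℕ}
    (hv : v < n) : candRow (dims n s k j) τ i v = termRow T v := by
  obtain ⟨h1, h2⟩ := Finset.mem_filter.1 h
  rw [Fintype.mem_piFinset] at h1
  have hK : (dims n s k j).K + 1 = blockLen n := rfl
  have hx : ∀ t ≤ (dims n s k j).K, ∃ t' : Fin (blockLen n), (t' : ℕ) = t ∧
      extSample τ (i * blockLen n + t) v =
        (block (blockLen n) τ.1 (i * blockLen n) t' ⟨v, hv⟩).toNat := fun t ht =>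
    ⟨⟨t, by omega⟩, rfl, by simp [extSample, hv, block]⟩
  rw [candRow, hK, commonRow]
  by_cases hT : termRow T v = 2
  · rw [if_neg, hT]
    intro hall
    obtain ⟨t, t', hne⟩ := h2 ⟨v, hv⟩ hT
    apply hne
    have ha := hall t (by omega)
    have hb := hall t' (by omega)
    rw [← hb] at ha
    simp only [extSample, hv, dif_pos] at ha
    simp only [block]
    revert ha
    cases τ.1 (i * blockLen n + t) ⟨v, hv⟩ <;> cases τ.1 (i * blockLen n + t') ⟨v, hv⟩ <;> simp
  · have hval : ∀ t ≤ (dims n s k j).K, extSample τ (i * blockLen n + t) v = termRow T v :=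
      fun t ht => by
        obtain ⟨t', -, h3⟩ := hx t ht
        rw [h3]
        exact ((mem_rowSet.1 (h1 t') ⟨v, hv⟩).resolve_left hT).symm
    have h0 := hval 0 (Nat.zero_le _)
    rw [add_zero] at h0
    rw [if_pos fun t ht => by rw [hval t ht, h0], h0]

/-- The subcube of candidate term number `i`. -/
def candSet (n s k j : ℕ) (τ : Tape n) (i : ℕ) : Finset (Fin n → Bool) :=
  rowSet n (candRow (dims n s k j) τ i)

theorem candCount_eq (i : ℕ) : candCount (dims n s k j) τ i =
    hits (candSet n s k j τ i) τ.1 (numCand n s k j * blockLen n) (numEst n s k j) := by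
  unfold candCount hits
  have hK : (dims n s k j).K + 1 = blockLen n := rfl
  have e : ∀ t, rowSat (dims n s k j).N (candRow (dims n s k j) τ i)
      (extSample τ ((dims n s k j).B * ((dims n s k j).K + 1) + t)) ↔
      τ.1 (numCand n s k j * blockLen n + t) ∈ candSet n s k j τ i := by
    intro t
    rw [hK, show (dims n s k j).B = numCand n s k j from rfl, candSet, mem_rowSet]
    constructor
    · intro h v
      have := h v (by simp only [dims, Dims.N]; omega)
      simpa [extSample] using this
    · intro h v hv
      by_cases hvn : v < n
      · have := h ⟨v, hvn⟩
        simpa [extSample, hvn] using this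
      · right
        rw [candRow_of_le _ _ _ (by omega)]
        simp [extSample, hvn]
  simp only [e]
  rfl

theorem count_eq_of_le {p : ℕ → Prop} [DecidablePred p] {n N : ℕ} (hn : n ≤ N)
    (h : ∀ v, n ≤ v → ¬ p v) : Nat.count p N = Nat.count p n := by
  obtain ⟨b, rfl⟩ := Nat.exists_eq_add_of_le hn
  rw [Nat.count_add, Nat.add_eq_left]
  rw [Nat.count_eq_card_filter_range, Finset.card_eq_zero, Finset.filter_eq_empty_iff]
  exact fun v _ => h _ (by omega)

theorem candFree_eq (i : ℕ) : candFree (dims n s k j) τ i =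
    Nat.count (fun v => candRow (dims n s k j) τ i v = 2) n :=
  count_eq_of_le (by simp [dims, Dims.N]) fun v hv h => by
    rw [candRow_of_le _ _ _ hv] at h; omega

theorem candFree_le_n (i : ℕ) : candFree (dims n s k j) τ i ≤ n := by
  rw [candFree_eq]; exact Nat.count_le _

theorem card_rowSet {r : ℕ → ℕ} (hr : ∀ v, r v ≤ 2) :
    (rowSet n r).card = 2 ^ Nat.count (fun v => r v = 2) n := by
  have e : rowSet n r = Fintype.piFinset fun v : Fin n =>
      if r v = 2 then Finset.univ else {decide (r v = 1)} := by
    ext x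
    rw [mem_rowSet, Fintype.mem_piFinset]
    refine forall_congr' fun v => ?_
    have := hr v
    split_ifs with h
    · simp [h]
    · rcases (by omega : r v = 0 ∨ r v = 1) with h0 | h0 <;> cases hx : x v <;> simp [h0]
  rw [e, Fintype.card_piFinset]
  have e2 : ∀ v : Fin n, (if r v = 2 then (Finset.univ : Finset Bool)
      else {decide (r v = 1)}).card = if r v = 2 then 2 else 1 := fun v => by split_ifs <;> simp
  simp only [e2]
  rw [Fin.prod_univ_eq_prod_range (fun v => if r v = 2 then 2 else 1) n,
    Finset.prod_ite, Finset.prod_const, Finset.prod_const, one_pow, mul_one,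
    ← Nat.count_eq_card_filter_range]

theorem card_candSet (i : ℕ) :
    (candSet n s k j τ i).card = 2 ^ candFree (dims n s k j) τ i := by
  rw [candFree_eq]; exact card_rowSet (candRow_le_two _ _ _)

theorem litCount_candRow (i : ℕ) :
    litCount (candRow (dims n s k j) τ i) (dims n s k j).N + candFree (dims n s k j) τ i =
      (dims n s k j).N := by
  have : ∀ (p : ℕ → Prop) [DecidablePred p] (N : ℕ),
      Nat.count (fun v => ¬ p v) N + Nat.count p N = N := by
    intro p _ N
    induction N with
    | zero => simp
    | succ N ih =>
      rw [Nat.count_succ, Nat.count_succ]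
      by_cases h : p N <;> simp only [h, not_true, not_false_eq_true, if_true, if_false] <;> omega
  exact this _ _

end Selected

/-! ## The union of the selected terms is close to the satisfying set -/

section Selected

variable {n s k j : ℕ} {τ : Tape n} {S : Finset (Fin n → Bool)} {φ : DNF n}

/-- Here `x = |C|/|S|`, `p` and `p'` are the densities of `C` and of a dense term, and `η` is the
tolerance. Dividing by `p' ≥ 1/s` gives `x * (1 - 2ηs) ≤ p + 2η`, so the excess is of order `ηs`
once `x` is known to be bounded. -/
theorem excess_le {x p p' η s : ℝ} (hx : 0 ≤ x) (hp : p ≤ 1) (hs : 1 ≤ s)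
    (hp' : 1 ≤ s * p') (hη : 0 < η) (hηs : 32 * (η * s) ≤ 1)
    (h : x * (p' - 2 * η) ≤ p' * (p + 2 * η)) : x - p ≤ 8 * (η * s) := by
  have h0 : 0 < p' := by
    by_contra h0
    nlinarith [mul_nonneg (by linarith : (0 : ℝ) ≤ s) (by linarith : 0 ≤ -p')]
  have hq : 1 / p' ≤ s := by rw [div_le_iff₀ h0]; exact hp'
  have h1 : x * (1 - 2 * (η * (1 / p'))) ≤ p + 2 * η := by
    rw [← mul_le_mul_iff_of_pos_left h0]
    calc p' * (x * (1 - 2 * (η * (1 / p')))) = x * (p' - 2 * η) := by field_simp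
      _ ≤ _ := h
  have h2 : η * (1 / p') ≤ η * s := mul_le_mul_of_nonneg_left hq hη.le
  have h3 : η ≤ η * s := le_mul_of_one_le_right hη.le hs
  have h4 : x * (η * (1 / p')) ≤ x * (η * s) := mul_le_mul_of_nonneg_left h2 hx
  have h5 : x * (32 * (η * s)) ≤ x * 1 := mul_le_mul_of_nonneg_left hηs hx
  have hx2 : x ≤ 2 := by nlinarith
  have h6 : x * (η * s) ≤ 2 * (η * s) := mul_le_mul_of_nonneg_right hx2 (by linarith)
  nlinarith

theorem termSet_subset (hφ : S = Finset.univ.filter fun x => φ.eval x = true) {T : Term n}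
    (hT : T ∈ φ) : termSet T ⊆ S := fun x hx => by
  rw [hφ, Finset.mem_filter]
  exact ⟨Finset.mem_univ _, List.any_eq_true.2 ⟨T, hT, (Finset.mem_filter.1 hx).2⟩⟩

theorem exists_term_of_mem (hφ : S = Finset.univ.filter fun x => φ.eval x = true)
    {x : Fin n → Bool} (hx : x ∈ S) : ∃ T ∈ φ, x ∈ termSet T := by
  rw [hφ, Finset.mem_filter] at hx
  obtain ⟨T, hT, h⟩ := List.any_eq_true.1 hx.2
  exact ⟨T, hT, Finset.mem_filter.2 ⟨Finset.mem_univ _, h⟩⟩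

theorem card_mul_density (hS : S.Nonempty) (T : Finset (Fin n → Bool)) :
    (S.card : ℝ) * density S T = (S ∩ T).card := by
  have : (S.card : ℝ) ≠ 0 := by exact_mod_cast hS.card_pos.ne'
  rw [density]; field_simp

/-- The truncated subtraction in the test is harmless: where it matters, both inequalities hold
trivially. -/
theorem candKeep_iff (i : ℕ) : candKeep (dims n s k j) τ i ↔ ∀ i' < numCand n s k j,
    ((candSet n s k j τ i).card : ℝ) * (candCount (dims n s k j) τ i' - slack n s k j) ≤
      (candSet n s k j τ i').card * (candCount (dims n s k j) τ i + slack n s k j) := by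
  refine forall₂_congr fun i' _ => ?_
  rw [show (dims n s k j).e = slack n s k j from rfl, ← card_candSet, ← card_candSet]
  rcases le_total (slack n s k j) (candCount (dims n s k j) τ i') with h | h
  · rw [← Nat.cast_sub h]; norm_cast
  · rw [Nat.sub_eq_zero_of_le h, mul_zero]
    have : (candCount (dims n s k j) τ i' : ℝ) ≤ slack n s k j := by exact_mod_cast h
    refine iff_of_true (Nat.zero_le _) (le_trans
      (mul_nonpos_of_nonneg_of_nonpos (by positivity) (by linarith)) (by positivity))

theorem GoodSamples.abs_candCount_sub (h : GoodSamples S φ s k j τ.1) (i : ℕ) :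
    |(candCount (dims n s k j) τ i : ℝ) - numEst n s k j * density S (candSet n s k j τ i)| ≤
      slack n s k j := by
  obtain ⟨c, hc⟩ := exists_rowOf (n := n) (candRow_le_two (dims n s k j) τ i)
  have := h.freq c
  rw [← hc] at this
  rw [candCount_eq]; exact this

theorem GoodSamples.exists_candSet (h : GoodSamples S φ s k j τ.1) (hs : 0 < s) (hk : 0 < k)
    {T : Term n} (hT : T ∈ φ) (hd : 1 / (4 * (s * k) : ℝ) ≤ density S (termSet T)) :
    ∃ i < numCand n s k j, candSet n s k j τ i = termSet T := by
  obtain ⟨i, hi, hb⟩ := h.heavy T hT hd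
  refine ⟨i, hi, ?_⟩
  have hne : (termSet T).Nonempty := by
    rw [Finset.nonempty_iff_ne_empty]
    intro h
    rw [h, density, Finset.inter_empty, Finset.card_empty, Nat.cast_zero, zero_div] at hd
    exact absurd hd (not_le.2 (by positivity))
  rw [← rowSet_termRow hne]
  exact rowSet_congr fun v hv => candRow_eq_termRow hb hv

/-- For `C ⊆ S` one has `|C| = |S| p(C)`, while `|S| p(C') ≤ |C'|` for every other candidate; the
slack on both sides of the test absorbs the sampling errors. -/
theorem GoodSamples.candKeep_of_subset (h : GoodSamples S φ s k j τ.1) (hS : S.Nonempty) {i : ℕ}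
    (hi : candSet n s k j τ i ⊆ S) : candKeep (dims n s k j) τ i := by
  rw [candKeep_iff]
  intro i' _
  have h1 := (abs_le.1 (h.abs_candCount_sub i)).1
  have h2 := (abs_le.1 (h.abs_candCount_sub i')).2
  have h3 := card_mul_density hS (candSet n s k j τ i)
  have h4 := card_mul_density hS (candSet n s k j τ i')
  rw [Finset.inter_eq_right.2 hi] at h3
  have h5 : ((S ∩ candSet n s k j τ i').card : ℝ) ≤ (candSet n s k j τ i').card := by
    exact_mod_cast Finset.card_le_card Finset.inter_subset_right
  have h6 : 0 ≤ density S (candSet n s k j τ i) := by unfold density; positivity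
  calc ((candSet n s k j τ i).card : ℝ) * (candCount (dims n s k j) τ i' - slack n s k j) ≤
        (candSet n s k j τ i).card * (numEst n s k j * density S (candSet n s k j τ i')) :=
        mul_le_mul_of_nonneg_left (by linarith) (by positivity)
    _ = (S.card * density S (candSet n s k j τ i')) *
        (numEst n s k j * density S (candSet n s k j τ i)) := by rw [← h3]; ring
    _ ≤ (candSet n s k j τ i').card * (numEst n s k j * density S (candSet n s k j τ i)) :=
        mul_le_mul_of_nonneg_right (h4.trans_le h5) (by positivity)
    _ ≤ _ := mul_le_mul_of_nonneg_left (by linarith) (by positivity)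

/-- Pigeonhole: at most `s` terms cover `S`. -/
theorem exists_dense_term (hS : S.Nonempty)
    (hφ : S = Finset.univ.filter fun x => φ.eval x = true) (hs : φ.length ≤ s) :
    ∃ T ∈ φ, 1 ≤ s * density S (termSet T) := by
  classical
  by_contra! hc
  have hS0 : (0 : ℝ) < S.card := by exact_mod_cast hS.card_pos
  have hsub : S ⊆ φ.toFinset.biUnion termSet := fun x hx => by
    obtain ⟨T, hT, h⟩ := exists_term_of_mem hφ hx
    exact Finset.mem_biUnion.2 ⟨T, List.mem_toFinset.2 hT, h⟩
  obtain ⟨x, hx⟩ := hS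
  obtain ⟨T₀, hT₀, -⟩ := exists_term_of_mem hφ hx
  have hne : φ.toFinset.Nonempty := ⟨T₀, List.mem_toFinset.2 hT₀⟩
  have h1 : (S.card : ℝ) ≤ ∑ T ∈ φ.toFinset, ((termSet T).card : ℝ) := by
    exact_mod_cast (Finset.card_le_card hsub).trans Finset.card_biUnion_le
  have h2 : ∑ T ∈ φ.toFinset, (s : ℝ) * ((termSet T).card : ℝ) <
      ∑ _T ∈ φ.toFinset, (S.card : ℝ) := by
    refine Finset.sum_lt_sum_of_nonempty hne fun T hT => ?_
    rw [List.mem_toFinset] at hT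
    have h := hc T hT
    rw [← mul_lt_mul_iff_of_pos_left hS0, mul_left_comm, card_mul_density ⟨x, hx⟩,
      Finset.inter_eq_right.2 (termSet_subset hφ hT), mul_one] at h
    exact h
  rw [← Finset.mul_sum, Finset.sum_const, nsmul_eq_mul] at h2
  have h3 : (φ.toFinset.card : ℝ) ≤ s := by
    exact_mod_cast (List.toFinset_card_le φ).trans hs
  have h4 := mul_le_mul_of_nonneg_left h1 (Nat.cast_nonneg (α := ℝ) s)
  have h5 := mul_le_mul_of_nonneg_right h3 hS0.le
  linarith

/-- A dense term is heavy, hence a candidate, and `C` was selected against it. -/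
theorem GoodSamples.card_sdiff_le (h : GoodSamples S φ s k j τ.1) (hS : S.Nonempty)
    (hφ : S = Finset.univ.filter fun x => φ.eval x = true) (hs : φ.length ≤ s) (hk : 0 < k)
    {i : ℕ} (hi : candKeep (dims n s k j) τ i) :
    ((candSet n s k j τ i \ S).card : ℝ) ≤ S.card / (4 * (k * numCand n s k j)) := by
  obtain ⟨T, hT, hd⟩ := exists_dense_term hS hφ hs
  have hs0 : 0 < s := (List.length_pos_of_mem hT).trans_le hs
  have hs1 : (1 : ℝ) ≤ s := by exact_mod_cast hs0
  have hk1 : (1 : ℝ) ≤ k := by exact_mod_cast hk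
  have hB : (1 : ℝ) ≤ numCand n s k j := by exact_mod_cast numCand_pos (n := n) (j := j) hs0 hk
  have hS0 : (0 : ℝ) < S.card := by exact_mod_cast hS.card_pos
  have hheavy : 1 / (4 * (s * k) : ℝ) ≤ density S (termSet T) := by
    rw [div_le_iff₀ (by positivity)]
    have : 0 ≤ density S (termSet T) := by unfold density; positivity
    nlinarith
  obtain ⟨i', hi', hc⟩ := h.exists_candSet hs0 hk hT hheavy
  have hsub := termSet_subset hφ hT
  have hkeep := (candKeep_iff i).1 hi i' hi'
  have h1 := (abs_le.1 (h.abs_candCount_sub i)).2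
  have h2 := (abs_le.1 (h.abs_candCount_sub i')).1
  have h3 := card_mul_density hS (candSet n s k j τ i)
  have h4 := card_mul_density hS (candSet n s k j τ i')
  rw [hc] at h2 h4 hkeep
  rw [Finset.inter_eq_right.2 hsub] at h4
  have hH : (0 : ℝ) < invTol n s k j := by exact_mod_cast invTol_pos hs0 hk
  have he : (0 : ℝ) < slack n s k j := by unfold slack; push_cast; positivity
  have hm : (numEst n s k j : ℝ) = invTol n s k j * slack n s k j := by
    rw [numEst]; push_cast; rfl
  have hηs : 1 / (invTol n s k j : ℝ) * s = 1 / (32 * (k * numCand n s k j)) := by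
    rw [invTol]; push_cast; field_simp
  have hp1 : density S (candSet n s k j τ i) ≤ 1 := by
    rw [density, div_le_one hS0]
    exact_mod_cast Finset.card_le_card Finset.inter_subset_left
  -- The tolerance is `slack / numEst = 1 / invTol`. It enters twice on each side: from the test
  -- itself and from the sampling error.
  have key := excess_le (x := (candSet n s k j τ i).card / S.card)
    (p := density S (candSet n s k j τ i)) (p' := density S (termSet T))
    (η := 1 / (invTol n s k j : ℝ)) (by positivity) hp1 hs1 hd (by positivity)
    (by
      rw [hηs, ← mul_div_assoc, div_le_one (by positivity)]
      nlinarith)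
    (by
      have h5 : ((candSet n s k j τ i).card : ℝ) *
          (numEst n s k j * density S (termSet T) - 2 * slack n s k j) ≤
          (S.card * density S (termSet T)) * (numEst n s k j * density S (candSet n s k j τ i) +
            2 * slack n s k j) := by
        rw [h4]
        refine (mul_le_mul_of_nonneg_left ?_ (by positivity)).trans (hkeep.trans
          (mul_le_mul_of_nonneg_left ?_ (by positivity))) <;> linarith
      rw [hm] at h5
      rw [← mul_le_mul_iff_of_pos_left (mul_pos hS0 (mul_pos hH he))]
      refine le_of_eq_of_le ?_ (h5.trans_eq ?_) <;> field_simp)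
  rw [hηs] at key
  have h6 : ((candSet n s k j τ i \ S).card : ℝ) =
      S.card * ((candSet n s k j τ i).card / S.card - density S (candSet n s k j τ i)) := by
    rw [mul_sub, h3, mul_div_cancel₀ _ hS0.ne']
    have := Finset.card_sdiff_add_card_inter (candSet n s k j τ i) S
    rw [Finset.inter_comm] at this
    rw [← this]; push_cast; ring
  rw [h6]
  refine (mul_le_mul_of_nonneg_left key hS0.le).trans_eq ?_
  field_simp; norm_num

/-- The union of the selected candidate terms. -/
def hypSet (n s k j : ℕ) (τ : Tape n) : Finset (Fin n → Bool) :=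
  keptSet n (candRow (dims n s k j) τ) (candKeep (dims n s k j) τ) (dims n s k j).B

theorem hypSet_eq : hypSet n s k j τ = ((Finset.range (numCand n s k j)).filter
    (candKeep (dims n s k j) τ)).biUnion (candSet n s k j τ) := rfl

theorem GoodSamples.card_hypSet_sdiff_le (h : GoodSamples S φ s k j τ.1) (hS : S.Nonempty)
    (hφ : S = Finset.univ.filter fun x => φ.eval x = true) (hs : φ.length ≤ s) (hk : 0 < k) :
    ((hypSet n s k j τ \ S).card : ℝ) ≤ S.card / (4 * k) := by
  classical
  obtain ⟨x, hx⟩ := hS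
  obtain ⟨T, hT, -⟩ := exists_term_of_mem hφ hx
  have hs0 : 0 < s := (List.length_pos_of_mem hT).trans_le hs
  have hB : (0 : ℝ) < numCand n s k j := by exact_mod_cast numCand_pos hs0 hk
  have hk0 : (0 : ℝ) < k := by exact_mod_cast hk
  have hsub : hypSet n s k j τ \ S ⊆ ((Finset.range (numCand n s k j)).filter
      (candKeep (dims n s k j) τ)).biUnion fun i => candSet n s k j τ i \ S := by
    intro y hy
    simp only [hypSet_eq, Finset.mem_sdiff, Finset.mem_biUnion] at hy ⊢
    obtain ⟨⟨i, hi, h1⟩, h2⟩ := hy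
    exact ⟨i, hi, h1, h2⟩
  calc ((hypSet n s k j τ \ S).card : ℝ) ≤ ∑ i ∈ (Finset.range (numCand n s k j)).filter
        (candKeep (dims n s k j) τ), ((candSet n s k j τ i \ S).card : ℝ) := by
        exact_mod_cast (Finset.card_le_card hsub).trans Finset.card_biUnion_le
    _ ≤ ∑ i ∈ (Finset.range (numCand n s k j)).filter (candKeep (dims n s k j) τ),
        (S.card : ℝ) / (4 * (k * numCand n s k j)) := Finset.sum_le_sum fun i hi =>
          h.card_sdiff_le ⟨x, hx⟩ hφ hs hk (Finset.mem_filter.1 hi).2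
    _ ≤ numCand n s k j * (S.card / (4 * (k * numCand n s k j))) := by
        rw [Finset.sum_const, nsmul_eq_mul]
        refine mul_le_mul_of_nonneg_right ?_ (by positivity)
        exact_mod_cast (Finset.card_filter_le _ _).trans_eq (Finset.card_range _)
    _ = _ := by field_simp

/-- A heavy term is a candidate inside `S`, hence selected. A missed point therefore lies in one of
at most `s` light terms, each of size below `|S|/(4sk)`. -/
theorem GoodSamples.card_sdiff_hypSet_le (h : GoodSamples S φ s k j τ.1) (hS : S.Nonempty)
    (hφ : S = Finset.univ.filter fun x => φ.eval x = true) (hs : φ.length ≤ s) (hk : 0 < k) :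
    ((S \ hypSet n s k j τ).card : ℝ) ≤ S.card / (4 * k) := by
  classical
  obtain ⟨x, hx⟩ := hS
  have hS : S.Nonempty := ⟨x, hx⟩
  obtain ⟨T, hT, -⟩ := exists_term_of_mem hφ hx
  have hs0 : 0 < s := (List.length_pos_of_mem hT).trans_le hs
  have hs1 : (0 : ℝ) < s := by exact_mod_cast hs0
  have hk0 : (0 : ℝ) < k := by exact_mod_cast hk
  have hsub : S \ hypSet n s k j τ ⊆ (φ.toFinset.filter fun T =>
      density S (termSet T) < 1 / (4 * (s * k) : ℝ)).biUnion termSet := by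
    intro y hy
    rw [Finset.mem_sdiff] at hy
    obtain ⟨T, hT, hyT⟩ := exists_term_of_mem hφ hy.1
    refine Finset.mem_biUnion.2 ⟨T, Finset.mem_filter.2 ⟨List.mem_toFinset.2 hT, ?_⟩, hyT⟩
    by_contra hd
    obtain ⟨i, hi, hc⟩ := h.exists_candSet hs0 hk hT (not_lt.1 hd)
    refine hy.2 ?_
    rw [hypSet_eq, Finset.mem_biUnion]
    exact ⟨i, Finset.mem_filter.2 ⟨Finset.mem_range.2 hi,
      h.candKeep_of_subset hS (hc ▸ termSet_subset hφ hT)⟩, hc ▸ hyT⟩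
  calc ((S \ hypSet n s k j τ).card : ℝ) ≤ ∑ T ∈ φ.toFinset.filter fun T =>
      density S (termSet T) < 1 / (4 * (s * k) : ℝ), ((termSet T).card : ℝ) := by
        exact_mod_cast (Finset.card_le_card hsub).trans Finset.card_biUnion_le
    _ ≤ ∑ T ∈ φ.toFinset.filter fun T =>
        density S (termSet T) < 1 / (4 * (s * k) : ℝ), (S.card : ℝ) * (1 / (4 * (s * k))) := by
        refine Finset.sum_le_sum fun T hT => ?_
        rw [Finset.mem_filter, List.mem_toFinset] at hT
        rw [← Finset.inter_eq_right.2 (termSet_subset hφ hT.1), ← card_mul_density hS]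
        exact mul_le_mul_of_nonneg_left hT.2.le (by positivity)
    _ ≤ s * (S.card * (1 / (4 * (s * k)))) := by
        rw [Finset.sum_const, nsmul_eq_mul]
        refine mul_le_mul_of_nonneg_right ?_ (by positivity)
        exact_mod_cast (Finset.card_filter_le _ _).trans ((List.toFinset_card_le φ).trans hs)
    _ = _ := by field_simp

theorem GoodSamples.exists_candKeep (h : GoodSamples S φ s k j τ.1) (hS : S.Nonempty)
    (hφ : S = Finset.univ.filter fun x => φ.eval x = true) (hs : φ.length ≤ s) (hk : 0 < k) :
    ∃ i < numCand n s k j, candKeep (dims n s k j) τ i := by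
  obtain ⟨T, hT, hd⟩ := exists_dense_term hS hφ hs
  have hs0 : 0 < s := (List.length_pos_of_mem hT).trans_le hs
  have hs1 : (1 : ℝ) ≤ s := by exact_mod_cast hs0
  have hk1 : (1 : ℝ) ≤ k := by exact_mod_cast hk
  have hheavy : 1 / (4 * (s * k) : ℝ) ≤ density S (termSet T) := by
    rw [div_le_iff₀ (by positivity)]
    have : 0 ≤ density S (termSet T) := by unfold density; positivity
    nlinarith
  obtain ⟨i, hi, hc⟩ := h.exists_candSet hs0 hk hT hheavy
  exact ⟨i, hi, h.candKeep_of_subset hS (hc ▸ termSet_subset hφ hT)⟩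

theorem candFree_le_maxFree {i : ℕ} (hi : i < numCand n s k j)
    (hk : candKeep (dims n s k j) τ i) :
    candFree (dims n s k j) τ i ≤ maxFree (dims n s k j) τ :=
  Finset.le_sup (f := candFree (dims n s k j) τ)
    (Finset.mem_filter.2 ⟨Finset.mem_range.2 hi, hk⟩)

theorem maxFree_le : maxFree (dims n s k j) τ ≤ n := Finset.sup_le fun _ _ => candFree_le_n _

theorem card_hypSet_le :
    (hypSet n s k j τ).card ≤ numCand n s k j * 2 ^ maxFree (dims n s k j) τ := by
  rw [hypSet_eq]
  refine Finset.card_biUnion_le.trans ((Finset.sum_le_card_nsmul _ _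
    (2 ^ maxFree (dims n s k j) τ) fun i hi => ?_).trans ?_)
  · rw [Finset.mem_filter, Finset.mem_range] at hi
    rw [card_candSet]
    exact Nat.pow_le_pow_right (by norm_num) (candFree_le_maxFree hi.1 hi.2)
  · rw [smul_eq_mul]
    exact Nat.mul_le_mul_right _ ((Finset.card_filter_le _ _).trans_eq (Finset.card_range _))

/-- The largest selected subcube alone bounds the union from below; this keeps the acceptance
probability of a cycle at least `2 ^ (-b)`. -/
theorem two_pow_maxFree_le (h : ∃ i < numCand n s k j, candKeep (dims n s k j) τ i) :
    2 ^ maxFree (dims n s k j) τ ≤ (hypSet n s k j τ).card := by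
  obtain ⟨i₀, h0, hk0⟩ := h
  obtain ⟨i, hi, he⟩ := Finset.exists_mem_eq_sup ((Finset.range (numCand n s k j)).filter
    (candKeep (dims n s k j) τ)) ⟨i₀, Finset.mem_filter.2 ⟨Finset.mem_range.2 h0, hk0⟩⟩
    (candFree (dims n s k j) τ)
  have : maxFree (dims n s k j) τ = candFree (dims n s k j) τ i := he
  rw [this, ← card_candSet, hypSet_eq]
  exact Finset.card_le_card (Finset.subset_biUnion_of_mem (candSet n s k j τ) hi)

end Selected

/-! ## The output is a sampler -/

section Tv

variable {α : Type*} [Fintype α]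

theorem sum_toReal (D : PMF α) : ∑ x, (D x).toReal = 1 := by
  rw [← ENNReal.toReal_sum fun x _ => D.apply_ne_top x, ← tsum_fintype (L := .unconditional _),
    D.tsum_coe, ENNReal.toReal_one]

/-- The distance equals `1 - ∑ min (D x) (D' x)`, so a common lower bound on a set suffices; no
upper bound on the probabilities is needed. -/
theorem tvDist_le_one_sub (D D' : PMF α) (A : Finset α) {c : ℝ}
    (h : ∀ x ∈ A, c ≤ (D x).toReal) (h' : ∀ x ∈ A, c ≤ (D' x).toReal) :
    tvDist D D' ≤ 1 - c * A.card := by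
  classical
  have e : ∀ x, |(D x).toReal - (D' x).toReal| =
      (D x).toReal + (D' x).toReal - 2 * min (D x).toReal (D' x).toReal := fun x => by
    rcases le_total (D x).toReal (D' x).toReal with h | h
    · rw [min_eq_left h, abs_of_nonpos (by linarith)]; ring
    · rw [min_eq_right h, abs_of_nonneg (by linarith)]; ring
  have h1 : c * A.card ≤ ∑ x, min (D x).toReal (D' x).toReal := by
    calc c * A.card = ∑ x ∈ A, c := by rw [Finset.sum_const, nsmul_eq_mul, mul_comm]
      _ ≤ ∑ x ∈ A, min (D x).toReal (D' x).toReal :=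
        Finset.sum_le_sum fun x hx => le_min (h x hx) (h' x hx)
      _ ≤ _ := Finset.sum_le_sum_of_subset_of_nonneg (Finset.subset_univ _) fun _ _ _ =>
        le_min ENNReal.toReal_nonneg ENNReal.toReal_nonneg
  rw [tvDist]
  simp only [e]
  rw [Finset.sum_sub_distrib, Finset.sum_add_distrib, sum_toReal, sum_toReal, ← Finset.mul_sum]
  linarith

theorem tvDist_le_one (D D' : PMF α) : tvDist D D' ≤ 1 := by
  simpa using tvDist_le_one_sub D D' ∅ (c := 0) (by simp) (by simp)

end Tv

theorem map_uniformOfFintype_toReal {α β : Type*} [DecidableEq α] [Fintype β] [Nonempty β] (g : β → α) (y : α) :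
    (((PMF.uniformOfFintype β).map g) y).toReal =
      (Finset.univ.filter fun z => g z = y).card / Fintype.card β := by
  rw [PMF.map_apply, tsum_fintype]
  simp only [PMF.uniformOfFintype_apply]
  rw [ENNReal.toReal_sum fun x _ => by
    split_ifs <;> simp [ENNReal.inv_eq_top, Fintype.card_ne_zero]]
  rw [div_eq_mul_inv, ← nsmul_eq_mul, ← Finset.sum_const, Finset.sum_filter]
  refine Finset.sum_congr rfl fun x _ => ?_
  by_cases h : g x = y
  · simp [h]
  · simp [h, Ne.symm h]

/-- This amounts to `(1 - δ) ^ 3 ≥ (1 - 4δ)(1 + δ)`; the difference is `7δ² - δ³`. -/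
theorem combine_bounds {S A δ : ℝ} (hS : 0 < S) (hδ : 0 ≤ δ) (hδ1 : δ ≤ 1)
    (hA : (1 - δ) * S ≤ A) :
    1 - (1 - δ) * (1 - δ) / ((1 + δ) * S) * A ≤ 4 * δ := by
  have h1 : (1 - δ) * (1 - δ) / ((1 + δ) * S) * ((1 - δ) * S) ≤
      (1 - δ) * (1 - δ) / ((1 + δ) * S) * A :=
    mul_le_mul_of_nonneg_left hA (div_nonneg (mul_nonneg (by linarith) (by linarith))
      (by positivity))
  have h2 : (1 - δ) * (1 - δ) / ((1 + δ) * S) * ((1 - δ) * S) = (1 - δ) ^ 3 / (1 + δ) := by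
    field_simp
  have h3 : 1 - 4 * δ ≤ (1 - δ) ^ 3 / (1 + δ) := by
    rw [le_div_iff₀ (by linarith)]
    nlinarith [mul_nonneg hδ hδ, mul_nonneg hδ (mul_nonneg hδ (sub_nonneg.2 hδ1))]
  linarith

/-! ### Accuracy of the sampler for good samples -/

section Output

variable {n s k j : ℕ} {τ : Tape n} {S : Finset (Fin n → Bool)} {φ : DNF n}

theorem one_sub_pow_numCycles_le {σ : ℝ} (hk : 0 < k) (hσ : 1 / 2 ^ coinLen n s k j ≤ σ)
    (hσ1 : σ ≤ 1) : (1 - σ) ^ numCycles n s k j ≤ 1 / (4 * k) := by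
  have hk0 : (0 : ℝ) < k := by exact_mod_cast hk
  have h1 : 1 - σ ≤ Real.exp (-σ) := by linarith [Real.add_one_le_exp (-σ)]
  have h2 : (4 * k : ℝ) ≤ numCycles n s k j * σ := by
    calc (4 * k : ℝ) = numCycles n s k j * (1 / 2 ^ coinLen n s k j) := by
          rw [numCycles]; push_cast; field_simp
      _ ≤ _ := mul_le_mul_of_nonneg_left hσ (by positivity)
  calc (1 - σ) ^ numCycles n s k j ≤ Real.exp (-σ) ^ numCycles n s k j :=
        pow_le_pow_left₀ (by linarith) h1 _
    _ = Real.exp (-(numCycles n s k j * σ)) := by rw [← Real.exp_nat_mul]; ring_nf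
    _ ≤ Real.exp (-(4 * k)) := Real.exp_le_exp.2 (by linarith)
    _ ≤ _ := by
      rw [Real.exp_neg, one_div]
      exact inv_anti₀ (by positivity) (by linarith [Real.add_one_le_exp (4 * k : ℝ)])

theorem GoodSamples.samplerCount_ge (h : GoodSamples S φ s k j τ.1) (hS : S.Nonempty)
    (hφ : S = Finset.univ.filter fun x => φ.eval x = true) (hs : φ.length ≤ s) (hk : 0 < k)
    {y : Fin n → Bool} (hy : y ∈ hypSet n s k j τ) :
    (1 - 1 / (4 * k : ℝ)) * (1 - 1 / (4 * k)) / (hypSet n s k j τ).card ≤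
      samplerCount (candRow (dims n s k j) τ) (candKeep (dims n s k j) τ) (dims n s k j).B
        (dims n s k j).N (n - maxFree (dims n s k j) τ) ((dims n s k j).L * (dims n s k j).B)
        (numInputs n s k j) y / 2 ^ numInputs n s k j := by
  have hs0 : 0 < s := by
    obtain ⟨T, hT, -⟩ := exists_dense_term hS hφ hs
    exact (List.length_pos_of_mem hT).trans_le hs
  have hk1 : (1 : ℝ) ≤ k := by exact_mod_cast hk
  have hF : maxFree (dims n s k j) τ ≤ n := maxFree_le
  set F := maxFree (dims n s k j) τ with hFdef
  set b := coinLen n s k j with hb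
  have hpos : (0 : ℝ) < (hypSet n s k j τ).card := by
    exact_mod_cast Finset.card_pos.2 ⟨y, hy⟩
  have hα : (2 : ℝ) ^ (n - F) / 2 ^ (n + b) = 1 / (2 ^ F * 2 ^ b) := by
    rw [div_eq_div_iff (by positivity) (by positivity), one_mul, pow_add,
      ← mul_assoc, ← pow_add, Nat.sub_add_cancel hF]
  have hcard : ((hypSet n s k j τ).card : ℝ) ≤ numCand n s k j * 2 ^ F := by
    exact_mod_cast card_hypSet_le
  have hcard2 : (2 : ℝ) ^ F ≤ (hypSet n s k j τ).card := by
    exact_mod_cast two_pow_maxFree_le (h.exists_candKeep hS hφ hs hk)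
  have hpow : (4 * (k * numCand n s k j) : ℝ) ≤ 2 ^ b := by
    exact_mod_cast Nat.le_pow_clog (b := 2) (by norm_num) _
  -- The acceptance probability of a cycle. The bounds `2 ^ F ≤ |H| ≤ B * 2 ^ F` place it between `2
  -- ^ (-b)` and `1/(4k)`.
  obtain ⟨σ, hσ⟩ : ∃ σ : ℝ, σ = 2 ^ (n - F) / 2 ^ (n + b) * (hypSet n s k j τ).card := ⟨_, rfl⟩
  have hσ1 : σ ≤ 1 / (4 * k) := by
    rw [hσ, hα, one_div_mul_eq_div, div_le_div_iff₀ (by positivity) (by positivity), one_mul]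
    calc ((hypSet n s k j τ).card : ℝ) * (4 * k) ≤ numCand n s k j * 2 ^ F * (4 * k) := by gcongr
      _ = 2 ^ F * (4 * (k * numCand n s k j)) := by ring
      _ ≤ _ := by gcongr
  have hσ2 : 1 / 2 ^ b ≤ σ := by
    rw [hσ, hα, one_div_mul_eq_div, div_le_div_iff₀ (by positivity) (by positivity), one_mul]
    gcongr
  have hδ1 : 1 / (4 * k : ℝ) ≤ 1 := by rw [div_le_one (by positivity)]; linarith
  have hσ0 : 0 ≤ σ := le_trans (by positivity) hσ2
  refine le_trans ?_ (samplerCount_lower_bound (n := n) (fun i v hv _ => candRow_of_le _ _ _ hv)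
    (Nat.le_add_right n b) (fun i hi hki => ?_) rfl hσ (hσ1.trans hδ1) hy (numCycles n s k j))
  · change _ ≤ (1 - σ) * (1 - (1 - σ) ^ numCycles n s k j) / (hypSet n s k j τ).card
    refine div_le_div_of_nonneg_right (mul_le_mul (by linarith) ?_ (by linarith) ?_) hpos.le
    · linarith [one_sub_pow_numCycles_le (n := n) (s := s) (j := j) hk hσ2 (hσ1.trans hδ1)]
    · linarith
  · have h1 := litCount_candRow (n := n) (s := s) (k := k) (j := j) (τ := τ) i
    have h2 := candFree_le_maxFree hi hki
    have h3 : (dims n s k j).N = n + b := rfl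
    rw [h3] at h1
    change n - F ≤ litCount (candRow (dims n s k j) τ i) (n + b)
    omega

theorem GoodSamples.tvDist_le {f : (Fin n → Bool) → Bool} (hf : ∃ x, f x = true)
    (hfφ : f = φ.eval) (h : GoodSamples (Finset.univ.filter fun x => f x = true) φ s k j τ.1)
    (hs : φ.length ≤ s) (hk : 0 < k) {g : (Fin (numInputs n s k j) → Bool) → Fin n → Bool}
    (hg : ∀ z v, g z v = samplerBit (candRow (dims n s k j) τ) (candKeep (dims n s k j) τ)
      (dims n s k j).B (dims n s k j).N (n - maxFree (dims n s k j) τ)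
      ((dims n s k j).L * (dims n s k j).B) v (padInput z)) :
    tvDist ((PMF.uniformOfFintype _).map g) (unifSat f hf) ≤ 1 / k := by
  set S := Finset.univ.filter fun x => f x = true with hSdef
  have hφ : S = Finset.univ.filter fun x => φ.eval x = true := by rw [hSdef, hfφ]
  have hS : S.Nonempty := by obtain ⟨x, hx⟩ := hf; exact ⟨x, by simp [hSdef, hx]⟩
  have hS0 : (0 : ℝ) < S.card := by exact_mod_cast hS.card_pos
  have hk1 : (1 : ℝ) ≤ k := by exact_mod_cast hk
  have h1 := h.card_hypSet_sdiff_le hS hφ hs hk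
  have h2 := h.card_sdiff_hypSet_le hS hφ hs hk
  set H := hypSet n s k j τ with hH
  have hA1 : ((S \ H).card : ℝ) + (S ∩ H).card = S.card := by
    exact_mod_cast Finset.card_sdiff_add_card_inter S H
  have hA2 : ((H \ S).card : ℝ) + (S ∩ H).card = H.card := by
    rw [Finset.inter_comm]; exact_mod_cast Finset.card_sdiff_add_card_inter H S
  have hA3 : ((S ∩ H).card : ℝ) ≤ S.card := by
    exact_mod_cast Finset.card_le_card Finset.inter_subset_left
  have hdiv : (S.card : ℝ) / (4 * k) = 1 / (4 * k) * S.card := by ring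
  rw [hdiv] at h1 h2
  set δ : ℝ := 1 / (4 * k) with hδ
  have hδ0 : 0 ≤ δ := by positivity
  have hδ1 : δ ≤ 1 := by rw [hδ, div_le_one (by positivity)]; linarith
  have hHle : (H.card : ℝ) ≤ (1 + δ) * S.card := by linarith
  have hc : ∀ y ∈ S ∩ H, (1 - δ) * (1 - δ) / ((1 + δ) * S.card) ≤
      (((PMF.uniformOfFintype _).map g) y).toReal := by
    intro y hy
    have hyH := (Finset.mem_inter.1 hy).2
    have hH0 : (0 : ℝ) < H.card := by exact_mod_cast Finset.card_pos.2 ⟨y, hyH⟩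
    refine (div_le_div_of_nonneg_left (mul_nonneg (by linarith) (by linarith)) hH0 hHle).trans
      ((h.samplerCount_ge hS hφ hs hk hyH).trans_eq ?_)
    rw [map_uniformOfFintype_toReal, Fintype.card_fun, Fintype.card_bool, Fintype.card_fin,
      samplerCount]
    push_cast
    congr 3
    refine Finset.filter_congr fun z _ => ?_
    have : g z = samplerPoint n (candRow (dims n s k j) τ) (candKeep (dims n s k j) τ)
      (dims n s k j).B (dims n s k j).N (n - maxFree (dims n s k j) τ)
      ((dims n s k j).L * (dims n s k j).B) z := funext fun v => hg z v
    rw [this]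
  have hu : ∀ y ∈ S ∩ H, (1 - δ) * (1 - δ) / ((1 + δ) * S.card) ≤
      (unifSat f hf y).toReal := by
    intro y hy
    have : (unifSat f hf y).toReal = 1 / S.card := by
      rw [unifSat, PMF.uniformOfFinset_apply_of_mem _ (Finset.mem_inter.1 hy).1]
      simp [hSdef]
    rw [this, div_le_div_iff₀ (by positivity) hS0]
    have : (1 - δ) * (1 - δ) ≤ 1 + δ := by nlinarith
    nlinarith
  refine (tvDist_le_one_sub _ _ (S ∩ H) hc hu).trans
    ((combine_bounds hS0 hδ0 hδ1 (by linarith)).trans_eq ?_)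
  rw [hδ]; field_simp

end Output

/-! ## Running time -/

/-- Each parameter is a product of a few factors bounded by `D`, so exponents add up. The largest
one, `16 = 7 + 9`, comes from `numEst`. -/
theorem Fits.pow {n s k j D : ℕ} (hs : 0 < s) (hk : 0 < k)
    (hD : D = invHit n s k + n + s + k + j + 2) : Fits n s k j (D ^ 16) := by
  have hsk : 0 < s * k := Nat.mul_pos hs hk
  have hD2 : 2 ≤ D := by omega
  have hle : ∀ {a b : ℕ}, a ≤ b → D ^ a ≤ D ^ b := fun h => Nat.pow_le_pow_right (by omega) h
  have hD1 : ∀ {x : ℕ}, x ≤ D → x ≤ D ^ 1 := fun h => by rwa [pow_one]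
  have hmul : ∀ {x y a b : ℕ}, x ≤ D ^ a → y ≤ D ^ b → x * y ≤ D ^ (a + b) := fun hx hy => by
    rw [pow_add]; exact Nat.mul_le_mul hx hy
  have h2 : 2 ≤ D ^ 1 := hD1 hD2
  have hW : invHit n s k ≤ D ^ 1 := hD1 (by omega)
  have hbase : 4 * (s * k) ≤ D ^ 1 :=
    (Nat.le_self_pow (by simp [blockLen]) _).trans hW
  have hkk : k ≤ s * k := Nat.le_mul_of_pos_left _ hs
  have h4k : 4 * k ≤ D ^ 1 := (Nat.mul_le_mul_left 4 hkk).trans hbase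
  have hjs : j + s + 1 ≤ D ^ 1 := hD1 (by omega)
  have hB : numCand n s k j ≤ D ^ 3 := hmul h2 (hmul hW hjs)
  have hB0 : 0 < numCand n s k j := numCand_pos hs hk
  have hkB : 4 * (k * numCand n s k j) ≤ D ^ 4 := by
    rw [← mul_assoc]; exact hmul h4k hB
  -- Rounding up to a power of two at most doubles `4kB`.
  have hpow : 2 ^ coinLen n s k j ≤ D ^ 5 := by
    have h1 : 1 < 4 * (k * numCand n s k j) := by
      have := Nat.mul_pos hk hB0; omega
    have h3 := Nat.pow_pred_clog_lt_self (b := 2) (by norm_num) h1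
    have h5 : 0 < coinLen n s k j := Nat.clog_pos (by norm_num) h1
    calc 2 ^ coinLen n s k j = 2 * 2 ^ (coinLen n s k j - 1) := by
          rw [← pow_succ', Nat.sub_add_cancel h5]
      _ ≤ D ^ (1 + 4) := hmul h2 (h3.le.trans hkB)
  have hb : coinLen n s k j ≤ D ^ 5 := Nat.lt_two_pow_self.le.trans hpow
  have hn : n ≤ D ^ 1 := hD1 (by omega)
  have hN : n + coinLen n s k j ≤ D ^ 6 := by
    have h1 : n ≤ D ^ 5 := hn.trans (hle (by norm_num))
    have h3 : 2 * D ^ 5 ≤ D ^ (1 + 5) := hmul h2 le_rfl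
    norm_num at h3; omega
  have hu : 2 * n + j + 2 ≤ D ^ 2 := by
    have h3 : 2 * D ≤ D ^ (1 + 1) := hmul h2 (hD1 le_rfl)
    norm_num at h3; omega
  have hH : invTol n s k j ≤ D ^ 7 := by
    have h8 : 8 ≤ D ^ 3 := Nat.pow_le_pow_left hD2 3
    calc invTol n s k j = 8 * (4 * (s * k) * numCand n s k j) := by rw [invTol]; ring
      _ ≤ D ^ (3 + (1 + 3)) := hmul h8 (hmul hbase hB)
  have he : slack n s k j ≤ D ^ 9 := hmul hH hu
  have hL : numCycles n s k j ≤ D ^ 6 := by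
    rw [numCycles, ← mul_assoc]; exact hmul h4k hpow
  exact
    { le_n := hn.trans (hle (by norm_num))
      le_k := (hD1 (by omega)).trans (hle (by norm_num))
      le_block := by
        have : Nat.clog 2 n ≤ n := Nat.clog_le_of_le_pow Nat.lt_two_pow_self.le
        exact (hD1 (by rw [blockLen]; omega)).trans (hle (by norm_num))
      le_base := hbase.trans (hle (by norm_num))
      le_js := hjs.trans (hle (by norm_num))
      le_B := hB.trans (hle (by norm_num))
      le_kB := hkB.trans (hle (by norm_num))
      le_u := hu.trans (hle (by norm_num))
      le_e := he.trans (hle (by norm_num))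
      le_m := hmul hH he
      le_L := hL.trans (hle (by norm_num))
      le_N := hN.trans (hle (by norm_num))
      le_Z := (hmul (hmul hL hB) hN).trans (hle (by norm_num))
      le_pow := hpow.trans (hle (by norm_num)) }

theorem one_le_logb_max (x : ℝ) : 1 ≤ Real.logb 2 (max x 2) := by
  rw [Real.le_logb_iff_rpow_le (by norm_num) (by positivity), Real.rpow_one]
  exact le_max_right _ _

theorem le_quasiPoly (n s : ℕ) (ε : ℝ) : max (n : ℝ) 2 ≤ quasiPoly n s ε := by
  have h : (1 : ℝ) ≤ max (n : ℝ) 2 := le_max_of_le_right (by norm_num)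
  calc max (n : ℝ) 2 = max (n : ℝ) 2 ^ (1 : ℝ) := (Real.rpow_one _).symm
    _ ≤ _ := Real.rpow_le_rpow_of_exponent_le h (one_le_logb_max _)

/-- The symmetry `a ^ log b = b ^ log a` converts `(s/ε) ^ log n`, the form in which the number of
blocks arises, into the required one. -/
theorem quasiPoly_eq (n s : ℕ) (ε : ℝ) :
    quasiPoly n s ε = max ((s : ℝ) / ε) 2 ^ Real.logb 2 (max (n : ℝ) 2) := by
  have h1 : (0 : ℝ) < max (n : ℝ) 2 := by positivity
  have h2 : (0 : ℝ) < max ((s : ℝ) / ε) 2 := by positivity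
  rw [quasiPoly, Real.rpow_def_of_pos h1, Real.rpow_def_of_pos h2, Real.logb, Real.logb]
  congr 1; ring

theorem le_quasiPoly' (n s : ℕ) (ε : ℝ) : max ((s : ℝ) / ε) 2 ≤ quasiPoly n s ε := by
  have h : (1 : ℝ) ≤ max ((s : ℝ) / ε) 2 := le_max_of_le_right (by norm_num)
  rw [quasiPoly_eq]
  calc max ((s : ℝ) / ε) 2 = max ((s : ℝ) / ε) 2 ^ (1 : ℝ) := (Real.rpow_one _).symm
    _ ≤ _ := Real.rpow_le_rpow_of_exponent_le h (one_le_logb_max _)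

theorem blockLen_le (n : ℕ) : (blockLen n : ℝ) ≤ 4 * Real.logb 2 (max (n : ℝ) 2) := by
  have h1 := one_le_logb_max n
  have h2 : (Nat.clog 2 n : ℝ) ≤ Real.logb 2 (max (n : ℝ) 2) + 1 := by
    rcases Nat.lt_or_ge 1 n with hn | hn
    · have h3 := Nat.pow_pred_clog_lt_self (b := 2) (by norm_num) hn
      have h4 : 0 < Nat.clog 2 n := Nat.clog_pos (by norm_num) hn
      have h5 : ((Nat.clog 2 n - 1 : ℕ) : ℝ) ≤ Real.logb 2 (max (n : ℝ) 2) := by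
        rw [Real.le_logb_iff_rpow_le (by norm_num) (by positivity), Real.rpow_natCast]
        exact le_max_of_le_left (by exact_mod_cast h3.le)
      rw [Nat.cast_sub h4, Nat.cast_one] at h5
      linarith
    · rw [Nat.clog_of_right_le_one hn]; push_cast; linarith
  rw [blockLen]; push_cast; linarith

/-- The base `4sk ≤ 8s/ε` is at most `R ^ 4` because `R ≥ 2`, and the exponent is at most `4 log n`;
hence `16 = 4 * 4`. -/
theorem invHit_le {n s : ℕ} {ε : ℝ} (hs : 0 < s) (hε : 0 < ε) (hε1 : ε ≤ 1) :
    (invHit n s ⌈1 / ε⌉₊ : ℝ) ≤ quasiPoly n s ε ^ 16 := by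
  set R := max ((s : ℝ) / ε) 2 with hR
  have hR2 : 2 ≤ R := le_max_right _ _
  have hs1 : (1 : ℝ) ≤ s := by exact_mod_cast hs
  have hk : (⌈1 / ε⌉₊ : ℝ) ≤ 2 / ε := by
    have h1 := (Nat.ceil_lt_add_one (by positivity : 0 ≤ 1 / ε)).le
    have h2 : 1 ≤ 1 / ε := by rw [le_div_iff₀ hε]; linarith
    calc (⌈1 / ε⌉₊ : ℝ) ≤ 1 / ε + 1 / ε := by linarith
      _ = _ := by ring
  have hbase : (4 * (s * ⌈1 / ε⌉₊) : ℝ) ≤ R ^ 4 := by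
    calc (4 * (s * ⌈1 / ε⌉₊) : ℝ) ≤ 4 * (s * (2 / ε)) := by gcongr
      _ = 8 * (s / ε) := by ring
      _ ≤ 8 * R := by gcongr; exact le_max_left _ _
      _ ≤ R ^ 3 * R := by
        gcongr
        calc (8 : ℝ) = 2 ^ 3 := by norm_num
          _ ≤ R ^ 3 := by gcongr
      _ = _ := by ring
  calc (invHit n s ⌈1 / ε⌉₊ : ℝ) = (4 * (s * ⌈1 / ε⌉₊) : ℝ) ^ blockLen n := by
        rw [invHit]; push_cast; rfl
    _ ≤ (R ^ 4) ^ blockLen n := pow_le_pow_left₀ (by positivity) hbase _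
    _ = R ^ (4 * blockLen n : ℝ) := by
      rw [← pow_mul, ← Real.rpow_natCast]; push_cast; rfl
    _ ≤ R ^ (Real.logb 2 (max (n : ℝ) 2) * 16) :=
      Real.rpow_le_rpow_of_exponent_le (by linarith) (by linarith [blockLen_le n])
    _ = _ := by
      rw [Real.rpow_mul (by linarith), quasiPoly_eq, ← hR]
      exact_mod_cast Real.rpow_natCast _ 16

theorem sum_params_le {n s : ℕ} {ε δ : ℝ} (hs : 0 < s) (hε : 0 < ε) (hε1 : ε ≤ 1) :
    ((invHit n s ⌈1 / ε⌉₊ + n + s + ⌈1 / ε⌉₊ + ⌈Real.logb 2 (1 / δ)⌉₊ + 2 : ℕ) : ℝ) ≤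
      (quasiPoly n s ε + logInv δ) ^ 18 := by
  have hW := invHit_le (n := n) hs hε hε1
  have hQR := le_quasiPoly' n s ε
  have hQM := le_quasiPoly n s ε
  have hs1 : (1 : ℝ) ≤ s := by exact_mod_cast hs
  have hn : (n : ℝ) ≤ quasiPoly n s ε := (le_max_left _ _).trans hQM
  have hQ2 : 2 ≤ quasiPoly n s ε := (le_max_right _ _).trans hQM
  have hr : s / ε ≤ quasiPoly n s ε := (le_max_left _ _).trans hQR
  have hsQ : (s : ℝ) ≤ quasiPoly n s ε := by
    refine le_trans ?_ hr
    rw [le_div_iff₀ hε]; nlinarith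
  have hk : (⌈1 / ε⌉₊ : ℝ) ≤ quasiPoly n s ε + 1 := by
    have h1 := (Nat.ceil_lt_add_one (by positivity : 0 ≤ 1 / ε)).le
    have h2 : 1 / ε ≤ s / ε := by gcongr
    linarith
  have hl : 1 ≤ logInv δ := le_max_right _ _
  have hj : (⌈Real.logb 2 (1 / δ)⌉₊ : ℝ) ≤ logInv δ + 1 := by
    have h1 : (⌈Real.logb 2 (1 / δ)⌉₊ : ℝ) ≤ ⌈logInv δ⌉₊ := by
      exact_mod_cast Nat.ceil_mono (le_max_left _ _)
    have h2 := (Nat.ceil_lt_add_one (by linarith : 0 ≤ logInv δ)).le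
    linarith
  set Q := quasiPoly n s ε
  set l := logInv δ
  have hY : 3 ≤ Q + l := by linarith
  have h16 : Q ^ 16 ≤ (Q + l) ^ 16 := pow_le_pow_left₀ (by linarith) (by linarith) _
  have h1 : Q + l ≤ (Q + l) ^ 16 := le_self_pow₀ (by linarith) (by norm_num)
  -- All summands together are at most `9 * (Q + l) ^ 16`, and `Q + l ≥ 3` turns the factor `9` into
  -- two more powers.
  have h2 : 9 * (Q + l) ^ 16 ≤ (Q + l) ^ 18 := by
    rw [show (Q + l) ^ 18 = (Q + l) ^ 2 * (Q + l) ^ 16 by ring]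
    gcongr
    nlinarith
  push_cast
  linarith

theorem time_le {c : ℕ} {t X : ℕ} {Y : ℝ} (ht : t ≤ X ^ c) (hX : (X : ℝ) ≤ Y ^ 288)
    (hY : 1 ≤ Y) : (t : ℝ) ≤ (288 * c + 1 : ℕ) * Y ^ (288 * c + 1) := by
  calc (t : ℝ) ≤ (X : ℝ) ^ c := by exact_mod_cast ht
    _ ≤ (Y ^ 288) ^ c := pow_le_pow_left₀ (by positivity) hX _
    _ = Y ^ (288 * c) := (pow_mul _ _ _).symm
    _ ≤ Y ^ (288 * c + 1) := pow_le_pow_right₀ hY (by omega)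
    _ ≤ _ := le_mul_of_one_le_left (by positivity) (by simp)

theorem generatorP_runsInTime : ∃ c : ℕ, RunsInTime generatorP DNFClass fun n s ε δ =>
    (c : ℝ) * (quasiPoly n s ε + logInv δ) ^ c := by
  obtain ⟨c, hc⟩ := generatorP.exists_cost_le_pow
  refine ⟨288 * c + 1, fun n s ε δ hε hδ f hf τ hτ => ?_⟩
  obtain ⟨φ, hφs, rfl⟩ := hf
  -- A formula without terms has no satisfying assignment, but the tape supplies one.
  have hs : 0 < s := by
    obtain ⟨T, hT, -⟩ := List.any_eq_true.1 (hτ 0)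
    exact (List.length_pos_of_mem hT).trans_le hφs
  have hk : 0 < ⌈1 / ε⌉₊ := Nat.ceil_pos.2 (by positivity)
  have hQM := le_quasiPoly n s ε
  have hQ2 : 2 ≤ quasiPoly n s ε := (le_max_right _ _).trans hQM
  have hn : (n : ℝ) ≤ quasiPoly n s ε := (le_max_left _ _).trans hQM
  have hl : 1 ≤ logInv δ := le_max_right _ _
  rcases Nat.lt_or_ge 1 ⌈1 / ε⌉₊ with h1 | h1
  · have hε1 : ε ≤ 1 := by
      rw [Nat.lt_ceil, Nat.cast_one, lt_div_iff₀ hε] at h1; linarith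
    obtain ⟨D, hD⟩ : ∃ D, D = invHit n s ⌈1 / ε⌉₊ + n + s + ⌈1 / ε⌉₊ +
      ⌈Real.logb 2 (1 / δ)⌉₊ + 2 := ⟨_, rfl⟩
    obtain ⟨st, t, he, ht, -⟩ := Wp.generatorP (τ := τ) (Fits.pow hs hk hD) h1
      (st := initState n s ε δ) rfl rfl rfl rfl (fun _ _ => rfl) rfl rfl
    refine ⟨st, t, he, time_le (ht.trans (hc _ ?_)) ?_ (by linarith)⟩
    · exact (by omega : 2 ≤ D).trans (Nat.le_self_pow (by norm_num) _)
    · rw [show 288 = 18 * 16 by norm_num, pow_mul, Nat.cast_pow]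
      refine pow_le_pow_left₀ (by positivity) ?_ _
      rw [hD]
      exact sum_params_le hs hε hε1
  · obtain ⟨st, t, he, ht, -⟩ := Wp.generatorP_trivial (τ := τ) (X := n + 2) (by omega) h1
      (st := initState n s ε δ) rfl rfl rfl
    refine ⟨st, t, he, time_le (ht.trans (hc _ (by omega))) ?_ (by linarith)⟩
    calc ((n + 2 : ℕ) : ℝ) ≤ (quasiPoly n s ε + logInv δ) ^ 2 := by push_cast; nlinarith
      _ ≤ _ := pow_le_pow_right₀ (by linarith) (by norm_num)

/-! ## Correctness -/

theorem generatorP_isInverseGenerator : IsInverseGenerator generatorP DNFClass := by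
  intro n s ε δ hε hδ f hf hsat
  obtain ⟨φ, hφs, hfφ⟩ := hf
  have hkε : 1 / (⌈1 / ε⌉₊ : ℝ) ≤ ε := by
    have h := Nat.le_ceil (1 / ε)
    have h1 : 0 < 1 / ε := by positivity
    rw [div_le_iff₀ hε] at h
    rw [div_le_iff₀ (h1.trans_le (Nat.le_ceil _))]; linarith
  rcases Nat.lt_or_ge 1 ⌈1 / ε⌉₊ with h1 | h1
  · set S := Finset.univ.filter fun x => f x = true with hSdef
    have hS : S.Nonempty := by obtain ⟨x, hx⟩ := hsat; exact ⟨x, by simp [hSdef, hx]⟩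
    have hφ : S = Finset.univ.filter fun x => φ.eval x = true := by rw [hSdef, hfφ]
    have hs : 0 < s := by
      obtain ⟨T, hT, -⟩ := exists_dense_term hS hφ hφs
      exact (List.length_pos_of_mem hT).trans_le hφs
    have hgood := sampleLaw_not_good hS hφ hφs (by omega : 0 < ⌈1 / ε⌉₊) ⌈Real.logb 2 (1 / δ)⌉₊
    set G := {ω | GoodSamples S φ s ⌈1 / ε⌉₊ ⌈Real.logb 2 (1 / δ)⌉₊ ω} with hG
    have hprob : ENNReal.ofReal (1 - δ) ≤ sampleLaw S hS G := by
      have hδj : ((1 : ℝ) / 2) ^ ⌈Real.logb 2 (1 / δ)⌉₊ ≤ δ := by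
        have h := Nat.le_ceil (Real.logb 2 (1 / δ))
        rw [Real.logb_le_iff_le_rpow (by norm_num) (by positivity), Real.rpow_natCast] at h
        rw [one_div, inv_pow]
        exact inv_le_of_inv_le₀ hδ (by rwa [← one_div δ])
      -- Subadditivity replaces the complement rule, so measurability of the good event is not
      -- needed.
      have hc : (1 : ℝ) ≤ (sampleLaw S hS).real G + (sampleLaw S hS).real Gᶜ := by
        have := measureReal_union_le (μ := sampleLaw S hS) G Gᶜ
        rwa [Set.union_compl_self, probReal_univ] at this
      rw [ENNReal.ofReal_le_iff_le_toReal (measure_ne_top _ _)]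
      change _ ≤ (sampleLaw S hS).real G
      change (sampleLaw S hS).real Gᶜ ≤ _ at hgood
      linarith
    have hprod : tapeLaw f hsat (G ×ˢ Set.univ) = sampleLaw S hS G := by
      change ((sampleLaw S hS).prod _) _ = _
      rw [Measure.prod_prod, measure_univ, mul_one]
    rw [← hprod] at hprob
    refine hprob.trans (measure_mono ?_)
    rintro τ ⟨hτ, -⟩
    obtain ⟨st, t, he, -, Gs, outs, hout, hev⟩ := Wp.generatorP (τ := τ)
      (Fits.pow hs (by omega : 0 < ⌈1 / ε⌉₊) rfl) h1
      (st := initState n s ε δ) rfl rfl rfl rfl (fun _ _ => rfl) rfl rfl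
    exact ⟨st, t, _, he, hout, _, rfl,
      (GoodSamples.tvDist_le hsat hfφ hτ hφs (by omega) hev).trans hkε⟩
  -- If `ε ≥ 1`, every circuit is an `ε`-sampler, so the trivial one will do for all samples.
  · have hε1 : 1 ≤ ε := by
      rw [ge_iff_le, Nat.ceil_le, Nat.cast_one, div_le_iff₀ hε] at h1; linarith
    have : {τ : Tape n | ∃ (st : State) (t : ℕ) (C : Circuit n),
        Exec τ generatorP (initState n s ε δ) st t ∧ st.out = C.encode ∧
          C.IsEpsSampler ε (unifSat f hsat)} = Set.univ := by
      refine Set.eq_univ_of_forall fun τ => ?_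
      obtain ⟨st, t, he, -, C, hC⟩ := Wp.generatorP_trivial (τ := τ) (X := n) le_rfl h1
        (st := initState n s ε δ) rfl rfl rfl
      exact ⟨st, t, C, he, hC, _, rfl, (tvDist_le_one _ _).trans hε1⟩
    have hp : IsProbabilityMeasure (tapeLaw f hsat) := by unfold tapeLaw; infer_instance
    rw [this, measure_univ]
    exact ENNReal.ofReal_le_one.2 (by linarith)

end InvGen

theorem theorem16 :
    ∃ P : InvGen.Prog,
      InvGen.IsInverseGenerator P InvGen.DNFClass ∧
      ∃ c : ℕ, InvGen.RunsInTime P InvGen.DNFClass fun n s ε δ =>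
        (c : ℝ) * (InvGen.quasiPoly n s ε + InvGen.logInv δ) ^ c :=
  ⟨InvGen.generatorP, InvGen.generatorP_isInverseGenerator, InvGen.generatorP_runsInTime⟩
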